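/- **Setting.** Let $U\subset\mathbb R^4$ be a non-empty connected open set, $g$ a (pseudo-Riemannian) Kähler metric on $U$ with Kähler form $\omega$, and let $J$ be defined by $\omega(X,Y)=g(JX,Y)$. For $v$ with $g(v,v)\neq0$ the holomorphic sectional curvature (HSC) of $\langle v,Jv\rangle$ is $K=R(v,Jv,v,Jv)/g(v,v)^2$, where $R$ is the Riemann curvature tensor of $g$; $g$ has *constant HSC* on $U$ if $K$ is the same number for all points of $U$ and all such $v$. Consider the following metrics on such sets $U$ on which the data are defined and the metric is non-degenerate; $\varepsilon\in\{\pm1\}$, $\beta\in\mathbb R$, the constants $c_i,d_i\in\mathbb R$ and $\varsigma\in\mathbb C$ are non-zero, and $G$ is a smooth function of $s_1$ without zeros. *(Liouville type)* In coordinates $(x_0,x_1,s_0,s_1)$, with $\rho_i=\rho_i(x_i)$, $F_i=F_i(x_i)$, $\rho_0\ne\rho_1$ on $U$, $$g=(\rho_0-\rho_1)(F_0^2dx_0^2+\varepsilon F_1^2dx_1^2)+\tfrac1{\rho_0-\rho_1}\Big[\big(\tfrac{\rho_0'}{F_0}\big)^2(ds_0+\rho_1ds_1)^2+\varepsilon\big(\tfrac{\rho_1'}{F_1}\big)^2(ds_0+\rho_0ds_1)^2\Big],$$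 $$\omega=\rho_0'\,dx_0\wedge(ds_0+\rho_1ds_1)+\rho_1'\,dx_1\wedge(ds_0+\rho_0ds_1),$$ where (L1) $\rho_i=x_i$, $F_i=c_i$; (L2) $\rho_i=c_ie^{(\beta-1)x_i}$, $F_i=d_ie^{-\frac12(\beta+2)x_i}$, $\beta\neq1$; (L3) $\rho_i=x_i$, $F_i=c_ie^{-\frac32x_i}$; (L4) $\rho_i=-\tan x_i$, $F_i=c_ie^{-\frac32\beta x_i}/\sqrt{|\cos x_i|}$. *(Complex type)* In coordinates $(z,\bar z,s_0,s_1)$, $z=x+iy$, with $\rho=\rho(z)$, $F=F(z)$, $\rho'=d\rho/dz$ and $\bar\rho\neq\rho$ on $U$, $$g=\tfrac14(\bar\rho-\rho)(F^2dz^2-\bar F^2d\bar z^2)+\tfrac4{\bar\rho-\rho}\Big[\big(\tfrac{\rho'}{F}\big)^2(ds_0+\bar\rho ds_1)^2-\big(\tfrac{\bar\rho'}{\bar F}\big)^2(ds_0+\rho ds_1)^2\Big],$$ $$\omega=\rho'\,dz\wedge(ds_0+\bar\rho ds_1)+\bar\rho'\,d\bar z\wedge(ds_0+\rho ds_1),$$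 where (C1) $\rho=z$, $F=\varsigma$; (C2) $\rho=e^{(\beta-1)z}$, $F=\varsigma e^{-\frac12(\beta+2)z}$, $\beta\neq1$; (C3) $\rho=z$, $F=\varsigma e^{-\frac32z}$; (C4) $\rho=-\tan z$, $F=\varsigma e^{-\frac32\beta z}/\sqrt{\cos z}$. *(Degenerate type)* In coordinates $(x_0,x_1,s_0,s_1)$, with $\rho=\rho(x_0)$, $F=F(x_0)$, $\theta=dx_1-\tau$, $\Omega=d\tau$, $$g=-\rho\,h+\rho F^2dx_0^2+\tfrac1\rho\big(\tfrac{\rho'}F\big)^2\theta^2,\qquad \omega=-\rho\,\Omega+\rho'\,dx_0\wedge\theta,$$ where (D1) $\rho=\frac1{x_0}$, $F=\frac{c_1}{\sqrt{|x_0|}}$, $\tau=s_0ds_1$, $h=G(s_1)ds_0^2+\frac1{G(s_1)}ds_1^2$; (D2a) $\rho=c_1e^{-3x_0}$, $F=d_1$, $\tau=s_0ds_1$, $h=G(s_1)ds_0^2+\frac1{G(s_1)}ds_1^2$; (D2b) $\rho=c_1e^{(\beta-1)x_0}$, $F=d_1e^{-\frac12(\beta+2)x_0}$, $\tau=-\frac1{\beta+2}e^{-(\beta+2)s_0}G(s_1)ds_1$,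 $h=e^{-(\beta+2)s_0}G(s_1)(ds_0^2+ds_1^2)$, $\beta\notin\{1,-2\}$; (D3) $\rho=\frac1{x_0}$, $F=\frac{c_1e^{-\frac32x_0}}{\sqrt{|x_0|}}$, $\tau=-\frac13e^{-3s_0}G(s_1)ds_1$, $h=e^{-3s_0}G(s_1)(ds_0^2+ds_1^2)$. **Theorem.** Among these metrics exactly the following have constant HSC: - (L1) with $\varepsilon=-1$ and $c_1=\pm c_0$; - (L2) with $\beta=-\frac12$ and $c_1=-\varepsilon c_0\frac{d_1^2}{d_0^2}$; or with $\beta=-2$, $\varepsilon=-1$ and $d_1=\pm d_0$; or with $\beta=0$, $\varepsilon=-1$ and $\frac{d_1}{c_1}=\pm\frac{d_0}{c_0}$ (for $\beta=0$ the metric is an L1 metric, with constants $\pm d_i/c_i$, in the coordinates $\rho_i$); - (C1) with $\operatorname{Re}\varsigma=0$ or $\operatorname{Im}\varsigma=0$; - (C2) with $\beta\in\{-\frac12,-2,0\}$, and $\operatorname{Re}\varsigma=0$ or $\operatorname{Im}\varsigma=0$ (for $\beta=0$ the metric is a C1 metric in the coordinate $\rho$); - (D1) with $h$ of vanishing Gauss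 curvature; - (D2a) with $h$ of constant Gauss curvature $-\frac{9}{d_1^2}$. All other metrics in the list (in particular all those of types L3, L4, C3, C4, D2b, D3) have non-constant HSC. -/

import Mathlib

open scoped Matrix

noncomputable section

/-- The partial derivative of `f` in the `i`-th coordinate at `p`. -/
def coordDeriv {n : ℕ} (i : Fin n) (f : (Fin n → ℝ) → ℝ) (p : Fin n → ℝ) : ℝ :=
  deriv (fun t : ℝ => f (Function.update p i t)) (p i)

/-- A field of bilinear forms in the coordinates of an open subset of `ℝⁿ`: the matrix `b p` stands
for `(X, Y) ↦ ∑ b p i j * X i * Y j`. -/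
abbrev FormField (n : ℕ) : Type := (Fin n → ℝ) → Matrix (Fin n) (Fin n) ℝ

/-- The Christoffel symbols `Γᵏᵢⱼ` of the Levi-Civita connection of `g`. -/
def christoffel {n : ℕ} (g : FormField n) (k i j : Fin n) (p : Fin n → ℝ) : ℝ :=
  (1 / 2) * ∑ l, (g p)⁻¹ k l *
    (coordDeriv i (fun q => g q j l) p + coordDeriv j (fun q => g q i l) p
      - coordDeriv l (fun q => g q i j) p)

/-- The components `Rˡₖᵢⱼ` of the Riemann curvature tensor: `R(∂ᵢ, ∂ⱼ) ∂ₖ = ∑ Rˡₖᵢⱼ ∂ₗ`, where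
`R(X, Y) = [∇_X, ∇_Y] - ∇_[X, Y]`. -/
def riemannTensor {n : ℕ} (g : FormField n) (l k i j : Fin n) (p : Fin n → ℝ) : ℝ :=
  coordDeriv i (christoffel g l j k) p - coordDeriv j (christoffel g l i k) p
    + ∑ m, (christoffel g l i m p * christoffel g m j k p
      - christoffel g l j m p * christoffel g m i k p)

/-- The covariant curvature tensor `R(X, Y, Z, W) = g(R(X, Y) W, Z)` at `p`, so that
`R(X, Y, X, Y)` is positive on round spheres. -/
def riemannForm {n : ℕ} (g : FormField n) (p X Y Z W : Fin n → ℝ) : ℝ :=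
  ∑ i, ∑ j, ∑ k, ∑ l, ∑ m,
    X i * Y j * W k * riemannTensor g l k i j p * g p l m * Z m

/-- The Gauss curvature of a metric in two coordinates. -/
def gaussCurvature (h : FormField 2) (q : Fin 2 → ℝ) : ℝ :=
  riemannForm h q ![1, 0] ![0, 1] ![1, 0] ![0, 1] / (h q).det

/-- The endomorphism field `J` determined by the metric `g` and the two-form `ω` through
`ω(X, Y) = g(J X, Y)`. -/
def complexStructure {n : ℕ} (g ω : FormField n) : FormField n :=
  fun p => (ω p * (g p)⁻¹)ᵀ

theorem complexStructure_spec {n : ℕ} (g ω : FormField n) (p : Fin n → ℝ)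
    (hg : IsUnit (g p).det) (X Y : Fin n → ℝ) :
    (complexStructure g ω p *ᵥ X) ⬝ᵥ (g p *ᵥ Y) = X ⬝ᵥ (ω p *ᵥ Y) := by
  rw [complexStructure, Matrix.mulVec_transpose, ← Matrix.dotProduct_mulVec, Matrix.mulVec_mulVec,
    Matrix.mul_assoc, Matrix.nonsing_inv_mul _ hg, Matrix.mul_one]

/-- The holomorphic sectional curvature of the plane spanned by `v` and `J v` (where
`g(v, v) ≠ 0`), for the metric `g` with Kähler form `ω`. -/
def holomorphicSectionalCurvature {n : ℕ} (g ω : FormField n) (p v : Fin n → ℝ) : ℝ :=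
  riemannForm g p v (complexStructure g ω p *ᵥ v) v (complexStructure g ω p *ᵥ v) /
    (v ⬝ᵥ (g p *ᵥ v)) ^ 2

/-- The metric `g` with Kähler form `ω` has constant holomorphic sectional curvature on `U`: one
value for all points of `U` and all non-degenerate `J`-invariant planes `⟨v, J v⟩`. -/
def HasConstantHSC {n : ℕ} (g ω : FormField n) (U : Set (Fin n → ℝ)) : Prop :=
  ∃ κ : ℝ, ∀ p ∈ U, ∀ v : Fin n → ℝ, v ⬝ᵥ (g p *ᵥ v) ≠ 0 →
    holomorphicSectionalCurvature g ω p v = κ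

/-- The symmetric square `α²` of a one-form. -/
def formSq {R : Type*} [CommRing R] (α : Fin 4 → R) : Matrix (Fin 4) (Fin 4) R :=
  Matrix.vecMulVec α α

/-- The wedge product `α ∧ β = α ⊗ β - β ⊗ α` of one-forms. -/
def formWedge {R : Type*} [CommRing R] (α β : Fin 4 → R) : Matrix (Fin 4) (Fin 4) R :=
  Matrix.vecMulVec α β - Matrix.vecMulVec β α

/-! ### Liouville type, in the coordinates `(x₀, x₁, s₀, s₁)` -/

/-- `(ρ₀-ρ₁)(F₀² dx₀² + ε F₁² dx₁²)
  + (ρ₀-ρ₁)⁻¹ ((ρ₀'/F₀)² (ds₀ + ρ₁ ds₁)² + ε (ρ₁'/F₁)² (ds₀ + ρ₀ ds₁)²)`. -/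
def liouvilleMetric (ε : ℝ) (ρ₀ ρ₁ F₀ F₁ : ℝ → ℝ) : FormField 4 := fun p =>
  (ρ₀ (p 0) - ρ₁ (p 1)) •
      (F₀ (p 0) ^ 2 • formSq ![1, 0, 0, 0] + (ε * F₁ (p 1) ^ 2) • formSq ![0, 1, 0, 0])
    + (1 / (ρ₀ (p 0) - ρ₁ (p 1))) •
      ((deriv ρ₀ (p 0) / F₀ (p 0)) ^ 2 • formSq ![0, 0, 1, ρ₁ (p 1)]
        + (ε * (deriv ρ₁ (p 1) / F₁ (p 1)) ^ 2) • formSq ![0, 0, 1, ρ₀ (p 0)])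

/-- `ρ₀' dx₀ ∧ (ds₀ + ρ₁ ds₁) + ρ₁' dx₁ ∧ (ds₀ + ρ₀ ds₁)`. -/
def liouvilleForm (ρ₀ ρ₁ : ℝ → ℝ) : FormField 4 := fun p =>
  deriv ρ₀ (p 0) • formWedge ![1, 0, 0, 0] ![0, 0, 1, ρ₁ (p 1)]
    + deriv ρ₁ (p 1) • formWedge ![0, 1, 0, 0] ![0, 0, 1, ρ₀ (p 0)]

/-! ### Complex type, in the real coordinates `(x, y, s₀, s₁)` with `z = x + i y` -/

/-- The complex coordinate `z = x + i y`. -/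
def zCoord (p : Fin 4 → ℝ) : ℂ := ⟨p 0, p 1⟩

/-- `dz = dx + i dy`. -/
def dz : Fin 4 → ℂ := ![1, Complex.I, 0, 0]

/-- `dz̄ = dx - i dy`. -/
def dzBar : Fin 4 → ℂ := ![1, -Complex.I, 0, 0]

/-- With `ρ = ρ(z)`, `ρ' = dρ/dz`, `F = F(z)`:
`¼ (ρ̄-ρ)(F² dz² - F̄² dz̄²)
  + 4 (ρ̄-ρ)⁻¹ ((ρ'/F)² (ds₀ + ρ̄ ds₁)² - (ρ̄'/F̄)² (ds₀ + ρ ds₁)²)`,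
as a complex matrix; its entries are real. -/
def complexTypeMatrix (ρ F : ℂ → ℂ) (p : Fin 4 → ℝ) : Matrix (Fin 4) (Fin 4) ℂ :=
  let r : ℂ := ρ (zCoord p)
  let rBar : ℂ := star r
  let f : ℂ := F (zCoord p)
  let fBar : ℂ := star f
  let r' : ℂ := deriv ρ (zCoord p)
  let rBar' : ℂ := star r'
  ((1 / 4) * (rBar - r)) • (f ^ 2 • formSq dz - fBar ^ 2 • formSq dzBar)
    + (4 / (rBar - r)) •
      ((r' / f) ^ 2 • formSq ![0, 0, 1, rBar] - (rBar' / fBar) ^ 2 • formSq ![0, 0, 1, r])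

/-- `ρ' dz ∧ (ds₀ + ρ̄ ds₁) + ρ̄' dz̄ ∧ (ds₀ + ρ ds₁)` as a complex matrix; its entries are real. -/
def complexTypeFormMatrix (ρ : ℂ → ℂ) (p : Fin 4 → ℝ) : Matrix (Fin 4) (Fin 4) ℂ :=
  let r : ℂ := ρ (zCoord p)
  let rBar : ℂ := star r
  let r' : ℂ := deriv ρ (zCoord p)
  let rBar' : ℂ := star r'
  r' • formWedge dz ![0, 0, 1, rBar] + rBar' • formWedge dzBar ![0, 0, 1, r]

theorem complexTypeMatrix_im (ρ F : ℂ → ℂ) (p : Fin 4 → ℝ) (i j : Fin 4) :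
    (complexTypeMatrix ρ F p i j).im = 0 := by
  rw [← Complex.conj_eq_iff_im]
  fin_cases i <;> fin_cases j <;>
    simp [complexTypeMatrix, formSq, dz, dzBar, Complex.conj_ofNat] <;> grind

theorem complexTypeFormMatrix_im (ρ : ℂ → ℂ) (p : Fin 4 → ℝ) (i j : Fin 4) :
    (complexTypeFormMatrix ρ p i j).im = 0 := by
  rw [← Complex.conj_eq_iff_im]
  fin_cases i <;> fin_cases j <;>
    simp [complexTypeFormMatrix, formWedge, dz, dzBar] <;> ring

/-- The metric of complex type. -/
def complexTypeMetric (ρ F : ℂ → ℂ) : FormField 4 := fun p =>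
  (complexTypeMatrix ρ F p).map Complex.re

/-- The Kähler form of complex type. -/
def complexTypeForm (ρ : ℂ → ℂ) : FormField 4 := fun p =>
  (complexTypeFormMatrix ρ p).map Complex.re

/-! ### Degenerate type, in the coordinates `(x₀, x₁, s₀, s₁)` -/

/-- The coordinates `(s₀, s₁)` of the base. -/
def baseCoord (p : Fin 4 → ℝ) : Fin 2 → ℝ := ![p 2, p 3]

/-- The one-forms `ds₀`, `ds₁`. -/
def baseCoframe : Fin 2 → (Fin 4 → ℝ) := ![![0, 0, 1, 0], ![0, 0, 0, 1]]

/-- `θ = dx₁ - τ`, where `τ = t(s₀, s₁) ds₁`. -/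
def thetaForm (t : (Fin 2 → ℝ) → ℝ) (p : Fin 4 → ℝ) : Fin 4 → ℝ :=
  ![0, 1, 0, -t (baseCoord p)]

/-- `-ρ h + ρ F² dx₀² + ρ⁻¹ (ρ'/F)² θ²`, where `ρ = ρ(x₀)`, `F = F(x₀)`,
`h = ∑ hᵢⱼ(s₀, s₁) dsᵢ dsⱼ`, `θ = dx₁ - t(s₀, s₁) ds₁`. -/
def degenerateMetric (ρ F : ℝ → ℝ) (t : (Fin 2 → ℝ) → ℝ) (h : FormField 2) : FormField 4 := fun p =>
  -(ρ (p 0) • ∑ i, ∑ j, h (baseCoord p) i j • Matrix.vecMulVec (baseCoframe i) (baseCoframe j))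
    + (ρ (p 0) * F (p 0) ^ 2) • formSq ![1, 0, 0, 0]
    + (1 / ρ (p 0) * (deriv ρ (p 0) / F (p 0)) ^ 2) • formSq (thetaForm t p)

/-- `-ρ Ω + ρ' dx₀ ∧ θ`, where `Ω = dτ = ∂t/∂s₀ ds₀ ∧ ds₁`; in all cases of the list `Ω` is an area
form of `h`. -/
def degenerateForm (ρ : ℝ → ℝ) (t : (Fin 2 → ℝ) → ℝ) : FormField 4 := fun p =>
  -((ρ (p 0) * coordDeriv 0 t (baseCoord p)) • formWedge ![0, 0, 1, 0] ![0, 0, 0, 1])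
    + deriv ρ (p 0) • formWedge ![1, 0, 0, 0] (thetaForm t p)

/-- `h = G(s₁) ds₀² + G(s₁)⁻¹ ds₁²`. -/
def baseMetricA (G : ℝ → ℝ) : FormField 2 := fun q => !![G (q 1), 0; 0, 1 / G (q 1)]

/-- `h = e^{-k s₀} G(s₁) (ds₀² + ds₁²)`. -/
def baseMetricB (k : ℝ) (G : ℝ → ℝ) : FormField 2 := fun q =>
  !![Real.exp (-k * q 0) * G (q 1), 0; 0, Real.exp (-k * q 0) * G (q 1)]

/-- `G` is smooth and without zeros on the interval of values of the coordinate `s₁` on `U`. -/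
def IsSmoothNonvanishing (G : ℝ → ℝ) (U : Set (Fin 4 → ℝ)) : Prop :=
  ContDiffOn ℝ (⊤ : ℕ∞) G ((fun p : Fin 4 → ℝ => p 3) '' U) ∧ ∀ p ∈ U, G (p 3) ≠ 0

end

/-! Two normal forms cover the list, and in each of them the curvature of one well-chosen plane `⟨v,
J v⟩` gives the necessary condition.

Liouville and complex types are both of the form `g = (a - b)(E dX² - e dY²) + (a - b)⁻¹ (A (ds₀ + b
ds₁)² - B (ds₀ + a ds₁)²)`, where `a, E, A` depend on `X` only, `b, e, B` on `Y` only, and `E A =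
a'²`, `e B = b'²`. In the complex type `X = z` and `Y = z̄`, and the coframe is complex. The plane
of `∂_X` has curvature `-1/2` times the second `a`-derivative of `(A - B)/(a - b)`
(`ortho_curvature_first`). If this is constant, then `B` is a cubic Taylor expression of `A` at `a`,
and the third derivative of `A` in `a` is constant (`OrthotoricChart.taylor_of_hasConstantHSC`).
Conversely, if `A` and `B` are the same polynomial of degree at most two in `a` and in `b`, the
metric is flat (`ortho_curvature_eq_zero`).

Up to constant factors, `A` is `exp (k a)` in the linear families, the power `a ^ (3β/(β-1))` in the
exponential ones, and `exp (3βz) / cos³ z` with `a = -tan z` in the last ones. The third derivative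
is constant only where it vanishes: for `k = 0`, and for the exponents 0, 1, 2, which are `β = 0,
-1/2, -2`; for real `β` it is never constant in the tangent families. It remains to equate the
coefficients of `A` and `B`. In the complex type they are conjugate, so that `ς²` must be real.

As `∂_z` is not a real vector, real test vectors do not suffice. The defect from constant curvature
is polynomial in the vector, so its vanishing extends to complex vectors
(`FrameJet.defect_eq_zero`).

For the degenerate type put `f = ρ⁻¹ (ρ'/F)²` and let `K` be the Gauss curvature of `h`. The
horizontal plane has curvature `-(ρ K + f)/ρ²` (`shear_curvature_base`). If this is a constant `κ`,
then `f/ρ + κ ρ = -K` does not depend on `x₀`. In D2b and D3 the function `f/ρ` is not affine in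
`ρ`, which excludes them. In D1 and D2a one has `f = a ρ² + b ρ`, which forces `κ = -a` and `K =
-b`; then all planes `⟨v, J v⟩` have curvature `-a` (`shear_curvature_constant`). -/

open Topology

/-! ### The curvature form as an algebraic function of the two-jet of the metric -/

/-- The first-kind Christoffel symbols `Γ_m(X, Y)` of a metric with first derivatives
`D i j k = ∂ᵢ gⱼₖ`. -/
def lowerChristoffel {n : ℕ} {R : Type*} [Field R] (D : Fin n → Fin n → Fin n → R)
    (X Y : Fin n → R) (m : Fin n) : R :=
  (1 / 2) * ∑ j, ∑ k, (D j k m + D k j m - D m j k) * X j * Y k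

/-- The quadrilinear form with coefficients `T`. -/
def quadrilinear {n : ℕ} {R : Type*} [Field R] (T : Fin n → Fin n → Fin n → Fin n → R)
    (X Y Z W : Fin n → R) : R :=
  ∑ i, ∑ j, ∑ k, ∑ l, T i j k l * X i * Y j * Z k * W l

/-- The covariant curvature form `g(R(X, Y) W, Z)` of a metric with inverse matrix `N`, first
derivatives `D i j k = ∂ᵢ gⱼₖ` and second derivatives `T i j k l = ∂ᵢ ∂ⱼ gₖₗ`. -/
def jetCurvature {n : ℕ} {R : Type*} [Field R] (N : Matrix (Fin n) (Fin n) R)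
    (D : Fin n → Fin n → Fin n → R) (T : Fin n → Fin n → Fin n → Fin n → R)
    (X Y Z W : Fin n → R) : R :=
  (1 / 2) * (quadrilinear T X W Y Z - quadrilinear T X Z Y W
      - quadrilinear T Y W X Z + quadrilinear T Y Z X W)
    - (lowerChristoffel D X Z ⬝ᵥ N *ᵥ lowerChristoffel D Y W
      - lowerChristoffel D Y Z ⬝ᵥ N *ᵥ lowerChristoffel D X W)

/-- The coefficients of `jetCurvature`. -/
def jetCurvatureCoeff {n : ℕ} {R : Type*} [Field R] (N : Matrix (Fin n) (Fin n) R)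
    (D : Fin n → Fin n → Fin n → R) (T : Fin n → Fin n → Fin n → Fin n → R)
    (i j k l : Fin n) : R :=
  (1 / 2) * (T i l j k - T i k j l - T j l i k + T j k i l)
    - ∑ m, ∑ r, (1 / 2) * N m r * ((1 / 2) *
      ((D i k m + D k i m - D m i k) * (D j l r + D l j r - D r j l)
        - (D j k m + D k j m - D m j k) * (D i l r + D l i r - D r i l)))

/-- Multilinearity. Both the comparison with `riemannForm` and the explicit computations in
dimension four are made coefficient by coefficient. -/
theorem jetCurvature_eq_sum {n : ℕ} {R : Type*} [Field R] (N : Matrix (Fin n) (Fin n) R)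
    (D : Fin n → Fin n → Fin n → R) (T : Fin n → Fin n → Fin n → Fin n → R)
    (X Y Z W : Fin n → R) :
    jetCurvature N D T X Y Z W
      = ∑ i, ∑ j, ∑ k, ∑ l, X i * Y j * Z k * W l * jetCurvatureCoeff N D T i j k l := by
  have hN : ∀ X Z Y W, lowerChristoffel D X Z ⬝ᵥ N *ᵥ lowerChristoffel D Y W
      = ∑ i, ∑ j, ∑ k, ∑ l, X i * Y j * Z k * W l * ∑ m, ∑ r, (1 / 2) * N m r * ((1 / 2) *
        ((D i k m + D k i m - D m i k) * (D j l r + D l j r - D r j l))) := by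
    intro X Z Y W
    -- The outer pair `(m, r)` and the inner quadruple are treated as two product indices, so that
    -- one exchange of sums reorders all six.
    have e : ∀ F : Fin n → Fin n → Fin n → Fin n → Fin n → Fin n → R,
        ∑ m, ∑ r, ∑ i, ∑ k, ∑ j, ∑ l, F m r i j k l
          = ∑ i, ∑ j, ∑ k, ∑ l, ∑ m, ∑ r, F m r i j k l := by
      intro F
      have e1 := Finset.sum_comm (s := (Finset.univ : Finset (Fin n × Fin n)))
        (t := (Finset.univ : Finset (Fin n × Fin n × Fin n × Fin n)))
        (f := fun x y => F x.1 x.2 y.1 y.2.2.1 y.2.1 y.2.2.2)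
      simp only [Fintype.sum_prod_type] at e1
      rw [e1]
      exact Finset.sum_congr rfl fun i _ => Finset.sum_comm
    have h1 : ∀ m r, lowerChristoffel D X Z m * (N m r * lowerChristoffel D Y W r)
        = ∑ i, ∑ k, ∑ j, ∑ l, X i * Y j * Z k * W l * ((1 / 2) * N m r * ((1 / 2) *
          ((D i k m + D k i m - D m i k) * (D j l r + D l j r - D r j l)))) := by
      intro m r
      simp only [lowerChristoffel]
      rw [Finset.mul_sum, Finset.sum_mul]
      refine Finset.sum_congr rfl fun i _ => ?_
      rw [Finset.mul_sum, Finset.sum_mul]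
      refine Finset.sum_congr rfl fun k _ => ?_
      simp only [Finset.mul_sum]
      exact Finset.sum_congr rfl fun j _ => Finset.sum_congr rfl fun l _ => by ring
    simp only [dotProduct, Matrix.mulVec, Finset.mul_sum]
    rw [← e]
    exact Finset.sum_congr rfl fun m _ => Finset.sum_congr rfl fun r _ => h1 m r
  have hQ1 : ∀ X Y, quadrilinear T X W Y Z
      = ∑ i, ∑ j, ∑ k, ∑ l, X i * Y j * Z k * W l * T i l j k := by
    intro X Y
    refine Finset.sum_congr rfl fun i _ => ?_
    rw [Finset.sum_comm]
    refine Finset.sum_congr rfl fun j _ => ?_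
    rw [Finset.sum_comm]
    exact Finset.sum_congr rfl fun k _ => Finset.sum_congr rfl fun l _ => by ring
  have hQ2 : ∀ X Y, quadrilinear T X Z Y W
      = ∑ i, ∑ j, ∑ k, ∑ l, X i * Y j * Z k * W l * T i k j l := by
    intro X Y
    refine Finset.sum_congr rfl fun i _ => ?_
    rw [Finset.sum_comm]
    exact Finset.sum_congr rfl fun j _ => Finset.sum_congr rfl fun k _ =>
      Finset.sum_congr rfl fun l _ => by ring
  rw [jetCurvature, hN X Z Y W, hN Y Z X W, hQ1 X Y, hQ1 Y X, hQ2 X Y, hQ2 Y X,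
    Finset.sum_comm (f := fun i j => ∑ k, ∑ l, Y i * X j * Z k * W l * T i k j l),
    Finset.sum_comm (f := fun i j => ∑ k, ∑ l, Y i * X j * Z k * W l * T i l j k),
    Finset.sum_comm (f := fun i j => ∑ k, ∑ l, Y i * X j * Z k * W l *
        ∑ m, ∑ r, (1 / 2) * N m r * ((1 / 2) *
        ((D i k m + D k i m - D m i k) * (D j l r + D l j r - D r j l))))]
  simp only [← Finset.sum_sub_distrib, ← Finset.sum_add_distrib]
  rw [Finset.mul_sum, ← Finset.sum_sub_distrib]
  refine Finset.sum_congr rfl fun i _ => ?_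
  rw [Finset.mul_sum, ← Finset.sum_sub_distrib]
  refine Finset.sum_congr rfl fun j _ => ?_
  rw [Finset.mul_sum, ← Finset.sum_sub_distrib]
  refine Finset.sum_congr rfl fun k _ => ?_
  rw [Finset.mul_sum, ← Finset.sum_sub_distrib]
  refine Finset.sum_congr rfl fun l _ => ?_
  simp only [jetCurvatureCoeff, mul_sub (1 / 2 : R) (_ * _) (_ * _), mul_sub (_ * _ : R) (1 / 2 * _),
    Finset.sum_sub_distrib]
  ring

/-! ### From Christoffel symbols to the two-jet formula -/

section
variable {n : ℕ}

theorem differentiableAt_matrix_det {M : ℝ → Matrix (Fin n) (Fin n) ℝ} {t : ℝ}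
    (hM : ∀ i j, DifferentiableAt ℝ (fun s => M s i j) t) :
    DifferentiableAt ℝ (fun s => (M s).det) t := by
  simp only [Matrix.det_apply]
  fun_prop

/-- By Cramer's rule the entries are determinants divided by `det`. Only differentiability is needed
later; the derivative of the inverse is never computed. -/
theorem differentiableAt_matrix_inv_apply {M : ℝ → Matrix (Fin n) (Fin n) ℝ} {t : ℝ}
    (hM : ∀ i j, DifferentiableAt ℝ (fun s => M s i j) t) (h0 : (M t).det ≠ 0) (i j : Fin n) :
    DifferentiableAt ℝ (fun s => (M s)⁻¹ i j) t := by
  simp only [Matrix.inv_def, Matrix.smul_apply, Ring.inverse_eq_inv', smul_eq_mul,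
    Matrix.adjugate_apply]
  refine ((differentiableAt_matrix_det hM).inv h0).mul (differentiableAt_matrix_det fun k l => ?_)
  by_cases hk : k = j
  · subst hk; simp
  · simpa [Matrix.updateRow_apply, hk] using hM k l

variable {g : FormField n} {U : Set (Fin n → ℝ)} {p : Fin n → ℝ}
  {dg : Fin n → Fin n → Fin n → (Fin n → ℝ) → ℝ}
  {ddg : Fin n → Fin n → Fin n → Fin n → ℝ}

theorem eventually_update_mem (hU : IsOpen U) (hp : p ∈ U) (i : Fin n) :
    ∀ᶠ t in 𝓝 (p i), Function.update p i t ∈ U := by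
  have h : Filter.Tendsto (fun t : ℝ => Function.update p i t) (𝓝 (p i)) (𝓝 p) := by
    have : Continuous fun t : ℝ => Function.update p i t := by fun_prop
    simpa using this.tendsto (p i)
  exact h (hU.mem_nhds hp)

/-- Lowering the index cancels the inverse matrix and leaves the Christoffel symbols of the first
kind, which are linear in the first derivatives of the metric. -/
theorem sum_mul_christoffel (hdet : (g p).det ≠ 0)
    (hg : ∀ i j k, HasDerivAt (fun t => g (Function.update p i t) j k) (dg i j k p) (p i))
    (l i j : Fin n) :
    ∑ m, g p l m * christoffel g m i j p
      = (1 / 2) * (dg i j l p + dg j i l p - dg l i j p) := by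
  have h : ∀ m, christoffel g m i j p
      = ∑ l, (g p)⁻¹ m l * ((1 / 2) * (dg i j l p + dg j i l p - dg l i j p)) := by
    intro m
    simp only [christoffel, coordDeriv, (hg _ _ _).deriv, Finset.mul_sum]
    exact Finset.sum_congr rfl fun _ _ => by ring
  have h2 : (fun m => christoffel g m i j p)
      = (g p)⁻¹ *ᵥ fun l => ((1 / 2) * (dg i j l p + dg j i l p - dg l i j p)) := by
    funext m; rw [h]; rfl
  have h3 : g p *ᵥ (fun m => christoffel g m i j p)
      = fun l => ((1 / 2) * (dg i j l p + dg j i l p - dg l i j p)) := by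
    rw [h2, Matrix.mulVec_mulVec, Matrix.mul_nonsing_inv _ (isUnit_iff_ne_zero.2 hdet),
      Matrix.one_mulVec]
  exact congrFun h3 l

theorem christoffel_eq (hg : ∀ i j k, HasDerivAt (fun t => g (Function.update p i t) j k)
    (dg i j k p) (p i)) (m i j : Fin n) :
    christoffel g m i j p
      = ∑ l, (g p)⁻¹ m l * ((1 / 2) * (dg i j l p + dg j i l p - dg l i j p)) := by
  simp only [christoffel, coordDeriv, (hg _ _ _).deriv, Finset.mul_sum]
  exact Finset.sum_congr rfl fun _ _ => by ring

/-- The product `g Γ` is a Christoffel symbol of the first kind. The product rule for it isolates `g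
∂Γ` without any derivative of `g⁻¹`. -/
theorem sum_mul_coordDeriv_christoffel (hU : IsOpen U) (hp : p ∈ U)
    (hdet : (g p).det ≠ 0)
    (hg : ∀ q ∈ U, ∀ i j k,
      HasDerivAt (fun t => g (Function.update q i t) j k) (dg i j k q) (q i))
    (hdg : ∀ l i j k,
      HasDerivAt (fun t => dg i j k (Function.update p l t)) (ddg l i j k) (p l))
    (l e i j : Fin n) :
    ∑ m, g p l m * coordDeriv e (christoffel g m i j) p
      = (1 / 2) * (ddg e i j l + ddg e j i l - ddg e l i j)
        - ∑ m, dg e l m p * christoffel g m i j p := by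
  have hC : ∀ m, DifferentiableAt ℝ (fun t => christoffel g m i j (Function.update p e t))
      (p e) := by
    intro m
    have : (fun t => christoffel g m i j (Function.update p e t)) =ᶠ[𝓝 (p e)] fun t =>
        ∑ l, (g (Function.update p e t))⁻¹ m l * ((1 / 2) * (dg i j l (Function.update p e t)
          + dg j i l (Function.update p e t) - dg l i j (Function.update p e t))) := by
      filter_upwards [eventually_update_mem hU hp e] with t ht
      exact christoffel_eq (hg _ ht) m i j
    refine DifferentiableAt.congr_of_eventuallyEq ?_ this
    have h1 : ∀ l, DifferentiableAt ℝ (fun t => (g (Function.update p e t))⁻¹ m l) (p e) :=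
      fun l => differentiableAt_matrix_inv_apply
        (fun i j => (hg p hp e i j).differentiableAt) (by simpa using hdet) m l
    have h2 : ∀ i j k, DifferentiableAt ℝ (fun t => dg i j k (Function.update p e t)) (p e) :=
      fun i j k => (hdg e i j k).differentiableAt
    exact DifferentiableAt.fun_sum fun l _ => (h1 l).mul
      ((((h2 i j l).add (h2 j i l)).sub (h2 l i j)).const_mul _)
  have h1 : HasDerivAt (fun t => ∑ m, g (Function.update p e t) l m
        * christoffel g m i j (Function.update p e t))
      (∑ m, (dg e l m p * christoffel g m i j p
        + g p l m * coordDeriv e (christoffel g m i j) p)) (p e) := by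
    refine HasDerivAt.fun_sum fun m _ => ?_
    have := (hg p hp e l m).fun_mul (hC m).hasDerivAt
    simpa [coordDeriv] using this
  -- The same function is differentiated again through its expression by first derivatives of `g`,
  -- valid near `p` where the determinant stays non-zero.
  have h2 : HasDerivAt (fun t => ∑ m, g (Function.update p e t) l m
        * christoffel g m i j (Function.update p e t))
      ((1 / 2) * (ddg e i j l + ddg e j i l - ddg e l i j)) (p e) := by
    refine (((hdg e i j l).add (hdg e j i l)).sub (hdg e l i j)).const_mul (1 / 2 : ℝ)
      |>.congr_of_eventuallyEq ?_
    have hdet' : ∀ᶠ t in 𝓝 (p e), (g (Function.update p e t)).det ≠ 0 :=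
      (differentiableAt_matrix_det fun i j =>
        (hg p hp e i j).differentiableAt).continuousAt.eventually_ne (by simpa using hdet)
    filter_upwards [eventually_update_mem hU hp e, hdet'] with t ht ht'
    exact sum_mul_christoffel ht' (hg _ ht) l i j
  have h3 := h1.unique h2
  rw [Finset.sum_add_distrib] at h3
  linarith

/-- The terms `∂g · Γ` left over by the product rule split by metric compatibility. One half cancels
the products `ΓΓ` in the definition of the curvature, the other half remains. -/
theorem sum_mul_riemannTensor (hU : IsOpen U) (hp : p ∈ U)
    (hdet : (g p).det ≠ 0)
    (hg : ∀ q ∈ U, ∀ i j k,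
      HasDerivAt (fun t => g (Function.update q i t) j k) (dg i j k q) (q i))
    (hdg : ∀ l i j k,
      HasDerivAt (fun t => dg i j k (Function.update p l t)) (ddg l i j k) (p l))
    (hs : ∀ i j k, dg i j k p = dg i k j p) (hss : ∀ i j k l, ddg i j k l = ddg j i k l)
    (l k i j : Fin n) :
    ∑ m, g p l m * riemannTensor g m k i j p
      = (1 / 2) * (ddg i k j l - ddg i l j k - ddg j k i l + ddg j l i k)
        - ∑ m, ((1 / 2) * (dg i l m p + dg l i m p - dg m i l p) * christoffel g m j k p
          - (1 / 2) * (dg j l m p + dg l j m p - dg m j l p) * christoffel g m i k p) := by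
  have key : ∀ i j, ∑ m, g p l m * ∑ r, christoffel g m i r p * christoffel g r j k p
      = ∑ r, (1 / 2) * (dg i r l p + dg r i l p - dg l i r p) * christoffel g r j k p := by
    intro i j
    simp only [Finset.mul_sum]
    rw [Finset.sum_comm]
    refine Finset.sum_congr rfl fun r _ => ?_
    rw [← sum_mul_christoffel (hdet) (hg p hp), Finset.sum_mul]
    exact Finset.sum_congr rfl fun _ _ => by ring
  have e0 : ∑ m, g p l m * riemannTensor g m k i j p
      = ∑ m, g p l m * coordDeriv i (christoffel g m j k) p
        - ∑ m, g p l m * coordDeriv j (christoffel g m i k) p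
        + (∑ m, g p l m * ∑ r, christoffel g m i r p * christoffel g r j k p
          - ∑ m, g p l m * ∑ r, christoffel g m j r p * christoffel g r i k p) := by
    simp only [riemannTensor, ← Finset.sum_sub_distrib, ← Finset.sum_add_distrib, ← mul_sub,
      ← mul_add]
  rw [e0, Finset.sum_sub_distrib]
  rw [sum_mul_coordDeriv_christoffel hU hp hdet hg hdg,
    sum_mul_coordDeriv_christoffel hU hp hdet hg hdg, key, key]
  -- Metric compatibility: `∂ᵢ g_{lm}` is the sum of the two first-kind symbols obtained by
  -- exchanging `l` and `m`.
  have e1 : ∀ i j, ∑ m, dg i l m p * christoffel g m j k p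
      = ∑ r, (1 / 2) * (dg i r l p + dg r i l p - dg l i r p) * christoffel g r j k p
      + ∑ m, (1 / 2) * (dg i l m p + dg l i m p - dg m i l p) * christoffel g m j k p := by
    intro i j
    rw [← Finset.sum_add_distrib]
    refine Finset.sum_congr rfl fun m _ => ?_
    rw [hs i m l, hs m i l, hs l i m, hs l m i]
    ring
  rw [e1 i j, e1 j i, hss i j]
  ring

theorem riemannForm_eq_jetCurvature (hU : IsOpen U) (hp : p ∈ U)
    (hdet : (g p).det ≠ 0)
    (hg : ∀ q ∈ U, ∀ i j k,
      HasDerivAt (fun t => g (Function.update q i t) j k) (dg i j k q) (q i))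
    (hdg : ∀ l i j k,
      HasDerivAt (fun t => dg i j k (Function.update p l t)) (ddg l i j k) (p l))
    (hsymm : (g p).IsSymm)
    (hs : ∀ i j k, dg i j k p = dg i k j p) (hss : ∀ i j k l, ddg i j k l = ddg j i k l)
    (X Y Z W : Fin n → ℝ) :
    riemannForm g p X Y Z W
      = jetCurvature (g p)⁻¹ (fun i j k => dg i j k p) ddg X Y Z W := by
  have h1 : riemannForm g p X Y Z W = ∑ i, ∑ j, ∑ k, ∑ l, X i * Y j * W k * Z l *
      ∑ m, g p l m * riemannTensor g m k i j p := by
    simp only [riemannForm]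
    refine Finset.sum_congr rfl fun i _ => Finset.sum_congr rfl fun j _ =>
      Finset.sum_congr rfl fun k _ => ?_
    rw [Finset.sum_comm]
    refine Finset.sum_congr rfl fun m _ => ?_
    rw [Finset.mul_sum]
    refine Finset.sum_congr rfl fun l _ => ?_
    rw [← hsymm.apply l m]
    ring
  rw [h1, jetCurvature_eq_sum]
  refine Finset.sum_congr rfl fun i _ => Finset.sum_congr rfl fun j _ => ?_
  rw [Finset.sum_comm]
  refine Finset.sum_congr rfl fun k _ => Finset.sum_congr rfl fun l _ => ?_
  rw [sum_mul_riemannTensor hU hp hdet hg hdg hs hss, jetCurvatureCoeff]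
  simp only [christoffel_eq (hg p hp), Finset.mul_sum, ← Finset.sum_sub_distrib]
  rw [show X i * Y j * W l * Z k = X i * Y j * Z k * W l by ring]
  congr 2
  refine Finset.sum_congr rfl fun m _ => Finset.sum_congr rfl fun r _ => ?_
  ring
end

/-! ### Derivatives along a constant complex frame -/

/-- `f` has derivative `d a` along the `a`-th vector of the constant complex frame whose dual
coframe has the matrix `Q`. -/
def HasFrameGrad {n : ℕ} (Q : Matrix (Fin n) (Fin n) ℂ) (f : (Fin n → ℝ) → ℂ) (d : Fin n → ℂ)
    (p : Fin n → ℝ) : Prop :=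
  ∀ i, HasDerivAt (fun t : ℝ => f (Function.update p i t)) (∑ a, d a * Q a i) (p i)

namespace HasFrameGrad
variable {n : ℕ} {P Q : Matrix (Fin n) (Fin n) ℂ} {f g : (Fin n → ℝ) → ℂ} {d e : Fin n → ℂ}
  {p : Fin n → ℝ} {U : Set (Fin n → ℝ)}

theorem const (c : ℂ) : HasFrameGrad Q (fun _ => c) (fun _ => 0) p := fun i => by
  simpa using hasDerivAt_const (p i) c

theorem add (hf : HasFrameGrad Q f d p) (hg : HasFrameGrad Q g e p) :
    HasFrameGrad Q (fun q => f q + g q) (fun a => d a + e a) p := fun i => by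
  simpa [add_mul, Finset.sum_add_distrib] using (hf i).fun_add (hg i)

theorem sub (hf : HasFrameGrad Q f d p) (hg : HasFrameGrad Q g e p) :
    HasFrameGrad Q (fun q => f q - g q) (fun a => d a - e a) p := fun i => by
  simpa [sub_mul, Finset.sum_sub_distrib] using (hf i).fun_sub (hg i)

theorem mul (hf : HasFrameGrad Q f d p) (hg : HasFrameGrad Q g e p) :
    HasFrameGrad Q (fun q => f q * g q) (fun a => d a * g p + f p * e a) p := fun i => by
  have := (hf i).fun_mul (hg i)
  refine this.congr_deriv ?_
  simp only [Function.update_eq_self, add_mul, Finset.sum_add_distrib, Finset.mul_sum,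
    Finset.sum_mul]
  congr 1 <;> exact Finset.sum_congr rfl fun _ _ => by ring

theorem comp {φ : ℂ → ℂ} {φ' : ℂ} (hf : HasFrameGrad Q f d p) (hφ : HasDerivAt φ φ' (f p)) :
    HasFrameGrad Q (fun q => φ (f q)) (fun a => φ' * d a) p := fun i => by
  have hφ' : HasDerivAt φ φ' ((fun t : ℝ => f (Function.update p i t)) (p i)) := by simpa using hφ
  have := hφ'.comp (p i) (hf i)
  simpa [Function.comp_def, Finset.mul_sum, mul_assoc] using this

theorem congr_grad (hf : HasFrameGrad Q f d p) (h : ∀ a, e a = d a) : HasFrameGrad Q f e p := by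
  rwa [funext h]

theorem neg (hf : HasFrameGrad Q f d p) :
    HasFrameGrad Q (fun q => -f q) (fun a => -d a) p := by
  simpa using hf.comp (hasDerivAt_neg (f p))

theorem inv (hf : HasFrameGrad Q f d p) (h0 : f p ≠ 0) :
    HasFrameGrad Q (fun q => (f q)⁻¹) (fun a => -d a / f p ^ 2) p := by
  have := hf.comp (hasDerivAt_inv h0)
  convert this using 2
  ring

theorem div (hf : HasFrameGrad Q f d p) (hg : HasFrameGrad Q g e p) (h0 : g p ≠ 0) :
    HasFrameGrad Q (fun q => f q / g q) (fun a => (d a * g p - f p * e a) / g p ^ 2) p := by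
  refine (hf.mul (hg.inv h0)).congr_grad fun a => ?_
  field_simp
  ring

theorem congr_fun (hf : HasFrameGrad Q f d p) (hU : IsOpen U) (hp : p ∈ U)
    (h : ∀ q ∈ U, g q = f q) : HasFrameGrad Q g d p := fun i =>
  (hf i).congr_of_eventuallyEq <| by
    filter_upwards [eventually_update_mem hU hp i] with t ht using h _ ht

/-- Coordinate derivatives are unique and `Q` is invertible. Together with `congr_fun` this is the
device for differentiating an identity between functions on an open set. -/
theorem unique (hQP : Q * P = 1) (hf : HasFrameGrad Q f d p) (hg : HasFrameGrad Q f e p) :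
    d = e := by
  have h : d ᵥ* Q = e ᵥ* Q := funext fun i => (hf i).unique (hg i)
  simpa [Matrix.vecMul_vecMul, hQP] using congrArg (· ᵥ* P) h

end HasFrameGrad

/-- The real part is a continuous linear map. The second assertion says that a derivative computed
in a complex frame is automatically real. -/
theorem hasDerivAt_of_ofReal {f : ℝ → ℝ} {z : ℂ} {t : ℝ}
    (h : HasDerivAt (fun s => (f s : ℂ)) z t) : HasDerivAt f z.re t ∧ (z.re : ℂ) = z := by
  have h1 : HasDerivAt f z.re t := by
    exact Complex.reCLM.hasFDerivAt.comp_hasDerivAt t h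
  exact ⟨h1, h1.ofReal_comp.unique h⟩

/-! ### Behaviour of the curvature formula under a constant change of frame -/

section
variable {n : ℕ} {R : Type*} [Field R]

/-- The trilinear form with coefficients `D`. -/
def trilinear (D : Fin n → Fin n → Fin n → R) (X Y Z : Fin n → R) : R :=
  ∑ i, ∑ j, ∑ k, D i j k * X i * Y j * Z k

/-- The pull-back of a tensor of degree three. -/
def pullThree (Q : Matrix (Fin n) (Fin n) R) (D : Fin n → Fin n → Fin n → R) (i j k : Fin n) : R :=
  ∑ a, ∑ b, ∑ c, D a b c * Q a i * Q b j * Q c k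

/-- The pull-back of a tensor of degree four. -/
def pullFour (Q : Matrix (Fin n) (Fin n) R) (T : Fin n → Fin n → Fin n → Fin n → R)
    (i j k l : Fin n) : R :=
  ∑ a, ∑ b, ∑ c, ∑ d, T a b c d * Q a i * Q b j * Q c k * Q d l

theorem mul_sum_mul_sum_mul_sum (c : R) (u v w : Fin n → R) :
    c * (∑ i, u i) * (∑ j, v j) * (∑ k, w k) = ∑ i, ∑ j, ∑ k, c * u i * v j * w k := by
  rw [Finset.mul_sum Finset.univ u c, Finset.sum_mul, Finset.sum_mul]
  refine Finset.sum_congr rfl fun i _ => ?_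
  rw [Finset.mul_sum Finset.univ v, Finset.sum_mul]
  exact Finset.sum_congr rfl fun j _ => Finset.mul_sum _ _ _

theorem sum_three_mul_sum (u : Fin n → Fin n → Fin n → R) (v : Fin n → R) :
    (∑ i, ∑ j, ∑ k, u i j k) * (∑ l, v l) = ∑ i, ∑ j, ∑ k, ∑ l, u i j k * v l := by
  simp only [Finset.sum_mul]
  exact Finset.sum_congr rfl fun i _ => Finset.sum_congr rfl fun j _ =>
    Finset.sum_congr rfl fun k _ => Finset.mul_sum _ _ _

theorem trilinear_pullThree (Q : Matrix (Fin n) (Fin n) R) (D : Fin n → Fin n → Fin n → R)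
    (X Y Z : Fin n → R) :
    trilinear (pullThree Q D) X Y Z = trilinear D (Q *ᵥ X) (Q *ᵥ Y) (Q *ᵥ Z) := by
  -- Exchange of the index triple of the tensor with the index triple of the vectors, both as
  -- product indices.
  have e := Finset.sum_comm (s := (Finset.univ : Finset (Fin n × Fin n × Fin n)))
    (t := (Finset.univ : Finset (Fin n × Fin n × Fin n)))
    (f := fun x y => D y.1 y.2.1 y.2.2 * (Q y.1 x.1 * X x.1) * (Q y.2.1 x.2.1 * Y x.2.1)
      * (Q y.2.2 x.2.2 * Z x.2.2))
  simp only [Fintype.sum_prod_type] at e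
  simp only [trilinear, pullThree, Matrix.mulVec, dotProduct, mul_sum_mul_sum_mul_sum]
  rw [← e]
  simp only [Finset.sum_mul]
  congr! 6
  ring

theorem quadrilinear_pullFour (Q : Matrix (Fin n) (Fin n) R)
    (T : Fin n → Fin n → Fin n → Fin n → R) (X Y Z W : Fin n → R) :
    quadrilinear (pullFour Q T) X Y Z W
      = quadrilinear T (Q *ᵥ X) (Q *ᵥ Y) (Q *ᵥ Z) (Q *ᵥ W) := by
  have e := Finset.sum_comm (s := (Finset.univ : Finset (Fin n × Fin n × Fin n × Fin n)))
    (t := (Finset.univ : Finset (Fin n × Fin n × Fin n × Fin n)))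
    (f := fun x y => T y.1 y.2.1 y.2.2.1 y.2.2.2 * (Q y.1 x.1 * X x.1)
      * (Q y.2.1 x.2.1 * Y x.2.1) * (Q y.2.2.1 x.2.2.1 * Z x.2.2.1)
      * (Q y.2.2.2 x.2.2.2 * W x.2.2.2))
  simp only [Fintype.sum_prod_type] at e
  simp only [quadrilinear, pullFour, Matrix.mulVec, dotProduct, mul_sum_mul_sum_mul_sum, sum_three_mul_sum]
  rw [← e]
  simp only [Finset.sum_mul]
  congr! 8
  ring

/-- This is Koszul's formula for constant vector fields; it expresses the Christoffel symbols by the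
trilinear form of `D`, whose pull-back is evident. -/
theorem lowerChristoffel_dotProduct (D : Fin n → Fin n → Fin n → R) (X Y Z : Fin n → R) :
    lowerChristoffel D X Y ⬝ᵥ Z
      = (1 / 2) * (trilinear D X Y Z + trilinear D Y X Z - trilinear D Z X Y) := by
  have h1 : ∀ X Y, trilinear D X Y Z = ∑ m, ∑ j, ∑ k, D j k m * X j * Y k * Z m := by
    intro X Y
    rw [trilinear, Finset.sum_comm (f := fun m j => ∑ k, D j k m * X j * Y k * Z m)]
    exact Finset.sum_congr rfl fun j _ => Finset.sum_comm
  have h2 : trilinear D Y X Z = ∑ m, ∑ j, ∑ k, D k j m * X j * Y k * Z m := by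
    rw [h1]
    refine Finset.sum_congr rfl fun m _ => ?_
    rw [Finset.sum_comm]
    exact Finset.sum_congr rfl fun j _ => Finset.sum_congr rfl fun k _ => by ring
  have h3 : trilinear D Z X Y = ∑ m, ∑ j, ∑ k, D m j k * X j * Y k * Z m :=
    Finset.sum_congr rfl fun j _ => Finset.sum_congr rfl fun k _ =>
      Finset.sum_congr rfl fun l _ => by ring
  rw [h1 X Y, h2, h3]
  simp only [← Finset.sum_sub_distrib, ← Finset.sum_add_distrib, Finset.mul_sum, dotProduct,
    lowerChristoffel, Finset.sum_mul]
  exact Finset.sum_congr rfl fun j _ => Finset.sum_congr rfl fun k _ =>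
    Finset.sum_congr rfl fun l _ => by ring

theorem lowerChristoffel_pullThree (Q : Matrix (Fin n) (Fin n) R)
    (D : Fin n → Fin n → Fin n → R) (X Y : Fin n → R) :
    lowerChristoffel (pullThree Q D) X Y = lowerChristoffel D (Q *ᵥ X) (Q *ᵥ Y) ᵥ* Q := by
  refine dotProduct_eq _ _ fun Z => ?_
  rw [← Matrix.dotProduct_mulVec, lowerChristoffel_dotProduct, lowerChristoffel_dotProduct]
  simp only [trilinear_pullThree]

/-- The change of frame is constant, so the derivatives of the metric transform as tensors and no
inhomogeneous terms arise. -/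
theorem jetCurvature_pull (Q N : Matrix (Fin n) (Fin n) R) (D : Fin n → Fin n → Fin n → R)
    (T : Fin n → Fin n → Fin n → Fin n → R) (X Y Z W : Fin n → R) :
    jetCurvature N (pullThree Q D) (pullFour Q T) X Y Z W
      = jetCurvature (Q * N * Qᵀ) D T (Q *ᵥ X) (Q *ᵥ Y) (Q *ᵥ Z) (Q *ᵥ W) := by
  have h : ∀ u v : Fin n → R, (u ᵥ* Q) ⬝ᵥ N *ᵥ (v ᵥ* Q) = u ⬝ᵥ (Q * N * Qᵀ) *ᵥ v := by
    intro u v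
    rw [← Matrix.dotProduct_mulVec, ← Matrix.mulVec_transpose Q v]
    simp only [Matrix.mulVec_mulVec, Matrix.mul_assoc]
  simp only [jetCurvature, quadrilinear_pullFour, lowerChristoffel_pullThree, h]

end

/-! ### Holomorphic sectional curvature in a complex frame -/

section
variable {n : ℕ}

theorem ofReal_jetCurvature (N : Matrix (Fin n) (Fin n) ℝ) (D : Fin n → Fin n → Fin n → ℝ)
    (T : Fin n → Fin n → Fin n → Fin n → ℝ) (X Y Z W : Fin n → ℝ) :
    ((jetCurvature N D T X Y Z W : ℝ) : ℂ) = jetCurvature (N.map Complex.ofReal)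
      (fun i j k => (D i j k : ℂ)) (fun i j k l => (T i j k l : ℂ)) (fun i => (X i : ℂ))
      (fun i => (Y i : ℂ)) (fun i => (Z i : ℂ)) (fun i => (W i : ℂ)) := by
  simp only [jetCurvature, quadrilinear, lowerChristoffel, dotProduct, Matrix.mulVec,
    Matrix.map_apply]
  push_cast
  rfl

/-- The metric `g` and the two-form `ω` near `p`, in a constant complex frame with dual coframe `Q`:
the coefficients `G` and `Ω`, the endomorphism `J` at `p`, and the derivatives of `G`. -/
structure FrameJet (g ω : FormField n) (U : Set (Fin n → ℝ)) (p : Fin n → ℝ) where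
  P : Matrix (Fin n) (Fin n) ℂ
  Q : Matrix (Fin n) (Fin n) ℂ
  G : (Fin n → ℝ) → Matrix (Fin n) (Fin n) ℂ
  N : Matrix (Fin n) (Fin n) ℂ
  J : Matrix (Fin n) (Fin n) ℂ
  D : (Fin n → ℝ) → Fin n → Fin n → Fin n → ℂ
  T : Fin n → Fin n → Fin n → Fin n → ℂ
  Q_mul_P : Q * P = 1
  metric_eq : ∀ q ∈ U, (g q).map Complex.ofReal = Qᵀ * G q * Q
  form_eq : (ω p).map Complex.ofReal = Qᵀ * (Jᵀ * G p) * Q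
  G_mul_N : G p * N = 1
  G_symm : ∀ q, (G q).IsSymm
  D_symm : ∀ q i j k, D q i j k = D q i k j
  T_symm : ∀ i j k l, T i j k l = T j i k l
  hasFrameGrad_G : ∀ q ∈ U, ∀ i j, HasFrameGrad Q (fun q => G q i j) (fun a => D q a i j) q
  hasFrameGrad_D : ∀ i j k, HasFrameGrad Q (fun q => D q i j k) (fun a => T a i j k) p

/-- The curvature form in the frame. -/
noncomputable def FrameJet.curv {g ω : FormField n} {U : Set (Fin n → ℝ)} {p : Fin n → ℝ}
    (F : FrameJet g ω U p) (X Y Z W : Fin n → ℂ) : ℂ :=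
  jetCurvature F.N (F.D p) F.T X Y Z W

namespace FrameJet
variable {g ω : FormField n} {U : Set (Fin n → ℝ)} {p : Fin n → ℝ}

theorem hasDerivAt_metric (F : FrameJet g ω U p) {q : Fin n → ℝ} (hq : q ∈ U) (hU : IsOpen U)
    (i j k : Fin n) :
    HasDerivAt (fun t => g (Function.update q i t) j k) (pullThree F.Q (F.D q) i j k).re (q i) ∧
      ((pullThree F.Q (F.D q) i j k).re : ℂ) = pullThree F.Q (F.D q) i j k := by
  refine hasDerivAt_of_ofReal ?_
  have h1 : HasDerivAt (fun t : ℝ => ∑ b, ∑ c, F.G (Function.update q i t) b c * F.Q b j * F.Q c k)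
      (∑ b, ∑ c, (∑ a, F.D q a b c * F.Q a i) * F.Q b j * F.Q c k) (q i) :=
    HasDerivAt.fun_sum fun b _ => HasDerivAt.fun_sum fun c _ =>
      ((F.hasFrameGrad_G q hq b c i).mul_const _).mul_const _
  have h2 : ∑ b, ∑ c, (∑ a, F.D q a b c * F.Q a i) * F.Q b j * F.Q c k
      = pullThree F.Q (F.D q) i j k := by
    simp only [pullThree, Finset.sum_mul]
    rw [Finset.sum_comm (f := fun a b => ∑ c, F.D q a b c * F.Q a i * F.Q b j * F.Q c k)]
    exact Finset.sum_congr rfl fun b _ => Finset.sum_comm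
  rw [← h2]
  refine h1.congr_of_eventuallyEq ?_
  filter_upwards [eventually_update_mem hU hq i] with t ht
  have := congrFun (congrFun (F.metric_eq _ ht) j) k
  simp only [Matrix.map_apply, Matrix.mul_apply, Matrix.transpose_apply, Finset.sum_mul] at this
  rw [this, Finset.sum_comm]
  exact Finset.sum_congr rfl fun _ _ => Finset.sum_congr rfl fun _ _ => by ring

theorem isSymm (F : FrameJet g ω U p) {q : Fin n → ℝ} (hq : q ∈ U) : (g q).IsSymm := by
  have : ((g q).map Complex.ofReal).IsSymm := by
    rw [F.metric_eq q hq, Matrix.IsSymm, Matrix.transpose_mul, Matrix.transpose_mul,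
      F.G_symm q, Matrix.transpose_transpose, Matrix.mul_assoc]
  refine Matrix.IsSymm.ext fun i j => ?_
  exact Complex.ofReal_injective (this.apply i j)

theorem Pt_mul_Qt (F : FrameJet g ω U p) : F.P * F.Q = 1 :=
  mul_eq_one_comm.1 F.Q_mul_P

theorem map_inv (F : FrameJet g ω U p) (hp : p ∈ U) :
    (g p).det ≠ 0 ∧ ((g p)⁻¹).map Complex.ofReal = F.P * F.N * F.Pᵀ := by
  have h : (g p).map Complex.ofReal * (F.P * F.N * F.Pᵀ) = 1 := by
    have e : F.Qᵀ * F.Pᵀ = 1 := by rw [← Matrix.transpose_mul, F.Pt_mul_Qt, Matrix.transpose_one]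
    calc _ = F.Qᵀ * (F.G p * (F.Q * F.P) * F.N) * F.Pᵀ := by
          rw [F.metric_eq p hp]; simp only [Matrix.mul_assoc]
      _ = 1 := by rw [F.Q_mul_P, Matrix.mul_one, F.G_mul_N, Matrix.mul_one, e]
  have hd : (g p).det ≠ 0 := by
    intro h0
    have := congrArg Matrix.det h
    rw [Matrix.det_mul, Matrix.det_one,
      show ((g p).map Complex.ofReal).det = (((g p).det : ℝ) : ℂ) from
        (Complex.ofRealHom.map_det (g p)).symm, h0] at this
    simp at this
  refine ⟨hd, ?_⟩
  have h2 : ((g p)⁻¹).map Complex.ofReal * (g p).map Complex.ofReal = 1 := by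
    have := congrArg (fun M => M.map Complex.ofRealHom)
      (Matrix.nonsing_inv_mul (g p) (isUnit_iff_ne_zero.2 hd))
    simp only [Matrix.map_mul, Matrix.map_one, map_zero, map_one] at this
    exact this
  exact left_inv_eq_right_inv h2 h

/-- The coordinate jet is the pull-back by `Q` of the frame jet and has real entries by
`hasDerivAt_of_ofReal`. The two-jet formula and its invariance then give the claim. -/
theorem ofReal_riemannForm (F : FrameJet g ω U p) (hU : IsOpen U) (hp : p ∈ U)
    (X Y Z W : Fin n → ℝ) :
    ((riemannForm g p X Y Z W : ℝ) : ℂ) = F.curv (F.Q *ᵥ fun i => (X i : ℂ))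
      (F.Q *ᵥ fun i => (Y i : ℂ)) (F.Q *ᵥ fun i => (Z i : ℂ)) (F.Q *ᵥ fun i => (W i : ℂ)) := by
  have hG := fun q hq => F.hasDerivAt_metric (q := q) hq hU
  have hD : ∀ l i j k, HasDerivAt
      (fun t => (pullThree F.Q (F.D (Function.update p l t)) i j k).re)
        (pullFour F.Q F.T l i j k).re (p l) ∧
      ((pullFour F.Q F.T l i j k).re : ℂ) = pullFour F.Q F.T l i j k := by
    intro l i j k
    refine hasDerivAt_of_ofReal ?_
    have h1 : HasDerivAt
        (fun t : ℝ => pullThree F.Q (F.D (Function.update p l t)) i j k)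
        (∑ b, ∑ c, ∑ d, (∑ a, F.T a b c d * F.Q a l) * F.Q b i * F.Q c j * F.Q d k) (p l) :=
      HasDerivAt.fun_sum fun b _ => HasDerivAt.fun_sum fun c _ => HasDerivAt.fun_sum fun d _ =>
        (((F.hasFrameGrad_D b c d l).mul_const _).mul_const _).mul_const _
    have h2 : ∑ b, ∑ c, ∑ d, (∑ a, F.T a b c d * F.Q a l) * F.Q b i * F.Q c j * F.Q d k
        = pullFour F.Q F.T l i j k := by
      simp only [pullFour, Finset.sum_mul]
      rw [Finset.sum_comm
        (f := fun a b => ∑ c, ∑ d, F.T a b c d * F.Q a l * F.Q b i * F.Q c j * F.Q d k)]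
      refine Finset.sum_congr rfl fun b _ => ?_
      rw [Finset.sum_comm
        (f := fun a c => ∑ d, F.T a b c d * F.Q a l * F.Q b i * F.Q c j * F.Q d k)]
      exact Finset.sum_congr rfl fun c _ => Finset.sum_comm
    rw [← h2]
    refine h1.congr_of_eventuallyEq ?_
    filter_upwards [eventually_update_mem hU hp l] with t ht
    exact (hG _ ht i j k).2
  have hs : ∀ q i j k, pullThree F.Q (F.D q) i j k = pullThree F.Q (F.D q) i k j := by
    intro q i j k
    refine Finset.sum_congr rfl fun a _ => ?_
    rw [Finset.sum_comm]
    exact Finset.sum_congr rfl fun b _ => Finset.sum_congr rfl fun c _ => by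
      rw [F.D_symm]; ring
  have hss : ∀ i j k l, pullFour F.Q F.T i j k l = pullFour F.Q F.T j i k l := by
    intro i j k l
    rw [pullFour, Finset.sum_comm]
    exact Finset.sum_congr rfl fun b _ => Finset.sum_congr rfl fun c _ =>
      Finset.sum_congr rfl fun b _ => Finset.sum_congr rfl fun c _ => by
        rw [F.T_symm]; ring
  obtain ⟨hdet, hinv⟩ := F.map_inv hp
  rw [riemannForm_eq_jetCurvature hU hp hdet (fun q hq i j k => (hG q hq i j k).1)
    (fun l i j k => (hD l i j k).1) (F.isSymm hp) (fun i j k => by rw [hs])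
    (fun i j k l => by rw [hss]), ofReal_jetCurvature, hinv]
  simp only [(hG p hp _ _ _).2, (hD _ _ _ _).2]
  refine (jetCurvature_pull F.Q _ (F.D p) F.T _ _ _ _).trans ?_
  rw [curv]
  congr 1
  calc F.Q * (F.P * F.N * F.Pᵀ) * F.Qᵀ = (F.Q * F.P) * F.N * (F.Q * F.P)ᵀ := by
        simp only [Matrix.transpose_mul, Matrix.mul_assoc]
    _ = F.N := by rw [F.Q_mul_P]; simp

theorem ofReal_metric (F : FrameJet g ω U p) (hp : p ∈ U) (v w : Fin n → ℝ) :
    ((v ⬝ᵥ g p *ᵥ w : ℝ) : ℂ)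
      = (F.Q *ᵥ fun i => (v i : ℂ)) ⬝ᵥ F.G p *ᵥ (F.Q *ᵥ fun i => (w i : ℂ)) := by
  have h1 : ((v ⬝ᵥ g p *ᵥ w : ℝ) : ℂ)
      = (fun i => (v i : ℂ)) ⬝ᵥ (g p).map Complex.ofReal *ᵥ fun i => (w i : ℂ) := by
    simp only [dotProduct, Matrix.mulVec, Matrix.map_apply]
    push_cast
    rfl
  rw [h1, F.metric_eq p hp, Matrix.mul_assoc, ← Matrix.mulVec_mulVec, ← Matrix.mulVec_mulVec,
    Matrix.dotProduct_mulVec _ F.Qᵀ, Matrix.vecMul_transpose]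

/-- In the frame `ω` has the matrix `Jᵀ G`, so `ω g⁻¹` becomes `Qᵀ Jᵀ Pᵀ`, whose transpose is `P J
Q`. -/
theorem complexStructure_mulVec (F : FrameJet g ω U p) (hp : p ∈ U) (v : Fin n → ℝ) :
    (F.Q *ᵥ fun i => ((complexStructure g ω p *ᵥ v) i : ℂ))
      = F.J *ᵥ F.Q *ᵥ fun i => (v i : ℂ) := by
  have h1 : (fun i => ((complexStructure g ω p *ᵥ v) i : ℂ))
      = ((ω p).map Complex.ofReal * ((g p)⁻¹).map Complex.ofReal)ᵀ *ᵥ fun i => (v i : ℂ) := by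
    funext i
    simp only [complexStructure, dotProduct, Matrix.mulVec, Matrix.map_apply, Matrix.mul_apply,
      Matrix.transpose_apply]
    push_cast
    rfl
  rw [h1, F.form_eq, (F.map_inv hp).2, Matrix.mulVec_mulVec, Matrix.mulVec_mulVec]
  congr 1
  have e : F.Qᵀ * (F.Jᵀ * F.G p) * F.Q * (F.P * F.N * F.Pᵀ) = F.Qᵀ * F.Jᵀ * F.Pᵀ := by
    calc _ = F.Qᵀ * (F.Jᵀ * (F.G p * (F.Q * F.P) * F.N)) * F.Pᵀ := by
          simp only [Matrix.mul_assoc]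
      _ = _ := by rw [F.Q_mul_P, Matrix.mul_one, F.G_mul_N, Matrix.mul_one]
  rw [e]
  simp only [Matrix.transpose_mul, Matrix.transpose_transpose, ← Matrix.mul_assoc, F.Q_mul_P,
    Matrix.one_mul]

/-- The defect of the curvature on the plane `⟨v, J v⟩` from being `κ`. -/
noncomputable def defect (F : FrameJet g ω U p) (κ : ℂ) (x : Fin n → ℂ) : ℂ :=
  F.curv x (F.J *ᵥ x) x (F.J *ᵥ x) - κ * (x ⬝ᵥ F.G p *ᵥ x) ^ 2

theorem hsc_eq_iff (F : FrameJet g ω U p) (hU : IsOpen U) (hp : p ∈ U) (κ : ℝ) (v : Fin n → ℝ)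
    (hv : v ⬝ᵥ g p *ᵥ v ≠ 0) :
    holomorphicSectionalCurvature g ω p v = κ ↔ F.defect κ (F.Q *ᵥ fun i => (v i : ℂ)) = 0 := by
  rw [holomorphicSectionalCurvature, div_eq_iff (pow_ne_zero 2 hv), ← Complex.ofReal_inj,
    F.ofReal_riemannForm hU hp, Complex.ofReal_mul, Complex.ofReal_pow, F.ofReal_metric hp,
    F.complexStructure_mulVec hp, defect, sub_eq_zero]

/-- Analytic continuation: write the vector as `Q (v + i w)` with `v, w` real and replace `i` by a
parameter `t`. The resulting entire function vanishes for real `t`, hence at `t = i`. This makes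
vectors such as `∂_z` available as test vectors. -/
theorem defect_eq_zero (F : FrameJet g ω U p) (hU : IsOpen U) (hp : p ∈ U) {κ : ℝ}
    (h : ∀ v : Fin n → ℝ, v ⬝ᵥ g p *ᵥ v ≠ 0 → holomorphicSectionalCurvature g ω p v = κ)
    (x : Fin n → ℂ) (hx : x ⬝ᵥ F.G p *ᵥ x ≠ 0) : F.defect κ x = 0 := by
  set v : Fin n → ℝ := fun i => ((F.P *ᵥ x) i).re with hv
  set w : Fin n → ℝ := fun i => ((F.P *ᵥ x) i).im with hw
  let y : ℂ → Fin n → ℂ := fun t => F.Q *ᵥ fun i => (v i : ℂ) + t * (w i : ℂ)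
  have hy : y Complex.I = x := by
    have : (fun i => (v i : ℂ) + Complex.I * (w i : ℂ)) = F.P *ᵥ x := by
      funext i
      rw [mul_comm]
      exact Complex.re_add_im _
    simp only [y, this, Matrix.mulVec_mulVec, F.Q_mul_P, Matrix.one_mulVec]
  -- The factor `g(y, y)` takes care of real parameters with a null vector, for which the hypothesis
  -- gives nothing.
  let f : ℂ → ℂ := fun t => F.defect κ (y t) * (y t ⬝ᵥ F.G p *ᵥ y t)
  have hdiff : Differentiable ℂ f := by
    simp only [f, y, defect, curv, jetCurvature, quadrilinear, lowerChristoffel, dotProduct,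
      Matrix.mulVec]
    fun_prop
  have hreal : ∀ t : ℝ, f t = 0 := by
    intro t
    have e : y t = F.Q *ᵥ fun i => (((v i + t * w i : ℝ)) : ℂ) := by
      simp only [y]; push_cast; rfl
    simp only [f, e]
    by_cases h0 : (fun i => v i + t * w i) ⬝ᵥ g p *ᵥ (fun i => v i + t * w i) = 0
    · have := F.ofReal_metric hp (fun i => v i + t * w i) (fun i => v i + t * w i)
      rw [← this, h0]; simp
    · rw [(F.hsc_eq_iff hU hp κ _ h0).1 (h _ h0), zero_mul]
  have hzero : f = 0 := by
    have ha : AnalyticOnNhd ℂ f Set.univ := fun z _ => hdiff.analyticAt z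
    refine ha.eq_of_frequently_eq (g := 0) (z₀ := 0) (fun z _ => analyticAt_const) ?_
    -- The identity theorem needs zeros accumulating at a point; here they are the non-zero real
    -- numbers tending to 0.
    have ht : Filter.Tendsto (fun t : ℝ => (t : ℂ)) (𝓝[≠] 0) (𝓝[≠] 0) :=
      tendsto_nhdsWithin_iff.2 ⟨(Complex.continuous_ofReal.tendsto' 0 0 (by simp)).mono_left
        nhdsWithin_le_nhds, by
          filter_upwards [self_mem_nhdsWithin] with t ht
          simpa using ht⟩
    exact ht.frequently (Filter.Frequently.of_forall hreal)
  have := congrFun hzero Complex.I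
  simp only [f, hy, Pi.zero_apply, mul_eq_zero] at this
  exact this.resolve_right hx

end FrameJet

theorem hasConstantHSC_iff_defect {g ω : FormField n} {U : Set (Fin n → ℝ)}
    {V : (Fin n → ℝ) → Set (Fin n → ℝ)} (hV : ∀ p, IsOpen (V p)) (hpV : ∀ p ∈ U, p ∈ V p)
    (F : ∀ p ∈ U, FrameJet g ω (V p) p) :
    HasConstantHSC g ω U ↔ ∃ κ : ℝ, ∀ p (hp : p ∈ U), ∀ x : Fin n → ℂ,
      x ⬝ᵥ (F p hp).G p *ᵥ x ≠ 0 → (F p hp).defect κ x = 0 := by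
  refine exists_congr fun κ => forall₂_congr fun p hp => ⟨fun h x hx => ?_, fun h v hv => ?_⟩
  · exact (F p hp).defect_eq_zero (hV p) (hpV p hp) h x hx
  · rw [(F p hp).hsc_eq_iff (hV p) (hpV p hp) κ v hv]
    refine h _ ?_
    rw [← (F p hp).ofReal_metric (hpV p hp)]
    exact_mod_cast hv

end

/-! ### Symmetries of the curvature coefficients, and dimension four -/

section
variable {n : ℕ} {R : Type*} [Field R] {N : Matrix (Fin n) (Fin n) R}
  {D : Fin n → Fin n → Fin n → R} {T : Fin n → Fin n → Fin n → Fin n → R}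

theorem jetCurvatureCoeff_antisymm_left (i j k l : Fin n) :
    jetCurvatureCoeff N D T j i k l = -jetCurvatureCoeff N D T i j k l := by
  simp only [jetCurvatureCoeff, ← Finset.sum_neg_distrib, sub_eq_add_neg, neg_add]
  congr 1
  · ring
  · exact Finset.sum_congr rfl fun m _ => Finset.sum_congr rfl fun r _ => by ring

theorem sum_sum_half_symm (hN : N.IsSymm) (u v : Fin n → R) :
    ∑ m, ∑ r, N m r * (u m * v r) = ∑ m, ∑ r, N m r * (v m * u r) := by
  rw [Finset.sum_comm]
  exact Finset.sum_congr rfl fun m _ => Finset.sum_congr rfl fun r _ => by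
    rw [hN.apply]; ring

theorem jetCurvatureCoeff_eq (i j k l : Fin n) :
    jetCurvatureCoeff N D T i j k l
      = (1 / 2) * (T i l j k - T i k j l - T j l i k + T j k i l)
      - (1 / 4) * (∑ m, ∑ r, N m r * ((D i k m + D k i m - D m i k) * (D j l r + D l j r - D r j l))
      - ∑ m, ∑ r, N m r * ((D j k m + D k j m - D m j k) * (D i l r + D l i r - D r i l))) := by
  simp only [jetCurvatureCoeff, Finset.mul_sum, ← Finset.sum_sub_distrib]
  congr 1
  refine Finset.sum_congr rfl fun m _ => Finset.sum_congr rfl fun r _ => ?_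
  -- This holds in every field, also in characteristic two, where both sides are 0 by the convention
  -- for division by zero.
  rw [show (1 / 4 : R) = (1 / 2) * (1 / 2) by rw [div_mul_div_comm]; norm_num]
  ring

theorem jetCurvatureCoeff_antisymm_right (hN : N.IsSymm) (i j k l : Fin n) :
    jetCurvatureCoeff N D T i j l k = -jetCurvatureCoeff N D T i j k l := by
  rw [jetCurvatureCoeff_eq, jetCurvatureCoeff_eq,
    sum_sum_half_symm hN (fun m => D i l m + D l i m - D m i l),
    sum_sum_half_symm hN (fun m => D j l m + D l j m - D m j l)]
  ring

/-- The symmetries of `N`, `D` and `T` suffice; no Bianchi identity is used. With the two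
antisymmetries it turns the curvature into a quadratic form on bivectors, with 21 coefficients in
dimension four. -/
theorem jetCurvatureCoeff_pair_symm (hN : N.IsSymm) (hD : ∀ i j k, D i j k = D i k j)
    (hT : ∀ i j k l, T i j k l = T i j l k) (hT' : ∀ i j k l, T i j k l = T j i k l)
    (i j k l : Fin n) :
    jetCurvatureCoeff N D T k l i j = jetCurvatureCoeff N D T i j k l := by
  have hΓ : ∀ i k, (fun m => D k i m + D i k m - D m k i) = fun m => D i k m + D k i m - D m i k :=
    fun i k => funext fun m => by rw [hD m k i]; ring
  rw [jetCurvatureCoeff_eq, jetCurvatureCoeff_eq,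
    sum_sum_half_symm hN (fun m => D l i m + D i l m - D m l i)]
  have e1 := fun m => congrFun (hΓ i k) m
  have e2 := fun m => congrFun (hΓ j l) m
  have e3 := fun m => congrFun (hΓ i l) m
  have e4 := fun m => congrFun (hΓ j k) m
  simp only [e1, e2, e3, e4]
  rw [hT' k j, hT j k l i, hT' k i, hT i k l j, hT' l j, hT' l i, hT j l k i, hT i l k j]
  ring

/-- Two-forms in four variables. -/
theorem sum_sum_antisymm {C : Fin 4 → Fin 4 → R} [CharZero R] (hC : ∀ i j, C j i = -C i j)
    (x y : Fin 4 → R) :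
    ∑ i, ∑ j, x i * y j * C i j
      = C 0 1 * (x 0 * y 1 - x 1 * y 0) + C 0 2 * (x 0 * y 2 - x 2 * y 0)
      + C 0 3 * (x 0 * y 3 - x 3 * y 0) + C 1 2 * (x 1 * y 2 - x 2 * y 1)
      + C 1 3 * (x 1 * y 3 - x 3 * y 1) + C 2 3 * (x 2 * y 3 - x 3 * y 2) := by
  have h0 : ∀ i, C i i = 0 := fun i => by
    have := hC i i
    exact self_eq_neg.1 this
  simp only [Fin.sum_univ_four, h0, hC 0 1, hC 0 2, hC 0 3, hC 1 2, hC 1 3, hC 2 3]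
  ring

/-- The quadratic form on bivectors defined by a curvature tensor in dimension four. -/
theorem jetCurvature_four [CharZero R] {N : Matrix (Fin 4) (Fin 4) R}
    {D : Fin 4 → Fin 4 → Fin 4 → R} {T : Fin 4 → Fin 4 → Fin 4 → Fin 4 → R}
    (hN : N.IsSymm) (hD : ∀ i j k, D i j k = D i k j)
    (hT : ∀ i j k l, T i j k l = T i j l k) (hT' : ∀ i j k l, T i j k l = T j i k l)
    (x y : Fin 4 → R) {p₀ p₁ p₂ p₃ p₄ p₅ : R} (h₀ : p₀ = x 0 * y 1 - x 1 * y 0)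
    (h₁ : p₁ = x 0 * y 2 - x 2 * y 0) (h₂ : p₂ = x 0 * y 3 - x 3 * y 0)
    (h₃ : p₃ = x 1 * y 2 - x 2 * y 1) (h₄ : p₄ = x 1 * y 3 - x 3 * y 1)
    (h₅ : p₅ = x 2 * y 3 - x 3 * y 2) {C : Fin 4 → Fin 4 → Fin 4 → Fin 4 → R}
    (hC : C = jetCurvatureCoeff N D T) :
    jetCurvature N D T x y x y
      = C 0 1 0 1 * p₀ ^ 2 + C 0 2 0 2 * p₁ ^ 2 + C 0 3 0 3 * p₂ ^ 2 + C 1 2 1 2 * p₃ ^ 2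
      + C 1 3 1 3 * p₄ ^ 2 + C 2 3 2 3 * p₅ ^ 2
      + 2 * (C 0 1 0 2 * p₀ * p₁ + C 0 1 0 3 * p₀ * p₂ + C 0 1 1 2 * p₀ * p₃
        + C 0 1 1 3 * p₀ * p₄ + C 0 1 2 3 * p₀ * p₅ + C 0 2 0 3 * p₁ * p₂ + C 0 2 1 2 * p₁ * p₃
        + C 0 2 1 3 * p₁ * p₄ + C 0 2 2 3 * p₁ * p₅ + C 0 3 1 2 * p₂ * p₃ + C 0 3 1 3 * p₂ * p₄
        + C 0 3 2 3 * p₂ * p₅ + C 1 2 1 3 * p₃ * p₄ + C 1 2 2 3 * p₃ * p₅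
        + C 1 3 2 3 * p₄ * p₅) := by
  subst hC
  have e1 : ∀ i j, ∑ k, ∑ l, x i * y j * x k * y l * jetCurvatureCoeff N D T i j k l
      = x i * y j * ∑ k, ∑ l, x k * y l * jetCurvatureCoeff N D T i j k l := by
    intro i j
    simp only [Finset.mul_sum]
    exact Finset.sum_congr rfl fun k _ => Finset.sum_congr rfl fun l _ => by ring
  have e2 := fun i j => sum_sum_antisymm
    (fun k l => jetCurvatureCoeff_antisymm_right (D := D) (T := T) hN i j k l) x y
  rw [jetCurvature_eq_sum]
  simp only [e1]
  rw [sum_sum_antisymm (C := fun i j => ∑ k, ∑ l, x k * y l * jetCurvatureCoeff N D T i j k l)]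
  · simp only [e2, ← h₀, ← h₁, ← h₂, ← h₃, ← h₄, ← h₅]
    have s := jetCurvatureCoeff_pair_symm hN hD hT hT'
    rw [s 0 1 0 2, s 0 1 0 3, s 0 1 1 2, s 0 1 1 3, s 0 1 2 3, s 0 2 0 3, s 0 2 1 2, s 0 2 1 3,
      s 0 2 2 3, s 0 3 1 2, s 0 3 1 3, s 0 3 2 3, s 1 2 1 3, s 1 2 2 3, s 1 3 2 3]
    ring
  · intro i j
    simp only [jetCurvatureCoeff_antisymm_left i j, mul_neg, Finset.sum_neg_distrib]

end

/-! ### Metrics with two commuting translation symmetries -/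

/-- The symmetric matrix with blocks `diag(x, y)` and `(p, q; q, r)`. -/
def blockMatrix {R : Type*} [Zero R] (x y p q r : R) : Matrix (Fin 4) (Fin 4) R :=
  Matrix.of ![![x, 0, 0, 0], ![0, y, 0, 0], ![0, 0, p, q], ![0, 0, q, r]]

/-- The tensor of first derivatives that vanishes unless the first index is `0` or `1`. -/
def firstJet {R : Type*} [Zero R] (M₀ M₁ : Matrix (Fin 4) (Fin 4) R) (i j k : Fin 4) : R :=
  (![M₀, M₁, 0, 0] : Fin 4 → Matrix (Fin 4) (Fin 4) R) i j k

/-- The tensor of second derivatives that vanishes unless the first two indices are `0` or `1`. -/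
def secondJet {R : Type*} [Zero R] (M₀ M M₁ : Matrix (Fin 4) (Fin 4) R) (i j k l : Fin 4) : R :=
  (![![M₀, M, 0, 0], ![M, M₁, 0, 0], 0, 0] : Fin 4 → Fin 4 → Matrix (Fin 4) (Fin 4) R) i j k l

section
variable {R : Type*} [Field R]

theorem firstJet_apply (M₀ M₁ : Matrix (Fin 4) (Fin 4) R) (j k : Fin 4) :
    firstJet M₀ M₁ 0 j k = M₀ j k ∧ firstJet M₀ M₁ 1 j k = M₁ j k ∧ firstJet M₀ M₁ 2 j k = 0 ∧
      firstJet M₀ M₁ 3 j k = 0 :=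
  ⟨rfl, rfl, rfl, rfl⟩

theorem secondJet_apply (M₀ M M₁ : Matrix (Fin 4) (Fin 4) R) (k l : Fin 4) :
    secondJet M₀ M M₁ 0 0 k l = M₀ k l ∧ secondJet M₀ M M₁ 0 1 k l = M k l ∧
      secondJet M₀ M M₁ 0 2 k l = 0 ∧ secondJet M₀ M M₁ 0 3 k l = 0 ∧
      secondJet M₀ M M₁ 1 0 k l = M k l ∧ secondJet M₀ M M₁ 1 1 k l = M₁ k l ∧
      secondJet M₀ M M₁ 1 2 k l = 0 ∧ secondJet M₀ M M₁ 1 3 k l = 0 ∧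
      (∀ j, secondJet M₀ M M₁ 2 j k l = 0) ∧ (∀ j, secondJet M₀ M M₁ 3 j k l = 0) :=
  ⟨rfl, rfl, rfl, rfl, rfl, rfl, rfl, rfl, fun _ => rfl, fun _ => rfl⟩

theorem blockMatrix_apply (x y p q r : R) :
    blockMatrix x y p q r 0 0 = x ∧ blockMatrix x y p q r 0 1 = 0 ∧ blockMatrix x y p q r 0 2 = 0 ∧
      blockMatrix x y p q r 0 3 = 0 ∧ blockMatrix x y p q r 1 0 = 0 ∧
      blockMatrix x y p q r 1 1 = y ∧ blockMatrix x y p q r 1 2 = 0 ∧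
      blockMatrix x y p q r 1 3 = 0 ∧ blockMatrix x y p q r 2 0 = 0 ∧
      blockMatrix x y p q r 2 1 = 0 ∧ blockMatrix x y p q r 2 2 = p ∧
      blockMatrix x y p q r 2 3 = q ∧ blockMatrix x y p q r 3 0 = 0 ∧
      blockMatrix x y p q r 3 1 = 0 ∧ blockMatrix x y p q r 3 2 = q ∧
      blockMatrix x y p q r 3 3 = r :=
  ⟨rfl, rfl, rfl, rfl, rfl, rfl, rfl, rfl, rfl, rfl, rfl, rfl, rfl, rfl, rfl, rfl⟩

/-- The curvature of a metric with two commuting translation symmetries. -/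
theorem jetCurvatureCoeff_block
    {x y p q r x₀ y₀ p₀ q₀ r₀ x₁ y₁ p₁ q₁ r₁ x₀₀ y₀₀ p₀₀ q₀₀ r₀₀ x₀₁ y₀₁ p₀₁ q₀₁ r₀₁ x₁₁ y₁₁ p₁₁ q₁₁ r₁₁ : R}
    {C : Fin 4 → Fin 4 → Fin 4 → Fin 4 → R}
    (hC : C = jetCurvatureCoeff (blockMatrix x y p q r)
      (firstJet (blockMatrix x₀ y₀ p₀ q₀ r₀) (blockMatrix x₁ y₁ p₁ q₁ r₁))
      (secondJet (blockMatrix x₀₀ y₀₀ p₀₀ q₀₀ r₀₀) (blockMatrix x₀₁ y₀₁ p₀₁ q₀₁ r₀₁)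
        (blockMatrix x₁₁ y₁₁ p₁₁ q₁₁ r₁₁))) :
    C 0 1 0 1 = -(1 / 2) * (y₀₀ + x₁₁) + (1 / 4) * (x * (x₀ * y₀ + x₁ ^ 2) + y * (x₁ * y₁ + y₀ ^ 2)) ∧
      C 0 2 0 2 = -(1 / 2) * p₀₀ + (1 / 4) * (x * x₀ * p₀ - y * x₁ * p₁
        + (p * p₀ * p₀ + q * p₀ * q₀ + q * q₀ * p₀ + r * q₀ * q₀)) ∧
      C 0 2 0 3 = -(1 / 2) * q₀₀ + (1 / 4) * (x * x₀ * q₀ - y * x₁ * q₁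
        + (p * p₀ * q₀ + q * p₀ * r₀ + q * q₀ * q₀ + r * q₀ * r₀)) ∧
      C 0 3 0 3 = -(1 / 2) * r₀₀ + (1 / 4) * (x * x₀ * r₀ - y * x₁ * r₁
        + (p * q₀ * q₀ + q * q₀ * r₀ + q * r₀ * q₀ + r * r₀ * r₀)) ∧
      C 0 2 1 2 = -(1 / 2) * p₀₁ + (1 / 4) * (x * x₁ * p₀ + y * y₀ * p₁
        + (p * p₁ * p₀ + q * p₁ * q₀ + q * q₁ * p₀ + r * q₁ * q₀)) ∧
      C 0 2 1 3 = -(1 / 2) * q₀₁ + (1 / 4) * (x * x₁ * q₀ + y * y₀ * q₁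
        + (p * p₁ * q₀ + q * p₁ * r₀ + q * q₁ * q₀ + r * q₁ * r₀)) ∧
      C 0 3 1 2 = -(1 / 2) * q₀₁ + (1 / 4) * (x * x₁ * q₀ + y * y₀ * q₁
        + (p * q₁ * p₀ + q * q₁ * q₀ + q * r₁ * p₀ + r * r₁ * q₀)) ∧
      C 0 3 1 3 = -(1 / 2) * r₀₁ + (1 / 4) * (x * x₁ * r₀ + y * y₀ * r₁
        + (p * q₁ * q₀ + q * q₁ * r₀ + q * r₁ * q₀ + r * r₁ * r₀)) ∧
      C 1 2 1 2 = -(1 / 2) * p₁₁ + (1 / 4) * (y * y₁ * p₁ - x * y₀ * p₀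
        + (p * p₁ * p₁ + q * p₁ * q₁ + q * q₁ * p₁ + r * q₁ * q₁)) ∧
      C 1 2 1 3 = -(1 / 2) * q₁₁ + (1 / 4) * (y * y₁ * q₁ - x * y₀ * q₀
        + (p * p₁ * q₁ + q * p₁ * r₁ + q * q₁ * q₁ + r * q₁ * r₁)) ∧
      C 1 3 1 3 = -(1 / 2) * r₁₁ + (1 / 4) * (y * y₁ * r₁ - x * y₀ * r₀
        + (p * q₁ * q₁ + q * q₁ * r₁ + q * r₁ * q₁ + r * r₁ * r₁)) ∧
      C 0 1 2 3 = (1 / 4) * ((p * p₁ * q₀ + q * p₁ * r₀ + q * q₁ * q₀ + r * q₁ * r₀)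
        - (p * p₀ * q₁ + q * p₀ * r₁ + q * q₀ * q₁ + r * q₀ * r₁)) ∧
      C 2 3 2 3 = -(1 / 4) * (x * (p₀ * r₀ - q₀ ^ 2) + y * (p₁ * r₁ - q₁ ^ 2)) ∧
      C 0 1 0 2 = 0 ∧
      C 0 1 0 3 = 0 ∧
      C 0 1 1 2 = 0 ∧
      C 0 1 1 3 = 0 ∧
      C 0 2 2 3 = 0 ∧
      C 0 3 2 3 = 0 ∧
      C 1 2 2 3 = 0 ∧
      C 1 3 2 3 = 0 := by
  subst hC
  have h4 : (1 / 4 : R) = (1 / 2) * (1 / 2) := by rw [div_mul_div_comm]; norm_num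
  refine ⟨?_, ?_, ?_, ?_, ?_, ?_, ?_, ?_, ?_, ?_, ?_, ?_, ?_, ?_, ?_, ?_, ?_, ?_, ?_, ?_, ?_⟩ <;>
  · simp only [jetCurvatureCoeff, Fin.sum_univ_four, blockMatrix_apply, firstJet_apply,
      secondJet_apply, mul_zero, zero_mul, add_zero, zero_add, sub_zero, zero_sub, sub_self, h4]
    try ring

end

/-! ### The orthotoric normal form -/

/-- The coefficients of the metric
`(a - b)(E dX² - e dY²) + (a - b)⁻¹ (A (ds₀ + b ds₁)² - B (ds₀ + a ds₁)²)`. -/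
noncomputable def orthoMetric (a b E e A B : ℂ) : Matrix (Fin 4) (Fin 4) ℂ :=
  blockMatrix ((a - b) * E) (-((a - b) * e))
    ((A - B) / (a - b)) ((A * b - B * a) / (a - b)) ((A * b ^ 2 - B * a ^ 2) / (a - b))

/-- The inverse of `orthoMetric`. -/
noncomputable def orthoInv (a b E e A B : ℂ) : Matrix (Fin 4) (Fin 4) ℂ :=
  blockMatrix (1 / ((a - b) * E)) (-1 / ((a - b) * e))
    ((a ^ 2 / A - b ^ 2 / B) / (a - b)) ((b / B - a / A) / (a - b)) ((1 / A - 1 / B) / (a - b))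

/-- The complex structure of `orthoMetric`, where `a₁ = da/dX` and `b₁ = db/dY`. -/
noncomputable def orthoJ (a b a₁ b₁ A B : ℂ) : Matrix (Fin 4) (Fin 4) ℂ :=
  !![0, 0, -(A / a₁) / (a - b), -(b * A / a₁) / (a - b);
    0, 0, (B / b₁) / (a - b), (a * B / b₁) / (a - b);
    a₁ / A * a, b₁ / B * b, 0, 0;
    -(a₁ / A), -(b₁ / B), 0, 0]

/-- The first derivatives of `orthoMetric`, where `E₁ = dE/dX`, `e₁ = de/dY`, and `u`, `v` are the
derivatives of `(A - B)/(a - b)` with respect to `a` and `b`. -/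
noncomputable def orthoD (a b a₁ b₁ E E₁ e e₁ A B u v : ℂ) : Fin 4 → Fin 4 → Fin 4 → ℂ :=
  firstJet
    (blockMatrix (a₁ * E + (a - b) * E₁) (-(a₁ * e)) (a₁ * u) (a₁ * (b * u))
      (a₁ * (b ^ 2 * u - B)))
    (blockMatrix (-(b₁ * E)) (b₁ * e - (a - b) * e₁) (b₁ * v) (b₁ * (a * v))
      (b₁ * (a ^ 2 * v - A)))

/-- The second derivatives of `orthoMetric`, where `u₁, w` are the derivatives of `u` with respect
to `a` and `b`, and `v₁` is the derivative of `v` with respect to `b`. -/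
noncomputable def orthoT (a b a₁ b₁ a₂ b₂ E E₁ E₂ e e₁ e₂ A B B₁ u v u₁ v₁ w : ℂ) :
    Fin 4 → Fin 4 → Fin 4 → Fin 4 → ℂ :=
  secondJet
    (blockMatrix (a₂ * E + 2 * a₁ * E₁ + (a - b) * E₂) (-(a₂ * e)) (a₁ ^ 2 * u₁ + a₂ * u)
      (b * (a₁ ^ 2 * u₁ + a₂ * u)) (b ^ 2 * (a₁ ^ 2 * u₁ + a₂ * u) - a₂ * B))
    (blockMatrix (-(b₁ * E₁)) (-(a₁ * e₁)) (a₁ * b₁ * w) (a₁ * b₁ * (u + b * w))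
      (a₁ * b₁ * (2 * b * u + b ^ 2 * w - B₁)))
    (blockMatrix (-(b₂ * E)) (b₂ * e + 2 * b₁ * e₁ - (a - b) * e₂) (b₁ ^ 2 * v₁ + b₂ * v)
      (a * (b₁ ^ 2 * v₁ + b₂ * v)) (a ^ 2 * (b₁ ^ 2 * v₁ + b₂ * v) - b₂ * A))

section
variable {a b a₁ b₁ a₂ b₂ E E₁ E₂ e e₁ e₂ A B A₁ B₁ u v u₁ v₁ w : ℂ}

theorem blockMatrix_isSymm {R : Type*} [Zero R] (x y p q r : R) :
    (blockMatrix x y p q r).IsSymm :=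
  Matrix.IsSymm.ext fun i j => by fin_cases i <;> fin_cases j <;> rfl

theorem firstJet_symm {R : Type*} [Zero R] {M₀ M₁ : Matrix (Fin 4) (Fin 4) R} (h₀ : M₀.IsSymm)
    (h₁ : M₁.IsSymm) (i j k : Fin 4) : firstJet M₀ M₁ i j k = firstJet M₀ M₁ i k j := by
  fin_cases i
  exacts [h₀.apply k j, h₁.apply k j, rfl, rfl]

theorem secondJet_symm_left {R : Type*} [Zero R] {M₀ M M₁ : Matrix (Fin 4) (Fin 4) R}
    (i j k l : Fin 4) : secondJet M₀ M M₁ i j k l = secondJet M₀ M M₁ j i k l := by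
  fin_cases i <;> fin_cases j <;> rfl

theorem secondJet_symm_right {R : Type*} [Zero R] {M₀ M M₁ : Matrix (Fin 4) (Fin 4) R}
    (h₀ : M₀.IsSymm) (h : M.IsSymm) (h₁ : M₁.IsSymm) (i j k l : Fin 4) :
    secondJet M₀ M M₁ i j k l = secondJet M₀ M M₁ i j l k := by
  fin_cases i <;> fin_cases j <;> 
    first | exact h₀.apply l k | exact h.apply l k | exact h₁.apply l k | rfl

theorem orthoD_symm (i j k : Fin 4) :
    orthoD a b a₁ b₁ E E₁ e e₁ A B u v i j k = orthoD a b a₁ b₁ E E₁ e e₁ A B u v i k j :=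
  firstJet_symm (blockMatrix_isSymm ..) (blockMatrix_isSymm ..) i j k

theorem orthoMetric_mul_orthoInv (hab : a - b ≠ 0) (hE : E ≠ 0) (he : e ≠ 0) (hA : A ≠ 0)
    (hB : B ≠ 0) : orthoMetric a b E e A B * orthoInv a b E e A B = 1 := by
  ext i j
  fin_cases i <;> fin_cases j <;>
    simp [orthoMetric, orthoInv, blockMatrix, Matrix.mul_apply, Fin.sum_univ_four] <;>
    field_simp <;> ring

/-- The form `ω` in the frame. -/
theorem orthoJ_transpose_mul (hab : a - b ≠ 0) (ha : a₁ ≠ 0) (hb : b₁ ≠ 0) (hA : A ≠ 0)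
    (hB : B ≠ 0) (hE : E * A = a₁ ^ 2) (he : e * B = b₁ ^ 2) :
    (orthoJ a b a₁ b₁ A B)ᵀ * orthoMetric a b E e A B
      = !![0, 0, a₁, a₁ * b; 0, 0, b₁, b₁ * a; -a₁, -b₁, 0, 0; -(a₁ * b), -(b₁ * a), 0, 0] := by
  obtain rfl : E = a₁ ^ 2 / A := by rw [eq_div_iff hA, hE]
  obtain rfl : e = b₁ ^ 2 / B := by rw [eq_div_iff hB, he]
  ext i j
  fin_cases i <;> fin_cases j <;>
    simp [orthoMetric, orthoJ, blockMatrix, Matrix.mul_apply, Fin.sum_univ_four] <;>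
    field_simp <;> ring

/-- The vector `J ∂_X` is proportional to `a ∂_{s₀} - ∂_{s₁}`, so only the coefficients 0202, 0203
and 0303 contribute. They involve `E₂` nowhere, and after elimination of `E`, `e` and `E₁` only the
second derivative `u₁` survives. -/
theorem ortho_curvature_first (hab : a - b ≠ 0) (ha : a₁ ≠ 0) (hb : b₁ ≠ 0) (hA : A ≠ 0)
    (hB : B ≠ 0) (hE : E * A = a₁ ^ 2) (he : e * B = b₁ ^ 2)
    (hE₁ : E₁ * A + E * (a₁ * A₁) = 2 * a₁ * a₂) (hu : A₁ = (A - B) / (a - b) + u * (a - b))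
    {x y : Fin 4 → ℂ} (hx : x = ![1, 0, 0, 0]) (hy : y = orthoJ a b a₁ b₁ A B *ᵥ x) :
    jetCurvature (orthoInv a b E e A B) (orthoD a b a₁ b₁ E E₁ e e₁ A B u v)
      (orthoT a b a₁ b₁ a₂ b₂ E E₁ E₂ e e₁ e₂ A B B₁ u v u₁ v₁ w) x y x y
      = -(1 / 2) * u₁ * ((a - b) * E) ^ 2 := by
  -- The relations `E A = a₁²`, `e B = b₁²` and their consequences are solved for `E`, `e`, `E₁` and
  -- `A₁`; what remains is an identity of rational functions in independent variables.
  obtain rfl : E = a₁ ^ 2 / A := by rw [eq_div_iff hA, hE]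
  obtain rfl : e = b₁ ^ 2 / B := by rw [eq_div_iff hB, he]
  obtain rfl : E₁ = 2 * a₁ * a₂ / A - a₁ ^ 3 * A₁ / A ^ 2 := by
    field_simp
    field_simp at hE₁
    linear_combination hE₁
  subst hu
  obtain rfl : y = ![0, 0, a₁ / A * a, -(a₁ / A)] := by
    rw [hy, hx]
    ext i
    fin_cases i <;> simp [orthoJ, Matrix.mulVec, dotProduct, Fin.sum_univ_four]
  subst hx
  obtain ⟨C, hC⟩ : ∃ C, C = jetCurvatureCoeff (orthoInv a b (a₁ ^ 2 / A) (b₁ ^ 2 / B) A B)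
    (orthoD a b a₁ b₁ (a₁ ^ 2 / A)
      (2 * a₁ * a₂ / A - a₁ ^ 3 * ((A - B) / (a - b) + u * (a - b)) / A ^ 2) (b₁ ^ 2 / B) e₁ A B u v)
    (orthoT a b a₁ b₁ a₂ b₂ (a₁ ^ 2 / A)
      (2 * a₁ * a₂ / A - a₁ ^ 3 * ((A - B) / (a - b) + u * (a - b)) / A ^ 2) E₂ (b₁ ^ 2 / B) e₁ e₂
      A B B₁ u v u₁ v₁ w) := ⟨_, rfl⟩
  refine (jetCurvature_four (blockMatrix_isSymm ..) orthoD_symm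
    (secondJet_symm_right (blockMatrix_isSymm ..) (blockMatrix_isSymm ..) (blockMatrix_isSymm ..))
    -- The `pᵢ` are the Plücker coordinates of the bivector `x ∧ J x`.
    secondJet_symm_left _ _ (p₀ := 0) (p₁ := a₁ / A * a) (p₂ := -(a₁ / A)) (p₃ := 0) (p₄ := 0)
    (p₅ := 0) (by simp) (by simp) (by simp) (by simp) (by simp) (by simp) hC).trans ?_
  obtain ⟨-, h1, h2, h3, -⟩ := jetCurvatureCoeff_block hC
  clear hC
  rw [h1, h2, h3]
  field_simp
  ring

/-- The quotient `(A - B)/(a - b)` is here affine, with equal derivatives `u` in `a` and `b`. Then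
every coefficient vanishes separately, so the metric is flat and `y` need not be `J x`. -/
theorem ortho_curvature_eq_zero (hab : a - b ≠ 0) (ha : a₁ ≠ 0) (hb : b₁ ≠ 0) (hA : A ≠ 0)
    (hB : B ≠ 0) (hE : E * A = a₁ ^ 2) (he : e * B = b₁ ^ 2)
    (hE₁ : E₁ * A + E * (a₁ * A₁) = 2 * a₁ * a₂) (he₁ : e₁ * B + e * (b₁ * B₁) = 2 * b₁ * b₂)
    (hu : A₁ = (A - B) / (a - b) + u * (a - b)) (hv : B₁ = (A - B) / (a - b) - u * (a - b))
    (x y : Fin 4 → ℂ) :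
    jetCurvature (orthoInv a b E e A B) (orthoD a b a₁ b₁ E E₁ e e₁ A B u u)
      (orthoT a b a₁ b₁ a₂ b₂ E E₁ E₂ e e₁ e₂ A B B₁ u u 0 0 0) x y x y = 0 := by
  have hE' : E = a₁ ^ 2 / A := by rw [eq_div_iff hA, hE]
  have he' : e = b₁ ^ 2 / B := by rw [eq_div_iff hB, he]
  have hE₁' : E₁ = 2 * a₁ * a₂ / A - a₁ ^ 3 * A₁ / A ^ 2 := by
    rw [hE'] at hE₁
    field_simp
    field_simp at hE₁
    linear_combination hE₁
  have he₁' : e₁ = 2 * b₁ * b₂ / B - b₁ ^ 3 * B₁ / B ^ 2 := by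
    rw [he'] at he₁
    field_simp
    field_simp at he₁
    linear_combination he₁
  obtain ⟨C, hC⟩ : ∃ C, C = jetCurvatureCoeff (orthoInv a b E e A B)
    (orthoD a b a₁ b₁ E E₁ e e₁ A B u u)
    (orthoT a b a₁ b₁ a₂ b₂ E E₁ E₂ e e₁ e₂ A B B₁ u u 0 0 0) := ⟨_, rfl⟩
  refine (jetCurvature_four (blockMatrix_isSymm ..) orthoD_symm
    (secondJet_symm_right (blockMatrix_isSymm ..) (blockMatrix_isSymm ..) (blockMatrix_isSymm ..))
    secondJet_symm_left _ _ rfl rfl rfl rfl rfl rfl hC).trans ?_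
  obtain ⟨c1, c2, c3, c4, c5, c6, c7, c8, c9, c10, c11, c12, c13, z1, z2, z3, z4, z5, z6, z7,
    z8⟩ := jetCurvatureCoeff_block hC
  clear hC hE he hE₁ he₁
  -- The reflection of `s₀` and `s₁` is a symmetry, so coefficients with an odd number of indices 2
  -- and 3 vanish.
  rw [z1, z2, z3, z4, z5, z6, z7, z8]
  subst hE₁' he₁' hE' he' hu hv
  replace c1 : C 0 1 0 1 = 0 := by rw [c1]; field_simp; ring
  replace c2 : C 0 2 0 2 = 0 := by rw [c2]; field_simp; ring
  replace c3 : C 0 2 0 3 = 0 := by rw [c3]; field_simp; ring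
  replace c4 : C 0 3 0 3 = 0 := by rw [c4]; field_simp; ring
  replace c5 : C 0 2 1 2 = 0 := by rw [c5]; field_simp; ring
  replace c6 : C 0 2 1 3 = 0 := by rw [c6]; field_simp; ring
  replace c7 : C 0 3 1 2 = 0 := by rw [c7]; field_simp; ring
  replace c8 : C 0 3 1 3 = 0 := by rw [c8]; field_simp; ring
  replace c9 : C 1 2 1 2 = 0 := by rw [c9]; field_simp; ring
  replace c10 : C 1 2 1 3 = 0 := by rw [c10]; field_simp; ring
  replace c11 : C 1 3 1 3 = 0 := by rw [c11]; field_simp; ring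
  replace c12 : C 0 1 2 3 = 0 := by rw [c12]; field_simp; ring
  replace c13 : C 2 3 2 3 = 0 := by rw [c13]; field_simp; ring
  rw [c1, c2, c3, c4, c5, c6, c7, c8, c9, c10, c11, c12, c13]
  ring

end

/-! ### Calculus of functions of two frame variables -/

theorem forall_fin_four {p : Fin 4 → Prop} (h₀ : p 0) (h₁ : p 1) (h₂ : p 2) (h₃ : p 3)
    (i : Fin 4) : p i := by
  fin_cases i <;> assumption

/-- `f` depends on the first two frame directions only, with derivatives `x` and `y`. -/
abbrev HasPairGrad (Q : Matrix (Fin 4) (Fin 4) ℂ) (f : (Fin 4 → ℝ) → ℂ) (x y : ℂ)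
    (p : Fin 4 → ℝ) : Prop :=
  HasFrameGrad Q f ![x, y, 0, 0] p

namespace HasPairGrad
variable {Q : Matrix (Fin 4) (Fin 4) ℂ} {f g : (Fin 4 → ℝ) → ℂ} {x y x' y' : ℂ} {p : Fin 4 → ℝ}

theorem congr (hf : HasPairGrad Q f x y p) (hx : x' = x) (hy : y' = y) :
    HasPairGrad Q f x' y' p := by
  rwa [hx, hy]

theorem const (c : ℂ) : HasPairGrad Q (fun _ => c) 0 0 p :=
  (HasFrameGrad.const c).congr_grad (forall_fin_four rfl rfl rfl rfl)

theorem add (hf : HasPairGrad Q f x y p) (hg : HasPairGrad Q g x' y' p) :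
    HasPairGrad Q (fun q => f q + g q) (x + x') (y + y') p :=
  (HasFrameGrad.add hf hg).congr_grad (forall_fin_four rfl rfl (by simp) (by simp))

theorem sub (hf : HasPairGrad Q f x y p) (hg : HasPairGrad Q g x' y' p) :
    HasPairGrad Q (fun q => f q - g q) (x - x') (y - y') p :=
  (HasFrameGrad.sub hf hg).congr_grad (forall_fin_four rfl rfl (by simp) (by simp))

theorem neg (hf : HasPairGrad Q f x y p) : HasPairGrad Q (fun q => -f q) (-x) (-y) p :=
  (HasFrameGrad.neg hf).congr_grad (forall_fin_four rfl rfl (by simp) (by simp))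

theorem mul (hf : HasPairGrad Q f x y p) (hg : HasPairGrad Q g x' y' p) :
    HasPairGrad Q (fun q => f q * g q) (x * g p + f p * x') (y * g p + f p * y') p :=
  (HasFrameGrad.mul hf hg).congr_grad (forall_fin_four rfl rfl (by simp) (by simp))

theorem pow (hf : HasPairGrad Q f x y p) (n : ℕ) :
    HasPairGrad Q (fun q => f q ^ n) (n * f p ^ (n - 1) * x) (n * f p ^ (n - 1) * y) p :=
  (HasFrameGrad.comp hf (hasDerivAt_pow n (f p))).congr_grad
    (forall_fin_four rfl rfl (by simp) (by simp))

theorem div (hf : HasPairGrad Q f x y p) (hg : HasPairGrad Q g x' y' p) (h : g p ≠ 0) :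
    HasPairGrad Q (fun q => f q / g q) ((x * g p - f p * x') / g p ^ 2)
      ((y * g p - f p * y') / g p ^ 2) p :=
  (HasFrameGrad.div hf hg h).congr_grad (forall_fin_four rfl rfl (by simp) (by simp))

theorem comp (hf : HasPairGrad Q f x y p) {φ : ℂ → ℂ} {φ' : ℂ} (hφ : HasDerivAt φ φ' (f p)) :
    HasPairGrad Q (fun q => φ (f q)) (φ' * x) (φ' * y) p :=
  (HasFrameGrad.comp hf hφ).congr_grad (forall_fin_four rfl rfl (by simp) (by simp))

end HasPairGrad

theorem hasFrameGrad_blockMatrix {Q : Matrix (Fin 4) (Fin 4) ℂ} {x y s q r : (Fin 4 → ℝ) → ℂ}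
    {x₀ y₀ s₀ q₀ r₀ x₁ y₁ s₁ q₁ r₁ : ℂ} {p : Fin 4 → ℝ} (hx : HasPairGrad Q x x₀ x₁ p)
    (hy : HasPairGrad Q y y₀ y₁ p) (hs : HasPairGrad Q s s₀ s₁ p)
    (hq : HasPairGrad Q q q₀ q₁ p) (hr : HasPairGrad Q r r₀ r₁ p)
    (i j : Fin 4) :
    HasFrameGrad Q (fun t => blockMatrix (x t) (y t) (s t) (q t) (r t) i j)
      (fun c => firstJet (blockMatrix x₀ y₀ s₀ q₀ r₀) (blockMatrix x₁ y₁ s₁ q₁ r₁) c i j) p := by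
  have h0 : HasFrameGrad Q (fun _ => 0) ![0, 0, 0, 0] p :=
    (HasFrameGrad.const 0).congr_grad (forall_fin_four rfl rfl rfl rfl)
  revert i j
  refine forall_fin_four ?_ ?_ ?_ ?_ <;> refine forall_fin_four ?_ ?_ ?_ ?_
  exacts [HasFrameGrad.congr_grad hx (forall_fin_four rfl rfl rfl rfl),
    HasFrameGrad.congr_grad h0 (forall_fin_four rfl rfl rfl rfl),
    HasFrameGrad.congr_grad h0 (forall_fin_four rfl rfl rfl rfl),
    HasFrameGrad.congr_grad h0 (forall_fin_four rfl rfl rfl rfl),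
    HasFrameGrad.congr_grad h0 (forall_fin_four rfl rfl rfl rfl),
    HasFrameGrad.congr_grad hy (forall_fin_four rfl rfl rfl rfl),
    HasFrameGrad.congr_grad h0 (forall_fin_four rfl rfl rfl rfl),
    HasFrameGrad.congr_grad h0 (forall_fin_four rfl rfl rfl rfl),
    HasFrameGrad.congr_grad h0 (forall_fin_four rfl rfl rfl rfl),
    HasFrameGrad.congr_grad h0 (forall_fin_four rfl rfl rfl rfl),
    HasFrameGrad.congr_grad hs (forall_fin_four rfl rfl rfl rfl),
    HasFrameGrad.congr_grad hq (forall_fin_four rfl rfl rfl rfl),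
    HasFrameGrad.congr_grad h0 (forall_fin_four rfl rfl rfl rfl),
    HasFrameGrad.congr_grad h0 (forall_fin_four rfl rfl rfl rfl),
    HasFrameGrad.congr_grad hq (forall_fin_four rfl rfl rfl rfl),
    HasFrameGrad.congr_grad hr (forall_fin_four rfl rfl rfl rfl)]

theorem hasFrameGrad_firstJet {Q : Matrix (Fin 4) (Fin 4) ℂ}
    {M₀ M₁ : (Fin 4 → ℝ) → Matrix (Fin 4) (Fin 4) ℂ} {M₀₀ M₀₁ M₁₁ : Matrix (Fin 4) (Fin 4) ℂ}
    {p : Fin 4 → ℝ}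
    (h₀ : ∀ j k, HasFrameGrad Q (fun t => M₀ t j k) (fun c => firstJet M₀₀ M₀₁ c j k) p)
    (h₁ : ∀ j k, HasFrameGrad Q (fun t => M₁ t j k) (fun c => firstJet M₀₁ M₁₁ c j k) p)
    (i j k : Fin 4) :
    HasFrameGrad Q (fun t => firstJet (M₀ t) (M₁ t) i j k)
      (fun c => secondJet M₀₀ M₀₁ M₁₁ c i j k) p := by
  revert i
  refine forall_fin_four ?_ ?_ ?_ ?_
  · exact (h₀ j k).congr_grad (forall_fin_four rfl rfl rfl rfl)
  · exact (h₁ j k).congr_grad (forall_fin_four rfl rfl rfl rfl)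
  · exact (HasFrameGrad.const 0).congr_grad (forall_fin_four rfl rfl rfl rfl)
  · exact (HasFrameGrad.const 0).congr_grad (forall_fin_four rfl rfl rfl rfl)

/-! ### Orthotoric charts and the condition on the profile functions -/

/-- A presentation of `g` and `ω` on `U`, in a constant complex frame with coframe
`dX, dY, ds₀, ds₁`, as
`g = (a - b)(E dX² - e dY²) + (a - b)⁻¹ (A (ds₀ + b ds₁)² - B (ds₀ + a ds₁)²)` and
`ω = a' dX ∧ (ds₀ + b ds₁) + b' dY ∧ (ds₀ + a ds₁)`, where `a, E, A` depend on `X` and `b, e, B`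
on `Y` only; `A₁, A₂` and `B₁, B₂` are derivatives with respect to `a` and `b`, the other subscripts
denote derivatives with respect to `X` and `Y`. -/
structure OrthotoricChart (g ω : FormField 4) (U : Set (Fin 4 → ℝ)) where
  P : Matrix (Fin 4) (Fin 4) ℂ
  Q : Matrix (Fin 4) (Fin 4) ℂ
  Q_mul_P : Q * P = 1
  a : (Fin 4 → ℝ) → ℂ
  a₁ : (Fin 4 → ℝ) → ℂ
  a₂ : (Fin 4 → ℝ) → ℂ
  b : (Fin 4 → ℝ) → ℂ
  b₁ : (Fin 4 → ℝ) → ℂ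
  b₂ : (Fin 4 → ℝ) → ℂ
  E : (Fin 4 → ℝ) → ℂ
  E₁ : (Fin 4 → ℝ) → ℂ
  E₂ : (Fin 4 → ℝ) → ℂ
  e : (Fin 4 → ℝ) → ℂ
  e₁ : (Fin 4 → ℝ) → ℂ
  e₂ : (Fin 4 → ℝ) → ℂ
  A : (Fin 4 → ℝ) → ℂ
  A₁ : (Fin 4 → ℝ) → ℂ
  A₂ : (Fin 4 → ℝ) → ℂ
  B : (Fin 4 → ℝ) → ℂ
  B₁ : (Fin 4 → ℝ) → ℂ
  B₂ : (Fin 4 → ℝ) → ℂ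
  grad_a : ∀ p ∈ U, HasPairGrad Q a (a₁ p) 0 p
  grad_a₁ : ∀ p ∈ U, HasPairGrad Q a₁ (a₂ p) 0 p
  grad_b : ∀ p ∈ U, HasPairGrad Q b 0 (b₁ p) p
  grad_b₁ : ∀ p ∈ U, HasPairGrad Q b₁ 0 (b₂ p) p
  grad_E : ∀ p ∈ U, HasPairGrad Q E (E₁ p) 0 p
  grad_E₁ : ∀ p ∈ U, HasPairGrad Q E₁ (E₂ p) 0 p
  grad_e : ∀ p ∈ U, HasPairGrad Q e 0 (e₁ p) p
  grad_e₁ : ∀ p ∈ U, HasPairGrad Q e₁ 0 (e₂ p) p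
  grad_A : ∀ p ∈ U, HasPairGrad Q A (a₁ p * A₁ p) 0 p
  grad_A₁ : ∀ p ∈ U, HasPairGrad Q A₁ (a₁ p * A₂ p) 0 p
  grad_B : ∀ p ∈ U, HasPairGrad Q B 0 (b₁ p * B₁ p) p
  grad_B₁ : ∀ p ∈ U, HasPairGrad Q B₁ 0 (b₁ p * B₂ p) p
  sub_ne : ∀ p ∈ U, a p - b p ≠ 0
  a₁_ne : ∀ p ∈ U, a₁ p ≠ 0
  b₁_ne : ∀ p ∈ U, b₁ p ≠ 0
  A_ne : ∀ p ∈ U, A p ≠ 0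
  B_ne : ∀ p ∈ U, B p ≠ 0
  E_mul_A : ∀ p ∈ U, E p * A p = a₁ p ^ 2
  e_mul_B : ∀ p ∈ U, e p * B p = b₁ p ^ 2
  metric_eq : ∀ p ∈ U, (g p).map Complex.ofReal
    = Qᵀ * orthoMetric (a p) (b p) (E p) (e p) (A p) (B p) * Q
  form_eq : ∀ p ∈ U, (ω p).map Complex.ofReal
    = Qᵀ * !![0, 0, a₁ p, a₁ p * b p; 0, 0, b₁ p, b₁ p * a p; -a₁ p, -b₁ p, 0, 0;
        -(a₁ p * b p), -(b₁ p * a p), 0, 0] * Q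

namespace OrthotoricChart
variable {g ω : FormField 4} {U : Set (Fin 4 → ℝ)} (F : OrthotoricChart g ω U) {p : Fin 4 → ℝ}

/-- The derivative of `(A - B)/(a - b)` with respect to `a`. -/
noncomputable def u (p : Fin 4 → ℝ) : ℂ :=
  (F.A₁ p * (F.a p - F.b p) - F.A p + F.B p) / (F.a p - F.b p) ^ 2

/-- The derivative of `(A - B)/(a - b)` with respect to `b`. -/
noncomputable def v (p : Fin 4 → ℝ) : ℂ :=
  (-F.B₁ p * (F.a p - F.b p) - F.B p + F.A p) / (F.a p - F.b p) ^ 2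

/-- The second derivative of `(A - B)/(a - b)` with respect to `a`. -/
noncomputable def u₁ (p : Fin 4 → ℝ) : ℂ := (F.A₂ p - 2 * F.u p) / (F.a p - F.b p)

/-- The second derivative of `(A - B)/(a - b)` with respect to `b`. -/
noncomputable def v₁ (p : Fin 4 → ℝ) : ℂ := (-F.B₂ p + 2 * F.v p) / (F.a p - F.b p)

/-- The mixed second derivative of `(A - B)/(a - b)`. -/
noncomputable def w (p : Fin 4 → ℝ) : ℂ :=
  (F.B₁ p - F.A₁ p + 2 * (F.a p - F.b p) * F.u p) / (F.a p - F.b p) ^ 2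

theorem grad_u (hp : p ∈ U) :
    HasPairGrad F.Q F.u (F.a₁ p * F.u₁ p) (F.b₁ p * F.w p) p := by
  have h := F.sub_ne p hp
  have hΔ := (F.grad_a p hp).sub (F.grad_b p hp)
  refine (((((F.grad_A₁ p hp).mul hΔ).sub (F.grad_A p hp)).add (F.grad_B p hp)).div (hΔ.pow 2)
    (pow_ne_zero 2 h)).congr ?_ ?_
  · simp only [u₁, u]; field_simp; ring
  · simp only [w, u]; field_simp; ring

/-- By equality of mixed derivatives the `a`-derivative of `v` is the same `w` as the `b`-derivative
of `u`. -/
theorem grad_v (hp : p ∈ U) :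
    HasPairGrad F.Q F.v (F.a₁ p * F.w p) (F.b₁ p * F.v₁ p) p := by
  have h := F.sub_ne p hp
  have hΔ := (F.grad_a p hp).sub (F.grad_b p hp)
  refine (((((F.grad_B₁ p hp).neg.mul hΔ).sub (F.grad_B p hp)).add (F.grad_A p hp)).div (hΔ.pow 2)
    (pow_ne_zero 2 h)).congr ?_ ?_
  · simp only [w, u]; field_simp; ring
  · simp only [v₁, v]; field_simp; ring

/-- Derivative of `E A = a₁²` along `X`. -/
theorem E₁_mul_A (hU : IsOpen U) (hp : p ∈ U) :
    F.E₁ p * F.A p + F.E p * (F.a₁ p * F.A₁ p) = 2 * F.a₁ p * F.a₂ p := by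
  have h := HasFrameGrad.unique F.Q_mul_P ((F.grad_E p hp).mul (F.grad_A p hp))
    (HasFrameGrad.congr_fun ((F.grad_a₁ p hp).pow 2) hU hp F.E_mul_A)
  have := congrFun h 0
  simpa using this

theorem e₁_mul_B (hU : IsOpen U) (hp : p ∈ U) :
    F.e₁ p * F.B p + F.e p * (F.b₁ p * F.B₁ p) = 2 * F.b₁ p * F.b₂ p := by
  have h := HasFrameGrad.unique F.Q_mul_P ((F.grad_e p hp).mul (F.grad_B p hp))
    (HasFrameGrad.congr_fun ((F.grad_b₁ p hp).pow 2) hU hp F.e_mul_B)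
  have := congrFun h 1
  simpa using this

theorem grad_metric (hp : p ∈ U) (i j : Fin 4) :
    HasFrameGrad F.Q
      (fun q => orthoMetric (F.a q) (F.b q) (F.E q) (F.e q) (F.A q) (F.B q) i j)
      (fun c => orthoD (F.a p) (F.b p) (F.a₁ p) (F.b₁ p) (F.E p) (F.E₁ p) (F.e p) (F.e₁ p) (F.A p)
        (F.B p) (F.u p) (F.v p) c i j) p := by
  have h := F.sub_ne p hp
  have ha := F.grad_a p hp
  have hb := F.grad_b p hp
  have hA := F.grad_A p hp
  have hB := F.grad_B p hp
  have hΔ := ha.sub hb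
  refine hasFrameGrad_blockMatrix ((hΔ.mul (F.grad_E p hp)).congr ?_ ?_)
    ((hΔ.mul (F.grad_e p hp)).neg.congr ?_ ?_)
    (((hA.sub hB).div hΔ h).congr ?_ ?_)
    ((((hA.mul hb).sub (hB.mul ha)).div hΔ h).congr ?_ ?_)
    ((((hA.mul (hb.pow 2)).sub (hB.mul (ha.pow 2))).div hΔ h).congr ?_ ?_) i j <;>
  · try simp only [u, v]
    push_cast
    field_simp
    ring

theorem grad_D (hp : p ∈ U) (i j k : Fin 4) :
    HasFrameGrad F.Q
      (fun q => orthoD (F.a q) (F.b q) (F.a₁ q) (F.b₁ q) (F.E q) (F.E₁ q) (F.e q) (F.e₁ q) (F.A q)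
        (F.B q) (F.u q) (F.v q) i j k)
      (fun c => orthoT (F.a p) (F.b p) (F.a₁ p) (F.b₁ p) (F.a₂ p) (F.b₂ p) (F.E p) (F.E₁ p) (F.E₂ p)
        (F.e p) (F.e₁ p) (F.e₂ p) (F.A p) (F.B p) (F.B₁ p) (F.u p) (F.v p) (F.u₁ p) (F.v₁ p)
        (F.w p) c i j k) p := by
  have h := F.sub_ne p hp
  have ha := F.grad_a p hp
  have hb := F.grad_b p hp
  have ha₁ := F.grad_a₁ p hp
  have hb₁ := F.grad_b₁ p hp
  have hA := F.grad_A p hp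
  have hB := F.grad_B p hp
  have hE := F.grad_E p hp
  have hE₁ := F.grad_E₁ p hp
  have he := F.grad_e p hp
  have he₁ := F.grad_e₁ p hp
  have hu := F.grad_u hp
  have hv := F.grad_v hp
  have hΔ := ha.sub hb
  refine hasFrameGrad_firstJet
    (fun j k => hasFrameGrad_blockMatrix (((ha₁.mul hE).add (hΔ.mul hE₁)).congr ?_ ?_)
      ((ha₁.mul he).neg.congr ?_ ?_) ((ha₁.mul hu).congr ?_ ?_)
      ((ha₁.mul (hb.mul hu)).congr ?_ ?_)
      ((ha₁.mul (((hb.pow 2).mul hu).sub hB)).congr ?_ ?_) j k)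
    (fun j k => hasFrameGrad_blockMatrix ((hb₁.mul hE).neg.congr ?_ ?_)
      (((hb₁.mul he).sub (hΔ.mul he₁)).congr ?_ ?_) ((hb₁.mul hv).congr ?_ ?_)
      ((hb₁.mul (ha.mul hv)).congr ?_ ?_)
      ((hb₁.mul (((ha.pow 2).mul hv).sub hA)).congr ?_ ?_) j k) i j k
  all_goals
    try simp only [u, v, w]
    push_cast
    first | done | ring1 | (field_simp; try ring1)

/-- The jet of the chart at a point. -/
noncomputable def frameJet (hp : p ∈ U) : FrameJet g ω U p where
  P := F.P
  Q := F.Q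
  G q := orthoMetric (F.a q) (F.b q) (F.E q) (F.e q) (F.A q) (F.B q)
  N := orthoInv (F.a p) (F.b p) (F.E p) (F.e p) (F.A p) (F.B p)
  J := orthoJ (F.a p) (F.b p) (F.a₁ p) (F.b₁ p) (F.A p) (F.B p)
  D q := orthoD (F.a q) (F.b q) (F.a₁ q) (F.b₁ q) (F.E q) (F.E₁ q) (F.e q) (F.e₁ q) (F.A q) (F.B q)
    (F.u q) (F.v q)
  T := orthoT (F.a p) (F.b p) (F.a₁ p) (F.b₁ p) (F.a₂ p) (F.b₂ p) (F.E p) (F.E₁ p) (F.E₂ p)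
    (F.e p) (F.e₁ p) (F.e₂ p) (F.A p) (F.B p) (F.B₁ p) (F.u p) (F.v p) (F.u₁ p) (F.v₁ p) (F.w p)
  Q_mul_P := F.Q_mul_P
  metric_eq := F.metric_eq
  form_eq := by
    rw [F.form_eq p hp, orthoJ_transpose_mul (F.sub_ne p hp) (F.a₁_ne p hp) (F.b₁_ne p hp)
      (F.A_ne p hp) (F.B_ne p hp) (F.E_mul_A p hp) (F.e_mul_B p hp)]
  G_mul_N := orthoMetric_mul_orthoInv (F.sub_ne p hp)
    (left_ne_zero_of_mul (F.E_mul_A p hp ▸ pow_ne_zero 2 (F.a₁_ne p hp)))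
    (left_ne_zero_of_mul (F.e_mul_B p hp ▸ pow_ne_zero 2 (F.b₁_ne p hp))) (F.A_ne p hp) (F.B_ne p hp)
  G_symm _ := blockMatrix_isSymm ..
  D_symm _ := orthoD_symm
  T_symm := secondJet_symm_left
  hasFrameGrad_G _ hq := F.grad_metric hq
  hasFrameGrad_D := F.grad_D hp

theorem hu (hp : p ∈ U) :
    F.A₁ p = (F.A p - F.B p) / (F.a p - F.b p) + F.u p * (F.a p - F.b p) := by
  have h := F.sub_ne p hp
  simp only [u]
  field_simp
  ring

/-- If the holomorphic sectional curvature is constant, then so is the second derivative of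
`(A - B)/(a - b)` with respect to `a`. -/
theorem u₁_eq_of_hasConstantHSC (hU : IsOpen U) (h : HasConstantHSC g ω U) :
    ∃ κ : ℂ, ∀ p ∈ U, F.u₁ p = κ := by
  obtain ⟨κ, hκ⟩ := (hasConstantHSC_iff_defect (fun _ => hU) (fun _ hp => hp)
    (fun p hp => F.frameJet hp)).1 h
  refine ⟨-2 * κ, fun p hp => ?_⟩
  have hE : F.E p ≠ 0 := left_ne_zero_of_mul (F.E_mul_A p hp ▸ pow_ne_zero 2 (F.a₁_ne p hp))
  have hx : (![1, 0, 0, 0] : Fin 4 → ℂ) ⬝ᵥ (F.frameJet hp).G p *ᵥ ![1, 0, 0, 0]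
      = (F.a p - F.b p) * F.E p := by
    simp [frameJet, orthoMetric, blockMatrix, Matrix.mulVec, dotProduct, Fin.sum_univ_four]
  have h0 : (F.a p - F.b p) * F.E p ≠ 0 := mul_ne_zero (F.sub_ne p hp) hE
  -- The test vector is `∂_X`. In the complex type it is `∂_z`, which is why the criterion must
  -- allow complex vectors.
  have := hκ p hp ![1, 0, 0, 0] (hx ▸ h0)
  rw [FrameJet.defect, hx, FrameJet.curv] at this
  have hc := ortho_curvature_first (a₂ := F.a₂ p) (b₂ := F.b₂ p) (E₂ := F.E₂ p) (e₁ := F.e₁ p)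
    (e₂ := F.e₂ p) (B₁ := F.B₁ p) (v := F.v p) (u₁ := F.u₁ p) (v₁ := F.v₁ p) (w := F.w p)
    (F.sub_ne p hp) (F.a₁_ne p hp) (F.b₁_ne p hp) (F.A_ne p hp) (F.B_ne p hp) (F.E_mul_A p hp)
    (F.e_mul_B p hp) (F.E₁_mul_A hU hp) (F.hu hp) rfl rfl
  have h2 := hc.symm.trans (sub_eq_zero.1 this)
  have h3 := mul_right_cancel₀ (pow_ne_zero 2 h0) h2
  linear_combination (-2) * h3

/-- For a common polynomial `α + β t + γ t²` the quotient `(A - B)/(a - b)` equals `β + γ (a + b)`.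
All its second derivatives vanish and both first derivatives are `γ`, so the metric is flat. -/
theorem hasConstantHSC_of_quadratic (hU : IsOpen U) (α β γ : ℂ)
    (hA : ∀ p ∈ U, F.A p = α + β * F.a p + γ * F.a p ^ 2)
    (hB : ∀ p ∈ U, F.B p = α + β * F.b p + γ * F.b p ^ 2) : HasConstantHSC g ω U := by
  have hA₁ : ∀ p ∈ U, F.A₁ p = β + 2 * γ * F.a p := fun p hp => by
    -- The values of `A₁` follow by differentiating the polynomial identity along `X` and cancelling
    -- `a₁`; likewise for `B₁`, `A₂` and `B₂`.
    have h := congrFun (HasFrameGrad.unique F.Q_mul_P (F.grad_A p hp) (HasFrameGrad.congr_fun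
      (((HasPairGrad.const α).add ((HasPairGrad.const β).mul (F.grad_a p hp))).add
        ((HasPairGrad.const γ).mul ((F.grad_a p hp).pow 2))) hU hp hA)) 0
    refine mul_left_cancel₀ (F.a₁_ne p hp) ?_
    simp at h
    linear_combination h
  have hB₁ : ∀ p ∈ U, F.B₁ p = β + 2 * γ * F.b p := fun p hp => by
    have h := congrFun (HasFrameGrad.unique F.Q_mul_P (F.grad_B p hp) (HasFrameGrad.congr_fun
      (((HasPairGrad.const α).add ((HasPairGrad.const β).mul (F.grad_b p hp))).add
        ((HasPairGrad.const γ).mul ((F.grad_b p hp).pow 2))) hU hp hB)) 1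
    refine mul_left_cancel₀ (F.b₁_ne p hp) ?_
    simp at h
    linear_combination h
  have hA₂ : ∀ p ∈ U, F.A₂ p = 2 * γ := fun p hp => by
    have h := congrFun (HasFrameGrad.unique F.Q_mul_P (F.grad_A₁ p hp) (HasFrameGrad.congr_fun
      ((HasPairGrad.const β).add ((HasPairGrad.const (2 * γ)).mul (F.grad_a p hp))) hU hp hA₁)) 0
    refine mul_left_cancel₀ (F.a₁_ne p hp) ?_
    simp at h
    linear_combination h
  have hB₂ : ∀ p ∈ U, F.B₂ p = 2 * γ := fun p hp => by
    have h := congrFun (HasFrameGrad.unique F.Q_mul_P (F.grad_B₁ p hp) (HasFrameGrad.congr_fun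
      ((HasPairGrad.const β).add ((HasPairGrad.const (2 * γ)).mul (F.grad_b p hp))) hU hp hB₁)) 1
    refine mul_left_cancel₀ (F.b₁_ne p hp) ?_
    simp at h
    linear_combination h
  refine (hasConstantHSC_iff_defect (fun _ => hU) (fun _ hp => hp)
    (fun p hp => F.frameJet hp)).2 ⟨0, fun p hp x _ => ?_⟩
  have h := F.sub_ne p hp
  have hu : F.u p = γ := by
    rw [u, hA₁ p hp, hA p hp, hB p hp]; field_simp; ring
  have hv : F.v p = F.u p := by
    rw [hu, v, hB₁ p hp, hA p hp, hB p hp]; field_simp; ring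
  have hu₁ : F.u₁ p = 0 := by rw [u₁, hu, hA₂ p hp]; simp
  have hv₁ : F.v₁ p = 0 := by rw [v₁, hv, hu, hB₂ p hp]; simp
  have hw : F.w p = 0 := by
    rw [w, hu, hB₁ p hp, hA₁ p hp]; field_simp; ring
  have hc := ortho_curvature_eq_zero (E₂ := F.E₂ p) (e₂ := F.e₂ p) h (F.a₁_ne p hp) (F.b₁_ne p hp)
    (F.A_ne p hp) (F.B_ne p hp) (F.E_mul_A p hp) (F.e_mul_B p hp) (F.E₁_mul_A hU hp)
    (F.e₁_mul_B hU hp) (F.hu hp) (by rw [hB₁ p hp, hA p hp, hB p hp, hu]; field_simp; ring) x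
    ((F.frameJet hp).J *ᵥ x)
  simp only [FrameJet.defect, FrameJet.curv, Complex.ofReal_zero, zero_mul, sub_zero]
  simp only [frameJet, hu₁, hv₁, hw, hv] at hc ⊢
  exact hc

end OrthotoricChart

/-- Clearing denominators in `u₁ = κ` gives the first identity. Its first two derivatives along `Y`
give the next two. The constancy of `A₃` comes from a derivative along `X`, which kills `B₁`. -/
theorem OrthotoricChart.taylor_of_hasConstantHSC {g ω : FormField 4} {U : Set (Fin 4 → ℝ)}
    (F : OrthotoricChart g ω U) {A₃ : (Fin 4 → ℝ) → ℂ} (hU : IsOpen U)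
    (hA₂ : ∀ p ∈ U, HasPairGrad F.Q F.A₂ (F.a₁ p * A₃ p) 0 p) (h : HasConstantHSC g ω U) :
    ∃ κ : ℂ, ∀ p ∈ U,
      2 * F.B p = 2 * F.A p - 2 * F.A₁ p * (F.a p - F.b p) + F.A₂ p * (F.a p - F.b p) ^ 2
        - κ * (F.a p - F.b p) ^ 3 ∧
      2 * F.B₁ p = 2 * F.A₁ p - 2 * F.A₂ p * (F.a p - F.b p) + 3 * κ * (F.a p - F.b p) ^ 2 ∧
      F.B₂ p = F.A₂ p - 3 * κ * (F.a p - F.b p) ∧ A₃ p = 3 * κ := by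
  obtain ⟨κ, hκ⟩ := F.u₁_eq_of_hasConstantHSC hU h
  have h0 : ∀ p ∈ U, 2 * F.B p = 2 * F.A p - 2 * F.A₁ p * (F.a p - F.b p)
      + F.A₂ p * (F.a p - F.b p) ^ 2 - κ * (F.a p - F.b p) ^ 3 := fun p hp => by
    have h := F.sub_ne p hp
    rw [← hκ p hp, u₁, u]
    field_simp
    ring
  have hΔ := fun p hp => (F.grad_a p hp).sub (F.grad_b p hp)
  have h1 : ∀ p ∈ U, 2 * F.B₁ p = 2 * F.A₁ p - 2 * F.A₂ p * (F.a p - F.b p)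
      + 3 * κ * (F.a p - F.b p) ^ 2 := fun p hp => by
    have h := congrFun (HasFrameGrad.unique F.Q_mul_P ((HasPairGrad.const 2).mul (F.grad_B p hp))
      (HasFrameGrad.congr_fun (((((HasPairGrad.const 2).mul (F.grad_A p hp)).sub
        (((HasPairGrad.const 2).mul (F.grad_A₁ p hp)).mul (hΔ p hp))).add
        ((hA₂ p hp).mul ((hΔ p hp).pow 2))).sub ((HasPairGrad.const κ).mul ((hΔ p hp).pow 3)))
        hU hp h0)) 1
    refine mul_left_cancel₀ (F.b₁_ne p hp) ?_
    simp at h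
    linear_combination h
  have h2 : ∀ p ∈ U, F.B₂ p = F.A₂ p - 3 * κ * (F.a p - F.b p) := fun p hp => by
    have h := congrFun (HasFrameGrad.unique F.Q_mul_P ((HasPairGrad.const 2).mul (F.grad_B₁ p hp))
      (HasFrameGrad.congr_fun ((((HasPairGrad.const 2).mul (F.grad_A₁ p hp)).sub
        (((HasPairGrad.const 2).mul (hA₂ p hp)).mul (hΔ p hp))).add
        ((HasPairGrad.const (3 * κ)).mul ((hΔ p hp).pow 2))) hU hp h1)) 1
    refine mul_left_cancel₀ (F.b₁_ne p hp) (mul_left_cancel₀ (two_ne_zero (α := ℂ)) ?_)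
    simp at h
    linear_combination h
  refine ⟨κ, fun p hp => ⟨h0 p hp, h1 p hp, h2 p hp, ?_⟩⟩
  -- The identity for `B₁` is now differentiated along `X`: the left side contributes 0, the terms
  -- with `A₂` cancel, and a factor `a - b` can be removed.
  have h := congrFun (HasFrameGrad.unique F.Q_mul_P
    (((HasPairGrad.const 2).mul (F.grad_B₁ p hp)))
      (HasFrameGrad.congr_fun ((((HasPairGrad.const 2).mul (F.grad_A₁ p hp)).sub
        (((HasPairGrad.const 2).mul (hA₂ p hp)).mul (hΔ p hp))).add
        ((HasPairGrad.const (3 * κ)).mul ((hΔ p hp).pow 2))) hU hp h1)) 0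
  refine mul_left_cancel₀ (F.a₁_ne p hp) (mul_left_cancel₀ (F.sub_ne p hp) ?_)
  simp at h
  linear_combination (1 / 2 : ℂ) * h

/-! ### Profiles of one complex variable -/

/-- Functions `a` and `E` of one complex variable with `A = a'² / E`. The functions `A₁, A₂, A₃` are
the derivatives of `A` with respect to `a`, the other subscripts denote derivatives; `A₄` is the
derivative of `A₃`. -/
structure OrthotoricProfile (S : Set ℂ) where
  a : ℂ → ℂ
  a₁ : ℂ → ℂ
  a₂ : ℂ → ℂ
  E : ℂ → ℂ
  E₁ : ℂ → ℂ
  E₂ : ℂ → ℂ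
  A : ℂ → ℂ
  A₁ : ℂ → ℂ
  A₂ : ℂ → ℂ
  A₃ : ℂ → ℂ
  A₄ : ℂ → ℂ
  deriv_a : ∀ z ∈ S, HasDerivAt a (a₁ z) z
  deriv_a₁ : ∀ z ∈ S, HasDerivAt a₁ (a₂ z) z
  deriv_E : ∀ z ∈ S, HasDerivAt E (E₁ z) z
  deriv_E₁ : ∀ z ∈ S, HasDerivAt E₁ (E₂ z) z
  deriv_A : ∀ z ∈ S, HasDerivAt A (a₁ z * A₁ z) z
  deriv_A₁ : ∀ z ∈ S, HasDerivAt A₁ (a₁ z * A₂ z) z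
  deriv_A₂ : ∀ z ∈ S, HasDerivAt A₂ (a₁ z * A₃ z) z
  deriv_A₃ : ∀ z ∈ S, HasDerivAt A₃ (A₄ z) z
  a₁_ne : ∀ z ∈ S, a₁ z ≠ 0
  A_ne : ∀ z ∈ S, A z ≠ 0
  E_mul_A : ∀ z ∈ S, E z * A z = a₁ z ^ 2

/-- A presentation of `g` and `ω` on `U` by profiles with the arguments `X` and `Y`. -/
structure OrthotoricPresentation {S : Set ℂ} (p₀ p₁ : OrthotoricProfile S) (g ω : FormField 4)
    (U : Set (Fin 4 → ℝ)) where
  P : Matrix (Fin 4) (Fin 4) ℂ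
  Q : Matrix (Fin 4) (Fin 4) ℂ
  X : (Fin 4 → ℝ) → ℂ
  Y : (Fin 4 → ℝ) → ℂ
  Q_mul_P : Q * P = 1
  grad_X : ∀ p, HasPairGrad Q X 1 0 p
  grad_Y : ∀ p, HasPairGrad Q Y 0 1 p
  X_mem : ∀ p ∈ U, X p ∈ S
  Y_mem : ∀ p ∈ U, Y p ∈ S
  ne : ∀ p ∈ U, p₀.a (X p) ≠ p₁.a (Y p)
  metric_eq : ∀ p ∈ U, (g p).map Complex.ofReal = Qᵀ * orthoMetric (p₀.a (X p)) (p₁.a (Y p))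
    (p₀.E (X p)) (p₁.E (Y p)) (p₀.A (X p)) (p₁.A (Y p)) * Q
  form_eq : ∀ p ∈ U, (ω p).map Complex.ofReal
    = Qᵀ * !![0, 0, p₀.a₁ (X p), p₀.a₁ (X p) * p₁.a (Y p);
        0, 0, p₁.a₁ (Y p), p₁.a₁ (Y p) * p₀.a (X p); -p₀.a₁ (X p), -p₁.a₁ (Y p), 0, 0;
        -(p₀.a₁ (X p) * p₁.a (Y p)), -(p₁.a₁ (Y p) * p₀.a (X p)), 0, 0] * Q

namespace OrthotoricPresentation
variable {S : Set ℂ} {p₀ p₁ : OrthotoricProfile S} {g ω : FormField 4} {U : Set (Fin 4 → ℝ)}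
  (F : OrthotoricPresentation p₀ p₁ g ω U) {p : Fin 4 → ℝ}

theorem grad_comp_X {φ : ℂ → ℂ} {φ' : ℂ} (h : HasDerivAt φ φ' (F.X p)) :
    HasPairGrad F.Q (fun q => φ (F.X q)) φ' 0 p :=
  ((F.grad_X p).comp h).congr (by simp) (by simp)

theorem grad_comp_Y {φ : ℂ → ℂ} {φ' : ℂ} (h : HasDerivAt φ φ' (F.Y p)) :
    HasPairGrad F.Q (fun q => φ (F.Y q)) 0 φ' p :=
  ((F.grad_Y p).comp h).congr (by simp) (by simp)

/-- The chart of a presentation. -/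
noncomputable def chart : OrthotoricChart g ω U where
  P := F.P
  Q := F.Q
  Q_mul_P := F.Q_mul_P
  a p := p₀.a (F.X p)
  a₁ p := p₀.a₁ (F.X p)
  a₂ p := p₀.a₂ (F.X p)
  b p := p₁.a (F.Y p)
  b₁ p := p₁.a₁ (F.Y p)
  b₂ p := p₁.a₂ (F.Y p)
  E p := p₀.E (F.X p)
  E₁ p := p₀.E₁ (F.X p)
  E₂ p := p₀.E₂ (F.X p)
  e p := p₁.E (F.Y p)
  e₁ p := p₁.E₁ (F.Y p)
  e₂ p := p₁.E₂ (F.Y p)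
  A p := p₀.A (F.X p)
  A₁ p := p₀.A₁ (F.X p)
  A₂ p := p₀.A₂ (F.X p)
  B p := p₁.A (F.Y p)
  B₁ p := p₁.A₁ (F.Y p)
  B₂ p := p₁.A₂ (F.Y p)
  grad_a p hp := F.grad_comp_X (p₀.deriv_a _ (F.X_mem p hp))
  grad_a₁ p hp := F.grad_comp_X (p₀.deriv_a₁ _ (F.X_mem p hp))
  grad_b p hp := F.grad_comp_Y (p₁.deriv_a _ (F.Y_mem p hp))
  grad_b₁ p hp := F.grad_comp_Y (p₁.deriv_a₁ _ (F.Y_mem p hp))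
  grad_E p hp := F.grad_comp_X (p₀.deriv_E _ (F.X_mem p hp))
  grad_E₁ p hp := F.grad_comp_X (p₀.deriv_E₁ _ (F.X_mem p hp))
  grad_e p hp := F.grad_comp_Y (p₁.deriv_E _ (F.Y_mem p hp))
  grad_e₁ p hp := F.grad_comp_Y (p₁.deriv_E₁ _ (F.Y_mem p hp))
  grad_A p hp := F.grad_comp_X (p₀.deriv_A _ (F.X_mem p hp))
  grad_A₁ p hp := F.grad_comp_X (p₀.deriv_A₁ _ (F.X_mem p hp))
  grad_B p hp := F.grad_comp_Y (p₁.deriv_A _ (F.Y_mem p hp))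
  grad_B₁ p hp := F.grad_comp_Y (p₁.deriv_A₁ _ (F.Y_mem p hp))
  sub_ne p hp := sub_ne_zero.2 (F.ne p hp)
  a₁_ne p hp := p₀.a₁_ne _ (F.X_mem p hp)
  b₁_ne p hp := p₁.a₁_ne _ (F.Y_mem p hp)
  A_ne p hp := p₀.A_ne _ (F.X_mem p hp)
  B_ne p hp := p₁.A_ne _ (F.Y_mem p hp)
  E_mul_A p hp := p₀.E_mul_A _ (F.X_mem p hp)
  e_mul_B p hp := p₁.E_mul_A _ (F.Y_mem p hp)
  metric_eq := F.metric_eq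
  form_eq := F.form_eq

/-- The function `A₃` has the constant value `3κ`, so its derivative `A₄` vanishes. This is the
obstruction that excludes most families. -/
theorem A₄_eq_zero_of_hasConstantHSC (hU : IsOpen U) (h : HasConstantHSC g ω U) (hp : p ∈ U) :
    p₀.A₄ (F.X p) = 0 := by
  obtain ⟨κ, hκ⟩ := F.chart.taylor_of_hasConstantHSC (A₃ := fun p => p₀.A₃ (F.X p)) hU
    (fun p hp => F.grad_comp_X (p₀.deriv_A₂ _ (F.X_mem p hp))) h
  exact congrFun (HasFrameGrad.unique F.Q_mul_P (F.grad_comp_X (p₀.deriv_A₃ _ (F.X_mem p hp)))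
    (HasFrameGrad.congr_fun (HasPairGrad.const (3 * κ)) hU hp fun q hq => (hκ q hq).2.2.2)) 0

/-- The vanishing of `A₃` at one point gives `κ = 0`, since `A₃ = 3κ`. The cubic term drops out and
`B` is the quadratic Taylor polynomial of `A`. -/
theorem taylor_of_hasConstantHSC (hU : IsOpen U) (h : HasConstantHSC g ω U) (hp : p ∈ U)
    (h0 : p₀.A₃ (F.X p) = 0) :
    p₁.A (F.Y p) = p₀.A (F.X p) - p₀.A₁ (F.X p) * (p₀.a (F.X p) - p₁.a (F.Y p))
      + p₀.A₂ (F.X p) / 2 * (p₀.a (F.X p) - p₁.a (F.Y p)) ^ 2 ∧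
    p₁.A₁ (F.Y p) = p₀.A₁ (F.X p) - p₀.A₂ (F.X p) * (p₀.a (F.X p) - p₁.a (F.Y p)) ∧
    p₁.A₂ (F.Y p) = p₀.A₂ (F.X p) := by
  obtain ⟨κ, hκ⟩ := F.chart.taylor_of_hasConstantHSC (A₃ := fun p => p₀.A₃ (F.X p)) hU
    (fun p hp => F.grad_comp_X (p₀.deriv_A₂ _ (F.X_mem p hp))) h
  obtain ⟨h1, h2, h3, h4⟩ := hκ p hp
  obtain rfl : κ = 0 := by
    rw [h0] at h4
    simpa using h4.symm
  simp only [chart] at h1 h2 h3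
  refine ⟨?_, ?_, ?_⟩
  · linear_combination h1 / 2
  · linear_combination h2 / 2
  · linear_combination h3

end OrthotoricPresentation

/-! ### The linear, exponential and tangent profiles -/

theorem HasDerivAt.cexp_mul (c k z : ℂ) :
    HasDerivAt (fun z => c * Complex.exp (k * z)) (k * (c * Complex.exp (k * z))) z :=
  ((((hasDerivAt_id' z).const_mul k).cexp).const_mul c).congr_deriv (by ring)

/-- The profile `a = z`, `E = e exp (-k z)`. -/
noncomputable def linearProfile (k e : ℂ) (he : e ≠ 0) : OrthotoricProfile Set.univ where
  a z := z
  a₁ _ := 1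
  a₂ _ := 0
  E z := e * Complex.exp (-k * z)
  E₁ z := -k * (e * Complex.exp (-k * z))
  E₂ z := -k * (-k * (e * Complex.exp (-k * z)))
  A z := 1 / e * Complex.exp (k * z)
  A₁ z := k * (1 / e * Complex.exp (k * z))
  A₂ z := k * (k * (1 / e * Complex.exp (k * z)))
  A₃ z := k * (k * (k * (1 / e * Complex.exp (k * z))))
  A₄ z := k * (k * (k * (k * (1 / e * Complex.exp (k * z)))))
  deriv_a z _ := hasDerivAt_id' z
  deriv_a₁ z _ := hasDerivAt_const z 1
  deriv_E z _ := .cexp_mul ..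
  deriv_E₁ z _ := (HasDerivAt.cexp_mul ..).const_mul _
  deriv_A z _ := (HasDerivAt.cexp_mul ..).congr_deriv (one_mul _).symm
  deriv_A₁ z _ := ((HasDerivAt.cexp_mul ..).const_mul _).congr_deriv (one_mul _).symm
  deriv_A₂ z _ := (((HasDerivAt.cexp_mul ..).const_mul _).const_mul _).congr_deriv (one_mul _).symm
  deriv_A₃ z _ := (((HasDerivAt.cexp_mul ..).const_mul _).const_mul _).const_mul _
  a₁_ne _ _ := one_ne_zero
  A_ne z _ := mul_ne_zero (one_div_ne_zero he) (Complex.exp_ne_zero _)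
  E_mul_A z _ := by
    rw [neg_mul, Complex.exp_neg]
    have := Complex.exp_ne_zero (k * z)
    field_simp

/-- The profile `a = c exp ((β - 1) z)`, `E = e exp (-(β + 2) z)`. -/
noncomputable def expProfile (β c e : ℂ) (hβ : β ≠ 1) (hc : c ≠ 0) (he : e ≠ 0) :
    OrthotoricProfile Set.univ where
  a z := c * Complex.exp ((β - 1) * z)
  a₁ z := (β - 1) * (c * Complex.exp ((β - 1) * z))
  a₂ z := (β - 1) * ((β - 1) * (c * Complex.exp ((β - 1) * z)))
  E z := e * Complex.exp (-(β + 2) * z)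
  E₁ z := -(β + 2) * (e * Complex.exp (-(β + 2) * z))
  E₂ z := -(β + 2) * (-(β + 2) * (e * Complex.exp (-(β + 2) * z)))
  A z := (β - 1) ^ 2 * (c ^ 2 / e) * Complex.exp (3 * β * z)
  A₁ z := 3 * β * (β - 1) * (c / e) * Complex.exp ((2 * β + 1) * z)
  A₂ z := 3 * β * (2 * β + 1) / e * Complex.exp ((β + 2) * z)
  -- As a function of `a`, `A` is a multiple of the power with exponent `q = 3β/(β-1)`. The factors
  -- `β`, `2β + 1` and `β + 2` come from `q`, `q - 1` and `q - 2`.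
  A₃ z := 3 * β * (2 * β + 1) * (β + 2) / ((β - 1) * (c * e)) * Complex.exp (3 * z)
  A₄ z := 3 * (3 * β * (2 * β + 1) * (β + 2) / ((β - 1) * (c * e)) * Complex.exp (3 * z))
  deriv_a z _ := .cexp_mul ..
  deriv_a₁ z _ := (HasDerivAt.cexp_mul ..).const_mul _
  deriv_E z _ := .cexp_mul ..
  deriv_E₁ z _ := (HasDerivAt.cexp_mul ..).const_mul _
  deriv_A z _ := (HasDerivAt.cexp_mul ..).congr_deriv <| by
    rw [show 3 * β * z = (β - 1) * z + (2 * β + 1) * z by ring, Complex.exp_add]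
    field_simp
  deriv_A₁ z _ := (HasDerivAt.cexp_mul ..).congr_deriv <| by
    rw [show (2 * β + 1) * z = (β - 1) * z + (β + 2) * z by ring, Complex.exp_add]
    field_simp
  deriv_A₂ z _ := (HasDerivAt.cexp_mul ..).congr_deriv <| by
    have := sub_ne_zero.2 hβ
    rw [show (β + 2) * z = (β - 1) * z + 3 * z by ring, Complex.exp_add]
    field_simp
  deriv_A₃ z _ := .cexp_mul ..
  a₁_ne z _ := mul_ne_zero (sub_ne_zero.2 hβ) (mul_ne_zero hc (Complex.exp_ne_zero _))
  A_ne z _ := mul_ne_zero (mul_ne_zero (pow_ne_zero 2 (sub_ne_zero.2 hβ))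
    (div_ne_zero (pow_ne_zero 2 hc) he)) (Complex.exp_ne_zero _)
  E_mul_A z _ := by
    have := Complex.exp_ne_zero ((β + 2) * z)
    rw [show 3 * β * z = (β + 2) * z + ((β - 1) * z + (β - 1) * z) by ring, Complex.exp_add,
      Complex.exp_add, neg_mul, Complex.exp_neg]
    field_simp

/-- The profile `a = -tan z`, `E = e exp (-3 β z) / cos z`. -/
noncomputable def tanProfile (β e : ℂ) (he : e ≠ 0) :
    OrthotoricProfile {z | Complex.cos z ≠ 0} where
  a z := -Complex.tan z
  a₁ z := -(1 / Complex.cos z ^ 2)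
  a₂ z := -(2 * Complex.sin z / Complex.cos z ^ 3)
  E z := e * Complex.exp (-(3 * β) * z) / Complex.cos z
  E₁ z := e * Complex.exp (-(3 * β) * z) * (Complex.sin z / Complex.cos z ^ 2
    - 3 * β / Complex.cos z)
  E₂ z := e * Complex.exp (-(3 * β) * z) * (1 / Complex.cos z
    + 2 * Complex.sin z ^ 2 / Complex.cos z ^ 3 - 6 * β * Complex.sin z / Complex.cos z ^ 2
    + 9 * β ^ 2 / Complex.cos z)
  A z := 1 / e * Complex.exp (3 * β * z) / Complex.cos z ^ 3
  A₁ z := -(1 / e * Complex.exp (3 * β * z) * (3 * Complex.sin z / Complex.cos z ^ 2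
    + 3 * β / Complex.cos z))
  A₂ z := 1 / e * Complex.exp (3 * β * z) * (6 / Complex.cos z + (9 * β ^ 2 - 3) * Complex.cos z
    + 12 * β * Complex.sin z)
  A₃ z := -(1 / e * Complex.exp (3 * β * z) * (6 * Complex.sin z
    + (27 * β ^ 2 + 3) * Complex.sin z * Complex.cos z ^ 2
    + (27 * β ^ 3 + 3 * β) * Complex.cos z ^ 3 + 18 * β * Complex.cos z))
  -- With `sin² + cos² = 1` all terms combine into a single multiple of `cos³`, and its coefficient
  -- has no real zero in `β`.
  A₄ z := -(1 / e * Complex.exp (3 * β * z)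
    * (9 * (9 * β ^ 2 + 1) * (β ^ 2 + 1) * Complex.cos z ^ 3))
  deriv_a z hz := (Complex.hasDerivAt_tan hz).neg
  deriv_a₁ z hz := by
    have hz : Complex.cos z ≠ 0 := hz
    refine (((hasDerivAt_const z (1 : ℂ)).div ((Complex.hasDerivAt_cos z).pow 2)
      (pow_ne_zero 2 hz)).neg).congr_deriv ?_
    push_cast
    simp only [Pi.pow_apply]
    field_simp
    ring
  deriv_E z hz := by
    have hz : Complex.cos z ≠ 0 := hz
    refine ((HasDerivAt.cexp_mul e (-(3 * β)) z).div (Complex.hasDerivAt_cos z) hz).congr_deriv ?_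
    field_simp
    ring
  deriv_E₁ z hz := by
    have hz : Complex.cos z ≠ 0 := hz
    refine ((HasDerivAt.cexp_mul e (-(3 * β)) z).mul (((Complex.hasDerivAt_sin z).div
      ((Complex.hasDerivAt_cos z).pow 2) (pow_ne_zero 2 hz)).sub
      ((hasDerivAt_const z (3 * β)).div (Complex.hasDerivAt_cos z) hz))).congr_deriv ?_
    push_cast
    simp only [Pi.div_apply, Pi.sub_apply, Pi.pow_apply]
    field_simp
    ring
  deriv_A z hz := by
    have hz : Complex.cos z ≠ 0 := hz
    refine ((HasDerivAt.cexp_mul (1 / e) (3 * β) z).div ((Complex.hasDerivAt_cos z).pow 3)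
      (pow_ne_zero 3 hz)).congr_deriv ?_
    push_cast
    simp only [Pi.pow_apply]
    field_simp
    ring
  deriv_A₁ z hz := by
    have hz : Complex.cos z ≠ 0 := hz
    refine ((HasDerivAt.cexp_mul (1 / e) (3 * β) z).mul ((((Complex.hasDerivAt_sin z).const_mul
      3).div ((Complex.hasDerivAt_cos z).pow 2) (pow_ne_zero 2 hz)).add
      ((hasDerivAt_const z (3 * β)).div (Complex.hasDerivAt_cos z) hz))).neg.congr_deriv ?_
    push_cast
    simp only [Pi.div_apply, Pi.add_apply, Pi.pow_apply]
    field_simp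
    linear_combination (-6) * Complex.sin_sq_add_cos_sq z
  deriv_A₂ z hz := by
    have hz : Complex.cos z ≠ 0 := hz
    refine ((HasDerivAt.cexp_mul (1 / e) (3 * β) z).mul ((((hasDerivAt_const z (6 : ℂ)).div
      (Complex.hasDerivAt_cos z) hz).add ((Complex.hasDerivAt_cos z).const_mul _)).add
      ((Complex.hasDerivAt_sin z).const_mul (12 * β)))).congr_deriv ?_
    simp only [Pi.div_apply, Pi.add_apply]
    field_simp
    ring
  deriv_A₃ z hz := by
    have hz : Complex.cos z ≠ 0 := hz
    refine ((HasDerivAt.cexp_mul (1 / e) (3 * β) z).mul (((((Complex.hasDerivAt_sin z).const_mul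
      6).add (((Complex.hasDerivAt_sin z).const_mul (27 * β ^ 2 + 3)).mul
      ((Complex.hasDerivAt_cos z).pow 2))).add
      (((Complex.hasDerivAt_cos z).pow 3).const_mul (27 * β ^ 3 + 3 * β))).add
      ((Complex.hasDerivAt_cos z).const_mul (18 * β)))).neg.congr_deriv ?_
    push_cast
    simp only [Pi.mul_apply, Pi.add_apply, Pi.pow_apply]
    field_simp
    linear_combination (54 * β ^ 2 * Complex.cos z + 6 * Complex.cos z)
      * Complex.sin_sq_add_cos_sq z
  a₁_ne z hz := neg_ne_zero.2 (one_div_ne_zero (pow_ne_zero 2 hz))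
  A_ne z hz := div_ne_zero (mul_ne_zero (one_div_ne_zero he) (Complex.exp_ne_zero _))
    (pow_ne_zero 3 hz)
  E_mul_A z hz := by
    have hz : Complex.cos z ≠ 0 := hz
    have := Complex.exp_ne_zero (3 * β * z)
    rw [neg_mul, Complex.exp_neg]
    field_simp

/-! ### Criteria for the three kinds of profiles -/

namespace OrthotoricPresentation
variable {g ω : FormField 4} {U : Set (Fin 4 → ℝ)}

/-- For `k = 0` the functions `A` and `B` are the constants `1/e₀` and `1/e₁`, and the two
polynomials agree exactly when the constants do. -/
theorem hasConstantHSC_iff_of_linear {e₀ e₁ : ℂ} {h₀ : e₀ ≠ 0} {h₁ : e₁ ≠ 0}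
    (F : OrthotoricPresentation (linearProfile 0 e₀ h₀) (linearProfile 0 e₁ h₁) g ω U)
    (hU : IsOpen U) (hne : U.Nonempty) : HasConstantHSC g ω U ↔ e₀ = e₁ := by
  refine ⟨fun h => ?_, fun h => ?_⟩
  · obtain ⟨p, hp⟩ := hne
    have := (F.taylor_of_hasConstantHSC hU h hp (by simp [linearProfile])).1
    simp [linearProfile] at this
    exact this.symm
  · refine F.chart.hasConstantHSC_of_quadratic hU (1 / e₀) 0 0 (fun p _ => ?_) fun p _ => ?_
    · simp [chart, linearProfile]
    · simp [chart, linearProfile, h]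

/-- For `k ≠ 0` the function `A` is an exponential of `a`, and none of its derivatives vanishes
anywhere. -/
theorem not_hasConstantHSC_of_linear {k e₀ e₁ : ℂ} {h₀ : e₀ ≠ 0} {h₁ : e₁ ≠ 0} (hk : k ≠ 0)
    (F : OrthotoricPresentation (linearProfile k e₀ h₀) (linearProfile k e₁ h₁) g ω U)
    (hU : IsOpen U) (hne : U.Nonempty) : ¬ HasConstantHSC g ω U := fun h => by
  obtain ⟨p, hp⟩ := hne
  have := F.A₄_eq_zero_of_hasConstantHSC hU h hp
  simp [linearProfile, hk, h₀] at this

/-- The power `a ^ (3β/(β-1))` must have exponent 1, 2 or 0, which gives `β = -1/2`, `-2` or `0`.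
Then `A` and `B` are monomials of the same degree, and the remaining equation compares their
coefficients. -/
theorem hasConstantHSC_iff_of_exp {β c₀ c₁ e₀ e₁ : ℂ} {hβ : β ≠ 1} {hc₀ : c₀ ≠ 0} {hc₁ : c₁ ≠ 0}
    {he₀ : e₀ ≠ 0} {he₁ : e₁ ≠ 0}
    (F : OrthotoricPresentation (expProfile β c₀ e₀ hβ hc₀ he₀) (expProfile β c₁ e₁ hβ hc₁ he₁)
      g ω U) (hU : IsOpen U) (hne : U.Nonempty) :
    HasConstantHSC g ω U ↔ (β = -1 / 2 ∧ c₀ / e₀ = c₁ / e₁) ∨ (β = -2 ∧ e₀ = e₁) ∨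
      (β = 0 ∧ c₀ ^ 2 / e₀ = c₁ ^ 2 / e₁) := by
  have hβ1 := sub_ne_zero.2 hβ
  constructor
  · intro h
    obtain ⟨p, hp⟩ := hne
    have h4 := F.A₄_eq_zero_of_hasConstantHSC hU h hp
    -- In this family `A₄ = 3 A₃`.
    have h3 : (expProfile β c₀ e₀ hβ hc₀ he₀).A₃ (F.X p) = 0 := by
      simp only [expProfile] at h4 ⊢
      exact (mul_eq_zero.1 h4).resolve_left three_ne_zero
    obtain ⟨t0, t1, t2⟩ := F.taylor_of_hasConstantHSC hU h hp h3
    have hcases : β = 0 ∨ β = -1 / 2 ∨ β = -2 := by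
      simp only [expProfile, mul_eq_zero, div_eq_zero_iff, Complex.exp_ne_zero, or_false,
        OfNat.ofNat_ne_zero, false_or, hβ1, hc₀, he₀] at h3
      rcases h3 with (h | h) | h
      · exact .inl h
      · exact .inr (.inl (by linear_combination h / 2))
      · exact .inr (.inr (by linear_combination h))
    simp only [expProfile] at t0 t1 t2
    -- For a monomial of degree 0, 1 or 2 the coefficient is read off from the Taylor identity for
    -- `B`, `B₁` or `B₂` respectively.
    rcases hcases with rfl | rfl | rfl
    · norm_num at t0
      exact .inr (.inr ⟨rfl, t0.symm⟩)
    · norm_num at t1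
      exact .inl ⟨rfl, t1.symm⟩
    · norm_num at t2
      exact .inr (.inl ⟨rfl, by field_simp at t2; exact t2⟩)
  · have hsq : ∀ z : ℂ, Complex.exp (-(6 * z)) = Complex.exp (-(3 * z)) ^ 2 := fun z => by
      rw [← Complex.exp_nat_mul]; congr 1; push_cast; ring
    rintro (⟨rfl, h⟩ | ⟨rfl, h⟩ | ⟨rfl, h⟩)
    · refine F.chart.hasConstantHSC_of_quadratic hU 0 (9 / 4 * (c₀ / e₀)) 0 (fun p _ => ?_)
        fun p _ => ?_
      · simp only [chart, expProfile]
        norm_num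
        ring
      · simp only [chart, expProfile, h]
        norm_num
        ring
    · refine F.chart.hasConstantHSC_of_quadratic hU 0 0 (9 / e₀) (fun p _ => ?_) fun p _ => ?_
      · simp only [chart, expProfile]
        norm_num [hsq]
        ring
      · simp only [chart, expProfile, h]
        norm_num [hsq]
        ring
    · refine F.chart.hasConstantHSC_of_quadratic hU (c₀ ^ 2 / e₀) 0 0 (fun p _ => ?_) fun p _ => ?_
      · simp [chart, expProfile]
      · simp [chart, expProfile, h]

/-- For real `β` the factor `(9β² + 1)(β² + 1)` in `A₄` is positive, and `cos` does not vanish on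
the domain. -/
theorem not_hasConstantHSC_of_tan {β : ℝ} {e₀ e₁ : ℂ} {h₀ : e₀ ≠ 0} {h₁ : e₁ ≠ 0}
    (F : OrthotoricPresentation (tanProfile β e₀ h₀) (tanProfile β e₁ h₁) g ω U)
    (hU : IsOpen U) (hne : U.Nonempty) : ¬ HasConstantHSC g ω U := fun h => by
  obtain ⟨p, hp⟩ := hne
  have h4 := F.A₄_eq_zero_of_hasConstantHSC hU h hp
  have hc : Complex.cos (F.X p) ≠ 0 := F.X_mem p hp
  have hb : (9 * (9 * (β : ℂ) ^ 2 + 1) * ((β : ℂ) ^ 2 + 1)) ≠ 0 := by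
    have : (9 * (9 * β ^ 2 + 1) * (β ^ 2 + 1)) ≠ 0 := by positivity
    exact_mod_cast this
  refine neg_ne_zero.2 (mul_ne_zero (mul_ne_zero (one_div_ne_zero h₀) (Complex.exp_ne_zero _))
    (mul_ne_zero hb (pow_ne_zero 3 hc))) h4

end OrthotoricPresentation

/-! ### Metrics of Liouville type in orthotoric form -/

theorem transpose_mul_formSq_mul {R : Type*} [CommRing R] (Q : Matrix (Fin 4) (Fin 4) R)
    (α : Fin 4 → R) : Qᵀ * formSq α * Q = formSq (α ᵥ* Q) := by
  rw [formSq, Matrix.mul_vecMulVec, Matrix.vecMulVec_mul, Matrix.mulVec_transpose, formSq]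

theorem transpose_mul_formWedge_mul {R : Type*} [CommRing R] (Q : Matrix (Fin 4) (Fin 4) R)
    (α β : Fin 4 → R) : Qᵀ * formWedge α β * Q = formWedge (α ᵥ* Q) (β ᵥ* Q) := by
  rw [formWedge, Matrix.mul_sub, Matrix.sub_mul, Matrix.mul_vecMulVec, Matrix.vecMulVec_mul,
    Matrix.mulVec_transpose, Matrix.mul_vecMulVec, Matrix.vecMulVec_mul, Matrix.mulVec_transpose,
    formWedge]

theorem orthoMetric_eq {a b : ℂ} (h : a - b ≠ 0) (E e A B : ℂ) :
    orthoMetric a b E e A B = (a - b) • (E • formSq ![1, 0, 0, 0] - e • formSq ![0, 1, 0, 0])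
      + (1 / (a - b)) • (A • formSq ![0, 0, 1, b] - B • formSq ![0, 0, 1, a]) := by
  ext i j
  fin_cases i <;> fin_cases j <;>
    simp [orthoMetric, blockMatrix, formSq] <;> field_simp

theorem orthoForm_eq (a b a₁ b₁ : ℂ) :
    !![0, 0, a₁, a₁ * b; 0, 0, b₁, b₁ * a; -a₁, -b₁, 0, 0; -(a₁ * b), -(b₁ * a), 0, 0]
      = a₁ • formWedge ![1, 0, 0, 0] ![0, 0, 1, b] + b₁ • formWedge ![0, 1, 0, 0] ![0, 0, 1, a] := by
  ext i j
  fin_cases i <;> fin_cases j <;> simp [formWedge]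

theorem hasPairGrad_coord_zero (p : Fin 4 → ℝ) :
    HasPairGrad 1 (fun q => (q 0 : ℂ)) 1 0 p := by
  refine forall_fin_four ?_ ?_ ?_ ?_ <;>
    simpa [Fin.sum_univ_four, Matrix.one_apply] using
      by first | exact (hasDerivAt_id' (p 0)).ofReal_comp | exact hasDerivAt_const _ _

theorem hasPairGrad_coord_one (p : Fin 4 → ℝ) :
    HasPairGrad 1 (fun q => (q 1 : ℂ)) 0 1 p := by
  refine forall_fin_four ?_ ?_ ?_ ?_ <;>
    simpa [Fin.sum_univ_four, Matrix.one_apply] using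
      by first | exact (hasDerivAt_id' (p 1)).ofReal_comp | exact hasDerivAt_const _ _

theorem liouvilleMetric_map (ε : ℝ) (ρ₀ ρ₁ F₀ F₁ : ℝ → ℝ) (p : Fin 4 → ℝ) :
    (liouvilleMetric ε ρ₀ ρ₁ F₀ F₁ p).map Complex.ofReal
      = ((ρ₀ (p 0) : ℂ) - ρ₁ (p 1)) • ((F₀ (p 0) ^ 2 : ℂ) • formSq ![1, 0, 0, 0]
          + (ε * F₁ (p 1) ^ 2 : ℂ) • formSq ![0, 1, 0, 0])
        + (1 / ((ρ₀ (p 0) : ℂ) - ρ₁ (p 1))) •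
          ((((deriv ρ₀ (p 0) : ℝ) : ℂ) / F₀ (p 0)) ^ 2 • formSq ![0, 0, 1, (ρ₁ (p 1) : ℂ)]
            + (ε * (((deriv ρ₁ (p 1) : ℝ) : ℂ) / F₁ (p 1)) ^ 2) • formSq ![0, 0, 1, (ρ₀ (p 0) : ℂ)]) := by
  ext i j
  fin_cases i <;> fin_cases j <;> simp [liouvilleMetric, formSq]

theorem liouvilleForm_map (ρ₀ ρ₁ : ℝ → ℝ) (p : Fin 4 → ℝ) :
    (liouvilleForm ρ₀ ρ₁ p).map Complex.ofReal
      = ((deriv ρ₀ (p 0) : ℝ) : ℂ) • formWedge ![1, 0, 0, 0] ![0, 0, 1, (ρ₁ (p 1) : ℂ)]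
        + ((deriv ρ₁ (p 1) : ℝ) : ℂ) • formWedge ![0, 1, 0, 0] ![0, 0, 1, (ρ₀ (p 0) : ℂ)] := by
  ext i j
  fin_cases i <;> fin_cases j <;> simp [liouvilleForm, formWedge]

/-- The profile `P` has `a = ρ` and `E = σ F²` at the real number `x`. -/
def OrthotoricProfile.Matches {S : Set ℂ} (P : OrthotoricProfile S) (ρ F : ℝ → ℝ) (σ x : ℝ) :
    Prop :=
  (x : ℂ) ∈ S ∧ P.a x = ρ x ∧ P.a₁ x = (deriv ρ x : ℝ) ∧ P.E x = σ * F x ^ 2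

/-- The relation `E A = a'²` determines `A`, and `σ² = 1` makes `σ` its own inverse. -/
theorem OrthotoricProfile.Matches.A_eq {S : Set ℂ} {P : OrthotoricProfile S} {ρ F : ℝ → ℝ}
    {σ x : ℝ} (h : P.Matches ρ F σ x) (hσ : σ ^ 2 = 1) :
    P.A x = σ * (((deriv ρ x : ℝ) : ℂ) / F x) ^ 2 := by
  obtain ⟨hS, -, h1, h2⟩ := h
  have h3 := P.E_mul_A x hS
  have hE : P.E x ≠ 0 := left_ne_zero_of_mul (h3 ▸ pow_ne_zero 2 (P.a₁_ne x hS))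
  have hF : (F x : ℂ) ≠ 0 := fun h0 => hE (by rw [h2, h0]; ring)
  have hσ' : (σ : ℂ) ^ 2 = 1 := by exact_mod_cast hσ
  have hσ0 : (σ : ℂ) ≠ 0 := fun h0 => by simp [h0] at hσ'
  refine mul_left_cancel₀ hE ?_
  rw [h3, h1, h2]
  field_simp
  rw [hσ', mul_one]

/-- The presentation of a metric of Liouville type. -/
def liouvillePresentation {S : Set ℂ} {p₀ p₁ : OrthotoricProfile S} {ε : ℝ} {ρ₀ ρ₁ F₀ F₁ : ℝ → ℝ}
    {U : Set (Fin 4 → ℝ)} (hε : ε ^ 2 = 1) (h₀ : ∀ p ∈ U, p₀.Matches ρ₀ F₀ 1 (p 0))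
    (h₁ : ∀ p ∈ U, p₁.Matches ρ₁ F₁ (-ε) (p 1)) (hne : ∀ p ∈ U, ρ₀ (p 0) ≠ ρ₁ (p 1)) :
    OrthotoricPresentation p₀ p₁ (liouvilleMetric ε ρ₀ ρ₁ F₀ F₁) (liouvilleForm ρ₀ ρ₁) U where
  P := 1
  Q := 1
  X p := p 0
  Y p := p 1
  Q_mul_P := one_mul 1
  grad_X := hasPairGrad_coord_zero
  grad_Y := hasPairGrad_coord_one
  X_mem p hp := (h₀ p hp).1
  Y_mem p hp := (h₁ p hp).1
  ne p hp := by
    rw [(h₀ p hp).2.1, (h₁ p hp).2.1]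
    exact_mod_cast hne p hp
  -- The normal form has `-e dY²` and `-B`, so the second profile carries the sign `-ε` in order to
  -- produce `+ε`.
  metric_eq p hp := by
    have hab : (ρ₀ (p 0) : ℂ) - ρ₁ (p 1) ≠ 0 := sub_ne_zero.2 (by exact_mod_cast hne p hp)
    rw [OrthotoricProfile.Matches.A_eq (h₀ p hp) (one_pow 2), OrthotoricProfile.Matches.A_eq (h₁ p hp) (by simpa using hε), (h₀ p hp).2.1,
      (h₁ p hp).2.1, (h₀ p hp).2.2.2, (h₁ p hp).2.2.2, orthoMetric_eq hab, liouvilleMetric_map]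
    simp only [Matrix.transpose_one, one_mul, mul_one, Complex.ofReal_one, Complex.ofReal_neg,
      neg_mul, neg_smul, sub_neg_eq_add]
  form_eq p hp := by
    rw [(h₀ p hp).2.1, (h₁ p hp).2.1, (h₀ p hp).2.2.1, (h₁ p hp).2.2.1, orthoForm_eq,
      liouvilleForm_map]
    simp only [Matrix.transpose_one, one_mul, mul_one]

/-! ### Metrics of complex type in orthotoric form -/

/-- The matrix of the coframe `dz, dz̄, ds₀, ds₁`. -/
def complexCoframe : Matrix (Fin 4) (Fin 4) ℂ :=
  !![1, Complex.I, 0, 0; 1, -Complex.I, 0, 0; 0, 0, 1, 0; 0, 0, 0, 1]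

/-- The matrix of the frame `∂_z, ∂_z̄, ∂_{s₀}, ∂_{s₁}`. -/
noncomputable def complexFrame : Matrix (Fin 4) (Fin 4) ℂ :=
  !![1 / 2, 1 / 2, 0, 0; -Complex.I / 2, Complex.I / 2, 0, 0; 0, 0, 1, 0; 0, 0, 0, 1]

theorem complexCoframe_mul_complexFrame : complexCoframe * complexFrame = 1 := by
  ext i j
  fin_cases i <;> fin_cases j <;>
    simp [complexCoframe, complexFrame, Matrix.mul_apply, Fin.sum_univ_four] <;> ring_nf <;>
    norm_num [Complex.I_sq]

theorem zCoord_eq (p : Fin 4 → ℝ) : zCoord p = p 0 + p 1 * Complex.I :=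
  (Complex.re_add_im (zCoord p)).symm

theorem hasPairGrad_zCoord (p : Fin 4 → ℝ) : HasPairGrad complexCoframe zCoord 1 0 p := by
  rw [funext zCoord_eq]
  refine forall_fin_four ?_ ?_ ?_ ?_ <;>
    simp [Fin.sum_univ_four, complexCoframe] <;> 
    first
      | exact (hasDerivAt_id' (p 0)).ofReal_comp
      | simpa using ((hasDerivAt_id' (p 1)).ofReal_comp.mul_const Complex.I).const_add (p 0 : ℂ)
      | exact hasDerivAt_const _ _

theorem hasPairGrad_star_zCoord (p : Fin 4 → ℝ) :
    HasPairGrad complexCoframe (fun q => star (zCoord q)) 0 1 p := by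
  have : (fun q => star (zCoord q)) = fun q => (q 0 : ℂ) + q 1 * -Complex.I := by
    funext q
    rw [zCoord_eq]
    simp
  rw [this]
  refine forall_fin_four ?_ ?_ ?_ ?_ <;>
    simp [Fin.sum_univ_four, complexCoframe] <;> 
    first
      | exact (hasDerivAt_id' (p 0)).ofReal_comp
      | simpa using
          ((hasDerivAt_id' (p 1)).ofReal_comp.mul_const (-Complex.I)).const_add (p 0 : ℂ)
      | exact hasDerivAt_const _ _

theorem complexTypeMetric_map (ρ F : ℂ → ℂ) (p : Fin 4 → ℝ) :
    (complexTypeMetric ρ F p).map Complex.ofReal = complexTypeMatrix ρ F p := by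
  ext i j
  exact Complex.ext rfl (complexTypeMatrix_im ρ F p i j).symm

theorem complexTypeForm_map (ρ : ℂ → ℂ) (p : Fin 4 → ℝ) :
    (complexTypeForm ρ p).map Complex.ofReal = complexTypeFormMatrix ρ p := by
  ext i j
  exact Complex.ext rfl (complexTypeFormMatrix_im ρ p i j).symm

theorem vecMul_complexCoframe (a : ℂ) :
    ![1, 0, 0, 0] ᵥ* complexCoframe = dz ∧ ![0, 1, 0, 0] ᵥ* complexCoframe = dzBar ∧
      ![0, 0, 1, a] ᵥ* complexCoframe = ![0, 0, 1, a] := by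
  refine ⟨?_, ?_, ?_⟩ <;> ext i <;> fin_cases i <;>
    simp [complexCoframe, dz, dzBar, Matrix.vecMul, dotProduct, Fin.sum_univ_four]

/-- The presentation of a metric of complex type. -/
noncomputable def complexPresentation {S : Set ℂ} {p₀ p₁ : OrthotoricProfile S} {ρ F : ℂ → ℂ}
    {U : Set (Fin 4 → ℝ)} (hS : ∀ p ∈ U, zCoord p ∈ S) (hS' : ∀ p ∈ U, star (zCoord p) ∈ S)
    (ha : ∀ z ∈ S, ρ z = p₀.a z) (ha₁ : ∀ z ∈ S, deriv ρ z = p₀.a₁ z)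
    (hE : ∀ z ∈ S, -(F z ^ 2 / 4) = p₀.E z) (ha' : ∀ z ∈ S, p₁.a (star z) = star (p₀.a z))
    (ha₁' : ∀ z ∈ S, p₁.a₁ (star z) = star (p₀.a₁ z))
    (hE' : ∀ z ∈ S, p₁.E (star z) = star (p₀.E z)) (hne : ∀ p ∈ U, (ρ (zCoord p)).im ≠ 0) :
    OrthotoricPresentation p₀ p₁ (complexTypeMetric ρ F) (complexTypeForm ρ) U where
  P := complexFrame
  Q := complexCoframe
  X := zCoord
  Y p := star (zCoord p)
  Q_mul_P := complexCoframe_mul_complexFrame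
  grad_X := hasPairGrad_zCoord
  grad_Y := hasPairGrad_star_zCoord
  X_mem := hS
  Y_mem := hS'
  ne p hp := by
    rw [ha' _ (hS p hp), ← ha _ (hS p hp)]
    exact fun h => hne p hp (Complex.conj_eq_iff_im.1 h.symm)
  metric_eq p hp := by
    have hz := hS p hp
    have hr : ρ (zCoord p) - star (ρ (zCoord p)) ≠ 0 := fun h =>
      hne p hp (Complex.conj_eq_iff_im.1 (sub_eq_zero.1 h).symm)
    have hr' : star (ρ (zCoord p)) - ρ (zCoord p) ≠ 0 := by
      rw [← neg_sub]; exact neg_ne_zero.2 hr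
    have hE0 := p₀.E_mul_A _ hz
    have hE1 := p₁.E_mul_A _ (hS' p hp)
    rw [ha₁' _ hz, hE' _ hz, ← hE _ hz, ← ha₁ _ hz] at hE1
    rw [← hE _ hz, ← ha₁ _ hz] at hE0
    have hF : F (zCoord p) ≠ 0 := fun h => p₀.a₁_ne _ hz (by
      rw [h, ha₁ _ hz] at hE0
      exact pow_eq_zero_iff two_ne_zero |>.1 (by rw [← hE0]; ring))
    have hF' : star (F (zCoord p)) ≠ 0 := star_ne_zero.2 hF
    -- The factor `(ρ̄ - ρ)/4` is rewritten as `-(ρ - ρ̄)/4`, so `E = -F²/4` and consequently `A =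
    -- -4 (ρ'/F)²`; `e` and `B` are their conjugates.
    have hA : p₀.A (zCoord p) = -4 * (deriv ρ (zCoord p) / F (zCoord p)) ^ 2 := by
      field_simp
      linear_combination (-4) * hE0
    have hB : p₁.A (star (zCoord p))
        = -4 * (star (deriv ρ (zCoord p)) / star (F (zCoord p))) ^ 2 := by
      have h4 : star (4 : ℂ) = 4 := Complex.conj_ofNat 4
      rw [star_neg, star_div₀, star_pow, h4] at hE1
      field_simp
      linear_combination (-4) * hE1
    have h4 : star (4 : ℂ) = 4 := Complex.conj_ofNat 4
    rw [complexTypeMetric_map, ha' _ hz, hE' _ hz, ← hE _ hz, ← ha _ hz, hA, hB,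
      orthoMetric_eq hr]
    simp only [mul_add, add_mul, mul_sub, sub_mul, Matrix.mul_smul, Matrix.smul_mul,
      transpose_mul_formSq_mul, (vecMul_complexCoframe 0).1,
      (vecMul_complexCoframe 0).2.1, (vecMul_complexCoframe _).2.2, complexTypeMatrix, star_neg, star_div₀,
      star_pow, h4]
    simp only [smul_sub, smul_smul]
    congr 2
    · congr 1
      ring
    · congr 1
      ring
    · congr 1
      field_simp
      ring
    · congr 1
      field_simp
      ring
  form_eq p hp := by
    have hz := hS p hp
    rw [complexTypeForm_map, ha₁' _ hz, ha' _ hz, ← ha _ hz, ← ha₁ _ hz, orthoForm_eq]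
    simp only [mul_add, add_mul, Matrix.mul_smul, Matrix.smul_mul,
      transpose_mul_formWedge_mul, (vecMul_complexCoframe 0).1,
      (vecMul_complexCoframe 0).2.1, (vecMul_complexCoframe _).2.2, complexTypeFormMatrix]

/-! ### The families L1 to L4 -/

theorem HasConstantHSC.mono {n : ℕ} {g ω : FormField n} {U V : Set (Fin n → ℝ)}
    (h : HasConstantHSC g ω U) (hV : V ⊆ U) : HasConstantHSC g ω V :=
  h.imp fun _ hκ p hp => hκ p (hV hp)

/-- For `ε = 1` the left side would make a non-zero square equal to minus a square; for `ε = -1` it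
says that the squares agree. -/
theorem sq_eq_neg_mul_sq_iff {ε x y : ℝ} (hε : ε = 1 ∨ ε = -1) (hx : x ≠ 0) :
    x ^ 2 = -(ε * y ^ 2) ↔ ε = -1 ∧ (y = x ∨ y = -x) := by
  have := pow_pos (abs_pos.2 hx) 2
  rw [sq_abs] at this
  rcases hε with rfl | rfl
  · exact ⟨fun h => by nlinarith, fun h => by norm_num at h⟩
  · rw [← sq_eq_sq_iff_eq_or_eq_neg]
    constructor
    · exact fun h => ⟨rfl, by linarith⟩
    · exact fun h => by linarith [h.2]

theorem HasDerivAt.exp_mul (c k x : ℝ) :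
    HasDerivAt (fun x => c * Real.exp (k * x)) (k * (c * Real.exp (k * x))) x :=
  ((((hasDerivAt_id' x).const_mul k).exp).const_mul c).congr_deriv (by ring)

theorem matches_linearProfile {k σ c : ℝ} (hσ : (σ * c ^ 2 : ℝ) ≠ 0) (x : ℝ) :
    (linearProfile k (σ * c ^ 2 : ℝ) (Complex.ofReal_ne_zero.2 hσ)).Matches (fun x => x)
      (fun x => c * Real.exp (-(k / 2) * x)) σ x := by
  refine ⟨trivial, rfl, by simp [linearProfile], ?_⟩
  have : Complex.exp (-k * x) = Complex.exp (-(k / 2) * x) ^ 2 := by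
    rw [← Complex.exp_nat_mul]; congr 1; push_cast; ring
  simp only [linearProfile, this]
  push_cast
  ring

theorem matches_expProfile {β c σ d : ℝ} (hβ : β ≠ 1) (hc : c ≠ 0) (hσ : (σ * d ^ 2 : ℝ) ≠ 0)
    (x : ℝ) :
    (expProfile β c (σ * d ^ 2 : ℝ) (by exact_mod_cast hβ) (Complex.ofReal_ne_zero.2 hc)
      (Complex.ofReal_ne_zero.2 hσ)).Matches (fun x => c * Real.exp ((β - 1) * x))
      (fun x => d * Real.exp (-(1 / 2) * (β + 2) * x)) σ x := by
  refine ⟨trivial, by simp [expProfile], ?_, ?_⟩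
  · rw [(HasDerivAt.exp_mul c (β - 1) x).deriv]
    simp [expProfile]
  · have : Complex.exp (-(β + 2) * x) = Complex.exp (-(1 / 2) * (β + 2) * x) ^ 2 := by
      rw [← Complex.exp_nat_mul]; congr 1; push_cast; ring
    simp only [expProfile, this]
    push_cast
    ring

/-- The number `s` is the sign of `cos x`. It absorbs the absolute value in `F²`, so that `E`
becomes the analytic function of the profile. -/
theorem matches_tanProfile {β c σ s x : ℝ} (hσ : (σ * c ^ 2 * s : ℝ) ≠ 0) (hs : s ^ 2 = 1)
    (hx : 0 < s * Real.cos x) :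
    (tanProfile β (σ * c ^ 2 * s : ℝ) (Complex.ofReal_ne_zero.2 hσ)).Matches
      (fun x => -Real.tan x)
      (fun x => c * Real.exp (-(3 / 2) * β * x) / Real.sqrt |Real.cos x|) σ x := by
  have hc : Real.cos x ≠ 0 := right_ne_zero_of_mul hx.ne'
  refine ⟨?_, by simp [tanProfile], ?_, ?_⟩
  · simpa [← Complex.ofReal_cos] using hc
  · rw [((Real.hasDerivAt_tan hc).fun_neg).deriv]
    simp [tanProfile]
  · have h1 : |Real.cos x| = s * Real.cos x := by
      have : |s| = 1 := by rw [← Real.sqrt_sq_eq_abs, hs, Real.sqrt_one]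
      rw [← abs_of_pos hx, abs_mul, this, one_mul]
    have h2 : (c * Real.exp (-(3 / 2) * β * x) / Real.sqrt |Real.cos x|) ^ 2
        = c ^ 2 * s * Real.exp (-(3 * β) * x) / Real.cos x := by
      have h3 : Real.exp (-(3 * β) * x) = Real.exp (-(3 / 2) * β * x) ^ 2 := by
        rw [← Real.exp_nat_mul]; congr 1; push_cast; ring
      rw [div_pow, Real.sq_sqrt (abs_nonneg _), h1, h3, div_eq_div_iff hx.ne' hc]
      linear_combination (-(c * Real.exp (-(3 / 2) * β * x)) ^ 2 * Real.cos x) * hs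
    have h4 := congrArg (fun t : ℝ => (σ : ℂ) * t) h2
    simp only [Complex.ofReal_pow] at h4
    rw [h4]
    simp only [tanProfile]
    push_cast
    ring

section
variable {ε c₀ c₁ : ℝ} {U : Set (Fin 4 → ℝ)}

theorem liouville_linear_hasConstantHSC_iff (hε : ε = 1 ∨ ε = -1) (h₀ : c₀ ≠ 0) (h₁ : c₁ ≠ 0)
    (hU : IsOpen U) (hne : U.Nonempty) (hp : ∀ p ∈ U, p 0 ≠ p 1) :
    HasConstantHSC (liouvilleMetric ε (fun x => x) (fun x => x) (fun _ => c₀) (fun _ => c₁))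
      (liouvilleForm (fun x => x) (fun x => x)) U ↔ ε = -1 ∧ (c₁ = c₀ ∨ c₁ = -c₀) := by
  have hε0 : -ε ≠ 0 := by rcases hε with rfl | rfl <;> norm_num
  have m : ∀ {σ c : ℝ} (hσ : (σ * c ^ 2 : ℝ) ≠ 0) (x : ℝ),
      (linearProfile 0 (σ * c ^ 2 : ℝ) (Complex.ofReal_ne_zero.2 hσ)).Matches (fun x => x)
        (fun _ => c) σ x := fun hσ x => by simpa using matches_linearProfile (k := 0) hσ x
  refine ((liouvillePresentation (by rcases hε with rfl | rfl <;> norm_num)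
    (fun p _ => m (mul_ne_zero one_ne_zero (pow_ne_zero 2 h₀)) (p 0))
    (fun p _ => m (mul_ne_zero hε0 (pow_ne_zero 2 h₁)) (p 1)) hp).hasConstantHSC_iff_of_linear hU
    hne).trans ?_
  rw [Complex.ofReal_inj, one_mul, neg_mul, sq_eq_neg_mul_sq_iff hε h₀]

theorem liouville_exp_hasConstantHSC_iff {β d₀ d₁ : ℝ} (hε : ε = 1 ∨ ε = -1) (hβ : β ≠ 1)
    (hc₀ : c₀ ≠ 0) (hc₁ : c₁ ≠ 0) (hd₀ : d₀ ≠ 0) (hd₁ : d₁ ≠ 0) (hU : IsOpen U) (hne : U.Nonempty)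
    (hp : ∀ p ∈ U, c₀ * Real.exp ((β - 1) * p 0) ≠ c₁ * Real.exp ((β - 1) * p 1)) :
    HasConstantHSC
        (liouvilleMetric ε
          (fun x => c₀ * Real.exp ((β - 1) * x)) (fun x => c₁ * Real.exp ((β - 1) * x))
          (fun x => d₀ * Real.exp (-(1 / 2) * (β + 2) * x))
          (fun x => d₁ * Real.exp (-(1 / 2) * (β + 2) * x)))
        (liouvilleForm
          (fun x => c₀ * Real.exp ((β - 1) * x)) (fun x => c₁ * Real.exp ((β - 1) * x))) U ↔
      (β = -1 / 2 ∧ c₁ = -ε * c₀ * (d₁ ^ 2 / d₀ ^ 2)) ∨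
      (β = -2 ∧ ε = -1 ∧ (d₁ = d₀ ∨ d₁ = -d₀)) ∨
      (β = 0 ∧ ε = -1 ∧ (d₁ / c₁ = d₀ / c₀ ∨ d₁ / c₁ = -(d₀ / c₀))) := by
  have hε0 : -ε ≠ 0 := by rcases hε with rfl | rfl <;> norm_num
  have hε2 : ε ^ 2 = 1 := by rcases hε with rfl | rfl <;> norm_num
  have hε1 : ε ≠ 0 := by rcases hε with rfl | rfl <;> norm_num
  refine ((liouvillePresentation hε2
    (fun p _ => matches_expProfile hβ hc₀ (mul_ne_zero one_ne_zero (pow_ne_zero 2 hd₀)) (p 0))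
    (fun p _ => matches_expProfile hβ hc₁ (mul_ne_zero hε0 (pow_ne_zero 2 hd₁)) (p 1))
    hp).hasConstantHSC_iff_of_exp hU hne).trans ?_
  refine or_congr (and_congr ?_ ?_) (or_congr (and_congr ?_ ?_) (and_congr ?_ ?_))
  · norm_cast
  · norm_cast
    rw [one_mul, div_eq_div_iff (pow_ne_zero 2 hd₀) (mul_ne_zero hε0 (pow_ne_zero 2 hd₁)),
      ← mul_div_assoc, eq_div_iff (pow_ne_zero 2 hd₀)]
    exact ⟨fun h => by linear_combination -h, fun h => by linear_combination -h⟩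
  · norm_cast
  · rw [Complex.ofReal_inj, one_mul, neg_mul, sq_eq_neg_mul_sq_iff hε hd₀]
  · norm_cast
  -- After inversion the condition `c₀²/e₀ = c₁²/e₁` becomes an equation between the squares of
  -- `d₀/c₀` and `d₁/c₁`, up to the sign `-ε`.
  · rw [← sq_eq_neg_mul_sq_iff hε (div_ne_zero hd₀ hc₀)]
    norm_cast
    rw [← inv_inj, inv_div, inv_div, one_mul, div_pow, div_pow, ← mul_div_assoc, ← neg_div, neg_mul]

theorem liouville_linear_exp_not_hasConstantHSC (hε : ε = 1 ∨ ε = -1) (h₀ : c₀ ≠ 0) (h₁ : c₁ ≠ 0)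
    (hU : IsOpen U) (hne : U.Nonempty) (hp : ∀ p ∈ U, p 0 ≠ p 1) :
    ¬ HasConstantHSC
      (liouvilleMetric ε (fun x => x) (fun x => x)
        (fun x => c₀ * Real.exp (-(3 / 2) * x)) (fun x => c₁ * Real.exp (-(3 / 2) * x)))
      (liouvilleForm (fun x => x) (fun x => x)) U := by
  have hε0 : -ε ≠ 0 := by rcases hε with rfl | rfl <;> norm_num
  exact (liouvillePresentation (by rcases hε with rfl | rfl <;> norm_num)
    (fun p _ => matches_linearProfile (k := 3) (mul_ne_zero one_ne_zero (pow_ne_zero 2 h₀)) (p 0))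
    (fun p _ => matches_linearProfile (k := 3) (mul_ne_zero hε0 (pow_ne_zero 2 h₁)) (p 1))
    hp).not_hasConstantHSC_of_linear (by norm_num) hU hne

/-- Constant curvature passes to open subsets, so it can be refuted near one point, where both
cosines keep their signs and the analytic profile applies. -/
theorem liouville_tan_not_hasConstantHSC {β : ℝ} (hε : ε = 1 ∨ ε = -1) (h₀ : c₀ ≠ 0) (h₁ : c₁ ≠ 0)
    (hU : IsOpen U) (hne : U.Nonempty)
    (hp : ∀ p ∈ U, Real.cos (p 0) ≠ 0 ∧ Real.cos (p 1) ≠ 0 ∧ Real.tan (p 0) ≠ Real.tan (p 1)) :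
    ¬ HasConstantHSC
      (liouvilleMetric ε (fun x => -Real.tan x) (fun x => -Real.tan x)
        (fun x => c₀ * Real.exp (-(3 / 2) * β * x) / Real.sqrt |Real.cos x|)
        (fun x => c₁ * Real.exp (-(3 / 2) * β * x) / Real.sqrt |Real.cos x|))
      (liouvilleForm (fun x => -Real.tan x) (fun x => -Real.tan x)) U := by
  have hε0 : -ε ≠ 0 := by rcases hε with rfl | rfl <;> norm_num
  have hs : ∀ {t : ℝ}, t ≠ 0 → ∃ s : ℝ, s ^ 2 = 1 ∧ s ≠ 0 ∧ 0 < s * t := fun {t} ht => by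
    rcases ht.lt_or_gt with h | h
    · exact ⟨-1, by norm_num, by norm_num, by linarith⟩
    · exact ⟨1, by norm_num, by norm_num, by linarith⟩
  obtain ⟨q, hq⟩ := hne
  obtain ⟨s, hs2, hs0, hsq⟩ := hs (hp q hq).1
  obtain ⟨t, ht2, ht0, htq⟩ := hs (hp q hq).2.1
  let V : Set (Fin 4 → ℝ) := U ∩ {p | 0 < s * Real.cos (p 0) ∧ 0 < t * Real.cos (p 1)}
  have hV : IsOpen V := 
    hU.inter (((isOpen_lt (g := fun p : Fin 4 → ℝ => s * Real.cos (p 0)) continuous_const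
      (by fun_prop))).inter (isOpen_lt (g := fun p : Fin 4 → ℝ => t * Real.cos (p 1))
      continuous_const (by fun_prop)))
  refine fun h => (liouvillePresentation (U := V) (by rcases hε with rfl | rfl <;> norm_num)
    (fun p hpV => matches_tanProfile
      (mul_ne_zero (mul_ne_zero one_ne_zero (pow_ne_zero 2 h₀)) hs0) hs2 hpV.2.1)
    (fun p hpV => matches_tanProfile
      (mul_ne_zero (mul_ne_zero hε0 (pow_ne_zero 2 h₁)) ht0) ht2 hpV.2.2)
    fun p hpV => ?_).not_hasConstantHSC_of_tan hV ⟨q, hq, hsq, htq⟩ (h.mono Set.inter_subset_left)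
  simpa using (hp p hpV.1).2.2

end

/-! ### The families C1 to C4 -/

section
variable {ς : ℂ} {U : Set (Fin 4 → ℝ)}

theorem neg_sq_div_four_ne_zero (hς : ς ≠ 0) : -(ς ^ 2 / 4) ≠ 0 :=
  by simpa using hς

/-- The imaginary part of `ς²` is `2 Re ς Im ς`. This is the equality of the two profile constants,
which are conjugate in the complex type. -/
theorem neg_sq_div_four_eq_star_iff : -(ς ^ 2 / 4) = star (-(ς ^ 2 / 4)) ↔ ς.re = 0 ∨ ς.im = 0 := by
  rw [eq_comm, Complex.star_def, Complex.conj_eq_iff_im]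
  have : (-(ς ^ 2 / 4)).im = -(1 / 2) * (ς.re * ς.im) := by
    rw [show -(ς ^ 2 / 4) = ((-(1 / 4) : ℝ) : ℂ) * ς ^ 2 by push_cast; ring, Complex.im_ofReal_mul, sq, Complex.mul_im]
    ring
  rw [this]
  simp

theorem complex_linear_hasConstantHSC_iff (hς : ς ≠ 0) (hU : IsOpen U) (hne : U.Nonempty)
    (hp : ∀ p ∈ U, (zCoord p).im ≠ 0) :
    HasConstantHSC (complexTypeMetric (fun z => z) (fun _ => ς)) (complexTypeForm (fun z => z)) U ↔
      ς.re = 0 ∨ ς.im = 0 := by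
  have h := neg_sq_div_four_ne_zero hς
  refine ((complexPresentation (p₀ := linearProfile 0 _ h)
    (p₁ := linearProfile 0 _ (star_ne_zero.2 h)) (fun _ _ => trivial) (fun _ _ => trivial)
    (fun _ _ => rfl) (fun z _ => deriv_id z) (fun _ _ => by simp [linearProfile]) (fun _ _ => rfl)
    (fun _ _ => by simp [linearProfile]) (fun _ _ => by simp [linearProfile])
    hp).hasConstantHSC_iff_of_linear hU hne).trans neg_sq_div_four_eq_star_iff

theorem complex_exp_hasConstantHSC_iff {β : ℝ} (hβ : β ≠ 1) (hς : ς ≠ 0) (hU : IsOpen U)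
    (hne : U.Nonempty) (hp : ∀ p ∈ U, (Complex.exp ((β - 1) * zCoord p)).im ≠ 0) :
    HasConstantHSC
        (complexTypeMetric (fun z => Complex.exp ((β - 1) * z))
          (fun z => ς * Complex.exp (-(1 / 2) * (β + 2) * z)))
        (complexTypeForm (fun z => Complex.exp ((β - 1) * z))) U ↔
      (β = -1 / 2 ∨ β = -2 ∨ β = 0) ∧ (ς.re = 0 ∨ ς.im = 0) := by
  have h := neg_sq_div_four_ne_zero hς
  have hβ' : (β : ℂ) ≠ 1 := by exact_mod_cast hβ
  have hconj : ∀ (k : ℝ) (z : ℂ), Complex.exp (k * star z) = star (Complex.exp (k * z)) := by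
    intro k z
    rw [Complex.star_def, ← Complex.exp_conj]
    simp
  have h1 : ∀ z : ℂ, Complex.exp ((β - 1) * star z) = star (Complex.exp ((β - 1) * z)) :=
    fun z => by simpa using hconj (β - 1) z
  have h2 : ∀ z : ℂ, Complex.exp (-(β + 2) * star z) = star (Complex.exp (-(β + 2) * z)) :=
    fun z => by simpa using hconj (-(β + 2)) z
  refine ((complexPresentation (p₀ := expProfile β 1 _ hβ' one_ne_zero h)
    (p₁ := expProfile β 1 _ hβ' one_ne_zero (star_ne_zero.2 h)) (fun _ _ => trivial)
    (fun _ _ => trivial) (fun _ _ => (one_mul _).symm) (fun z _ => ?_) (fun z _ => ?_)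
    (fun z _ => ?_) (fun z _ => ?_) (fun z _ => ?_) hp).hasConstantHSC_iff_of_exp hU hne).trans ?_
  · simpa [expProfile] using (HasDerivAt.cexp_mul 1 ((β : ℂ) - 1) z).deriv
  · have : Complex.exp (-(β + 2) * z) = Complex.exp (-(1 / 2) * (β + 2) * z) ^ 2 := by
      rw [← Complex.exp_nat_mul]; congr 1; push_cast; ring
    simp only [expProfile, this]
    ring
  · simp only [expProfile, h1, one_mul]
  · simp only [expProfile, h1, one_mul, star_mul']
    simp
  · simp only [expProfile, h2, star_mul']
  -- Both constants `c` are 1, so in each of the three cases the coefficient condition is `e₀ = e₁`,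
  -- that is, the reality of `ς²`.
  · simp only [one_pow, one_div, inv_inj, neg_sq_div_four_eq_star_iff]
    norm_cast
    tauto

theorem complex_linear_exp_not_hasConstantHSC (hς : ς ≠ 0) (hU : IsOpen U) (hne : U.Nonempty)
    (hp : ∀ p ∈ U, (zCoord p).im ≠ 0) :
    ¬ HasConstantHSC
      (complexTypeMetric (fun z => z) (fun z => ς * Complex.exp (-(3 / 2) * z)))
      (complexTypeForm (fun z => z)) U := by
  have h := neg_sq_div_four_ne_zero hς
  refine (complexPresentation (p₀ := linearProfile 3 _ h)
    (p₁ := linearProfile 3 _ (star_ne_zero.2 h)) (fun _ _ => trivial) (fun _ _ => trivial)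
    (fun _ _ => rfl) (fun z _ => deriv_id z) (fun z _ => ?_) (fun _ _ => rfl)
    (fun _ _ => by simp [linearProfile]) (fun z _ => ?_)
    hp).not_hasConstantHSC_of_linear three_ne_zero hU hne
  · have : Complex.exp (-3 * z) = Complex.exp (-(3 / 2) * z) ^ 2 := by
      rw [← Complex.exp_nat_mul]; congr 1; push_cast; ring
    simp only [linearProfile, this]
    ring
  · have : Complex.exp (-3 * star z) = star (Complex.exp (-3 * z)) := by
      rw [Complex.star_def, ← Complex.exp_conj]
      simp [Complex.conj_ofNat]
    simp only [linearProfile, star_mul', this]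

theorem complex_tan_not_hasConstantHSC {β : ℝ} (hς : ς ≠ 0) (hU : IsOpen U) (hne : U.Nonempty)
    (hp : ∀ p ∈ U, Complex.cos (zCoord p) ≠ 0 ∧ (Complex.tan (zCoord p)).im ≠ 0) :
    ¬ HasConstantHSC
      (complexTypeMetric (fun z => -Complex.tan z)
        (fun z => ς * Complex.exp (-(3 / 2) * β * z) / Complex.cos z ^ (1 / 2 : ℂ)))
      (complexTypeForm (fun z => -Complex.tan z)) U := by
  have h := neg_sq_div_four_ne_zero hς
  have hcos : ∀ z : ℂ, Complex.cos (star z) = star (Complex.cos z) := Complex.cos_conj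
  have htan : ∀ z : ℂ, Complex.tan (star z) = star (Complex.tan z) := Complex.tan_conj
  refine (complexPresentation (p₀ := tanProfile β _ h) (p₁ := tanProfile β _ (star_ne_zero.2 h))
    (fun p hpU => (hp p hpU).1) (fun p hpU => ?_) (fun _ _ => rfl) (fun z hz => ?_) (fun z hz => ?_)
    (fun z _ => ?_) (fun z _ => ?_) (fun z _ => ?_) fun p hpU => ?_).not_hasConstantHSC_of_tan hU hne
  · change Complex.cos (star (zCoord p)) ≠ 0
    rw [hcos]
    exact star_ne_zero.2 (hp p hpU).1
  · exact ((Complex.hasDerivAt_tan hz).fun_neg).deriv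
  · have h1 : Complex.exp (-(3 * β) * z) = Complex.exp (-(3 / 2) * β * z) ^ 2 := by
      rw [← Complex.exp_nat_mul]; congr 1; push_cast; ring
    -- Only the square of the root enters, which is `cos z` also on the branch cut.
    have h2 : (Complex.cos z ^ (1 / 2 : ℂ)) ^ 2 = Complex.cos z := by
      rw [one_div, Complex.cpow_ofNat_inv_pow]
    simp only [tanProfile, h1, div_pow, mul_pow, h2]
    ring
  · simp only [tanProfile, htan, star_neg]
  · simp only [tanProfile, hcos, star_neg, star_div₀, star_one, star_pow]
  · have : Complex.exp (-(3 * β) * star z) = star (Complex.exp (-(3 * β) * z)) := by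
      rw [Complex.star_def, ← Complex.exp_conj]
      simp [Complex.conj_ofNat]
    simp only [tanProfile, star_mul', star_div₀, this, hcos]
  · simpa [tanProfile] using (hp p hpU).2

end

/-! ### The degenerate normal form and its curvature -/

/-- The symmetric matrix with the blocks `x`, `(y, m; m, q)` and `p` at the indices `0`, `1, 3` and
`2`. -/
def shearMatrix {R : Type*} [Zero R] (x y m p q : R) : Matrix (Fin 4) (Fin 4) R :=
  Matrix.of ![![x, 0, 0, 0], ![0, y, 0, m], ![0, 0, p, 0], ![0, m, 0, q]]

/-- The tensor of first derivatives that vanishes if the first index is `1`. -/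
def shearFirstJet {R : Type*} [Zero R] (M₀ M₂ M₃ : Matrix (Fin 4) (Fin 4) R) (i j k : Fin 4) : R :=
  (![M₀, 0, M₂, M₃] : Fin 4 → Matrix (Fin 4) (Fin 4) R) i j k

/-- The tensor of second derivatives that vanishes if one of the first two indices is `1`. -/
def shearSecondJet {R : Type*} [Zero R] (M₀₀ M₀₂ M₀₃ M₂₂ M₂₃ M₃₃ : Matrix (Fin 4) (Fin 4) R)
    (i j k l : Fin 4) : R :=
  (![![M₀₀, 0, M₀₂, M₀₃], 0, ![M₀₂, 0, M₂₂, M₂₃], ![M₀₃, 0, M₂₃, M₃₃]] :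
    Fin 4 → Fin 4 → Matrix (Fin 4) (Fin 4) R) i j k l

section
variable {R : Type*} [Zero R]

theorem shearMatrix_apply (x y m p q : R) :
    shearMatrix x y m p q 0 0 = x ∧ shearMatrix x y m p q 0 1 = 0 ∧ shearMatrix x y m p q 0 2 = 0 ∧
      shearMatrix x y m p q 0 3 = 0 ∧ shearMatrix x y m p q 1 0 = 0 ∧
      shearMatrix x y m p q 1 1 = y ∧ shearMatrix x y m p q 1 2 = 0 ∧
      shearMatrix x y m p q 1 3 = m ∧ shearMatrix x y m p q 2 0 = 0 ∧
      shearMatrix x y m p q 2 1 = 0 ∧ shearMatrix x y m p q 2 2 = p ∧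
      shearMatrix x y m p q 2 3 = 0 ∧ shearMatrix x y m p q 3 0 = 0 ∧
      shearMatrix x y m p q 3 1 = m ∧ shearMatrix x y m p q 3 2 = 0 ∧
      shearMatrix x y m p q 3 3 = q :=
  ⟨rfl, rfl, rfl, rfl, rfl, rfl, rfl, rfl, rfl, rfl, rfl, rfl, rfl, rfl, rfl, rfl⟩

theorem shearFirstJet_apply (M₀ M₂ M₃ : Matrix (Fin 4) (Fin 4) R) (j k : Fin 4) :
    shearFirstJet M₀ M₂ M₃ 0 j k = M₀ j k ∧ shearFirstJet M₀ M₂ M₃ 1 j k = 0 ∧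
      shearFirstJet M₀ M₂ M₃ 2 j k = M₂ j k ∧ shearFirstJet M₀ M₂ M₃ 3 j k = M₃ j k :=
  ⟨rfl, rfl, rfl, rfl⟩

theorem shearSecondJet_apply (M₀₀ M₀₂ M₀₃ M₂₂ M₂₃ M₃₃ : Matrix (Fin 4) (Fin 4) R) (k l : Fin 4) :
    shearSecondJet M₀₀ M₀₂ M₀₃ M₂₂ M₂₃ M₃₃ 0 0 k l = M₀₀ k l ∧
      shearSecondJet M₀₀ M₀₂ M₀₃ M₂₂ M₂₃ M₃₃ 0 1 k l = 0 ∧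
      shearSecondJet M₀₀ M₀₂ M₀₃ M₂₂ M₂₃ M₃₃ 0 2 k l = M₀₂ k l ∧
      shearSecondJet M₀₀ M₀₂ M₀₃ M₂₂ M₂₃ M₃₃ 0 3 k l = M₀₃ k l ∧
      (∀ j, shearSecondJet M₀₀ M₀₂ M₀₃ M₂₂ M₂₃ M₃₃ 1 j k l = 0) ∧
      shearSecondJet M₀₀ M₀₂ M₀₃ M₂₂ M₂₃ M₃₃ 2 0 k l = M₀₂ k l ∧
      shearSecondJet M₀₀ M₀₂ M₀₃ M₂₂ M₂₃ M₃₃ 2 1 k l = 0 ∧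
      shearSecondJet M₀₀ M₀₂ M₀₃ M₂₂ M₂₃ M₃₃ 2 2 k l = M₂₂ k l ∧
      shearSecondJet M₀₀ M₀₂ M₀₃ M₂₂ M₂₃ M₃₃ 2 3 k l = M₂₃ k l ∧
      shearSecondJet M₀₀ M₀₂ M₀₃ M₂₂ M₂₃ M₃₃ 3 0 k l = M₀₃ k l ∧
      shearSecondJet M₀₀ M₀₂ M₀₃ M₂₂ M₂₃ M₃₃ 3 1 k l = 0 ∧
      shearSecondJet M₀₀ M₀₂ M₀₃ M₂₂ M₂₃ M₃₃ 3 2 k l = M₂₃ k l ∧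
      shearSecondJet M₀₀ M₀₂ M₀₃ M₂₂ M₂₃ M₃₃ 3 3 k l = M₃₃ k l :=
  ⟨rfl, rfl, rfl, rfl, fun _ => rfl, rfl, rfl, rfl, rfl, rfl, rfl, rfl, rfl⟩

theorem shearMatrix_isSymm (x y m p q : R) : (shearMatrix x y m p q).IsSymm :=
  Matrix.IsSymm.ext fun i j => by fin_cases i <;> fin_cases j <;> rfl

theorem shearFirstJet_symm {M₀ M₂ M₃ : Matrix (Fin 4) (Fin 4) R} (h₀ : M₀.IsSymm) (h₂ : M₂.IsSymm)
    (h₃ : M₃.IsSymm) (i j k : Fin 4) :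
    shearFirstJet M₀ M₂ M₃ i j k = shearFirstJet M₀ M₂ M₃ i k j := by
  fin_cases i
  exacts [h₀.apply k j, rfl, h₂.apply k j, h₃.apply k j]

theorem shearSecondJet_symm_left {M₀₀ M₀₂ M₀₃ M₂₂ M₂₃ M₃₃ : Matrix (Fin 4) (Fin 4) R}
    (i j k l : Fin 4) : shearSecondJet M₀₀ M₀₂ M₀₃ M₂₂ M₂₃ M₃₃ i j k l
      = shearSecondJet M₀₀ M₀₂ M₀₃ M₂₂ M₂₃ M₃₃ j i k l := by
  fin_cases i <;> fin_cases j <;> rfl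

theorem shearSecondJet_symm_right {M₀₀ M₀₂ M₀₃ M₂₂ M₂₃ M₃₃ : Matrix (Fin 4) (Fin 4) R}
    (h₀₀ : M₀₀.IsSymm) (h₀₂ : M₀₂.IsSymm) (h₀₃ : M₀₃.IsSymm) (h₂₂ : M₂₂.IsSymm) (h₂₃ : M₂₃.IsSymm)
    (h₃₃ : M₃₃.IsSymm) (i j k l : Fin 4) : shearSecondJet M₀₀ M₀₂ M₀₃ M₂₂ M₂₃ M₃₃ i j k l
      = shearSecondJet M₀₀ M₀₂ M₀₃ M₂₂ M₂₃ M₃₃ i j l k := by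
  fin_cases i <;> fin_cases j <;>
    first
      | exact h₀₀.apply l k
      | exact h₀₂.apply l k
      | exact h₀₃.apply l k
      | exact h₂₂.apply l k
      | exact h₂₃.apply l k
      | exact h₃₃.apply l k
      | rfl

end

/-- The coefficients of `-ρ (k ds₀² + l ds₁²) + E dx₀² + f (dx₁ - τ ds₁)²`. -/
def shearMetric (ρ E f k l τ : ℂ) : Matrix (Fin 4) (Fin 4) ℂ :=
  shearMatrix E f (-(f * τ)) (-(ρ * k)) (-(ρ * l) + f * τ ^ 2)

/-- The inverse of `shearMetric` at `τ = 0`. -/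
noncomputable def shearInv (ρ E f k l : ℂ) : Matrix (Fin 4) (Fin 4) ℂ :=
  shearMatrix (1 / E) (1 / f) 0 (-1 / (ρ * k)) (-1 / (ρ * l))

/-- The complex structure of `shearMetric` at `τ = 0`. -/
noncomputable def shearJ (ρ₁ f l t₂ : ℂ) : Matrix (Fin 4) (Fin 4) ℂ :=
  !![0, -(f / ρ₁), 0, 0; ρ₁ / f, 0, 0, 0; 0, 0, 0, -(l / t₂); 0, 0, t₂ / l, 0]

/-- The first derivatives of `shearMetric`, where `t₂, t₃` are the derivatives of `τ`. -/
def shearD (ρ ρ₁ E₁ f f₁ k k₂ k₃ l l₂ l₃ τ t₂ t₃ : ℂ) : Fin 4 → Fin 4 → Fin 4 → ℂ :=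
  shearFirstJet
    (shearMatrix E₁ f₁ (-(f₁ * τ)) (-(ρ₁ * k)) (-(ρ₁ * l) + f₁ * τ ^ 2))
    (shearMatrix 0 0 (-(f * t₂)) (-(ρ * k₂)) (-(ρ * l₂) + 2 * f * τ * t₂))
    (shearMatrix 0 0 (-(f * t₃)) (-(ρ * k₃)) (-(ρ * l₃) + 2 * f * τ * t₃))

/-- The second derivatives of `shearMetric` at `τ = 0`. -/
def shearT (ρ ρ₁ ρ₂ E₂ f f₁ f₂ k k₂ k₃ k₂₂ k₂₃ k₃₃ l l₂ l₃ l₂₂ l₂₃ l₃₃ t₂ t₃ t₂₂ t₂₃ t₃₃ : ℂ) :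
    Fin 4 → Fin 4 → Fin 4 → Fin 4 → ℂ :=
  shearSecondJet
    (shearMatrix E₂ f₂ 0 (-(ρ₂ * k)) (-(ρ₂ * l)))
    (shearMatrix 0 0 (-(f₁ * t₂)) (-(ρ₁ * k₂)) (-(ρ₁ * l₂)))
    (shearMatrix 0 0 (-(f₁ * t₃)) (-(ρ₁ * k₃)) (-(ρ₁ * l₃)))
    (shearMatrix 0 0 (-(f * t₂₂)) (-(ρ * k₂₂)) (-(ρ * l₂₂) + 2 * f * t₂ ^ 2))
    (shearMatrix 0 0 (-(f * t₂₃)) (-(ρ * k₂₃)) (-(ρ * l₂₃) + 2 * f * t₂ * t₃))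
    (shearMatrix 0 0 (-(f * t₃₃)) (-(ρ * k₃₃)) (-(ρ * l₃₃) + 2 * f * t₃ ^ 2))

/-- The Gauss curvature of `k ds₀² + l ds₁²`. -/
noncomputable def diagGaussCurvature (k k₂ k₃ k₃₃ l l₂ l₃ l₂₂ : ℂ) : ℂ :=
  (-(1 / 2) * (k₃₃ + l₂₂) + (k₃ ^ 2 + k₂ * l₂) / (4 * k) + (l₂ ^ 2 + k₃ * l₃) / (4 * l)) / (k * l)

section
variable {ρ ρ₁ ρ₂ E E₁ E₂ f f₁ f₂ k k₂ k₃ k₂₂ k₂₃ k₃₃ l l₂ l₃ l₂₂ l₂₃ l₃₃ τ t₂ t₃ t₂₂ t₂₃ t₃₃ : ℂ}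

theorem shearD_symm (i j m : Fin 4) :
    shearD ρ ρ₁ E₁ f f₁ k k₂ k₃ l l₂ l₃ τ t₂ t₃ i j m
      = shearD ρ ρ₁ E₁ f f₁ k k₂ k₃ l l₂ l₃ τ t₂ t₃ i m j :=
  shearFirstJet_symm (shearMatrix_isSymm ..) (shearMatrix_isSymm ..) (shearMatrix_isSymm ..) i j m

theorem shearT_symm (i j m n : Fin 4) :
    shearT ρ ρ₁ ρ₂ E₂ f f₁ f₂ k k₂ k₃ k₂₂ k₂₃ k₃₃ l l₂ l₃ l₂₂ l₂₃ l₃₃ t₂ t₃ t₂₂ t₂₃ t₃₃ i j m n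
      = shearT ρ ρ₁ ρ₂ E₂ f f₁ f₂ k k₂ k₃ k₂₂ k₂₃ k₃₃ l l₂ l₃ l₂₂ l₂₃ l₃₃ t₂ t₃ t₂₂ t₂₃ t₃₃
        i j n m :=
  shearSecondJet_symm_right (shearMatrix_isSymm ..) (shearMatrix_isSymm ..) (shearMatrix_isSymm ..)
    (shearMatrix_isSymm ..) (shearMatrix_isSymm ..) (shearMatrix_isSymm ..) i j m n

theorem shearMetric_mul_shearInv (hρ : ρ ≠ 0) (hE : E ≠ 0) (hf : f ≠ 0) (hk : k ≠ 0) (hl : l ≠ 0) :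
    shearMetric ρ E f k l 0 * shearInv ρ E f k l = 1 := by
  ext i j
  fin_cases i <;> fin_cases j <;>
    simp [shearMetric, shearInv, shearMatrix, Matrix.mul_apply, Fin.sum_univ_four] <;>
    field_simp

theorem shearJ_transpose_mul (hρ₁ : ρ₁ ≠ 0) (hf : f ≠ 0) (hl : l ≠ 0) (ht : t₂ ≠ 0)
    (hE : E * f = ρ₁ ^ 2) (hkl : k * l = t₂ ^ 2) :
    (shearJ ρ₁ f l t₂)ᵀ * shearMetric ρ E f k l 0
      = !![0, ρ₁, 0, 0; -ρ₁, 0, 0, 0; 0, 0, 0, -(ρ * t₂); 0, 0, ρ * t₂, 0] := by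
  obtain rfl : E = ρ₁ ^ 2 / f := by rw [eq_div_iff hf, hE]
  obtain rfl : k = t₂ ^ 2 / l := by rw [eq_div_iff hl, hkl]
  ext i j
  fin_cases i <;> fin_cases j <;>
    simp [shearMetric, shearJ, shearMatrix, Matrix.mul_apply, Fin.sum_univ_four] <;>
    field_simp

/-- The base metric `-ρ h` contributes `-ρ K`. The curvature of the connection form `θ` contributes
`-(3/4) f`, as in O'Neill's formula, and the dependence of `ρ` on `x₀` contributes `-(1/4) f`,
because `ρ₁²/E = f`. All terms carry the factor `k l = t₂²` in the coefficient 2323. -/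
theorem shear_curvature_base (hρ₁ : ρ₁ ≠ 0) (hf : f ≠ 0) (hl : l ≠ 0) (ht : t₂ ≠ 0)
    (hE : E * f = ρ₁ ^ 2) (hkl : k * l = t₂ ^ 2) {x y : Fin 4 → ℂ} (hx : x = ![0, 0, 1, 0])
    (hy : y = shearJ ρ₁ f l t₂ *ᵥ x) :
    jetCurvature (shearInv ρ E f k l) (shearD ρ ρ₁ E₁ f f₁ k k₂ k₃ l l₂ l₃ 0 t₂ t₃)
      (shearT ρ ρ₁ ρ₂ E₂ f f₁ f₂ k k₂ k₃ k₂₂ k₂₃ k₃₃ l l₂ l₃ l₂₂ l₂₃ l₃₃ t₂ t₃ t₂₂ t₂₃ t₃₃) x y x y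
      = -(ρ * diagGaussCurvature k k₂ k₃ k₃₃ l l₂ l₃ l₂₂ + f) * k ^ 2 := by
  obtain rfl : E = ρ₁ ^ 2 / f := by rw [eq_div_iff hf, hE]
  obtain rfl : k = t₂ ^ 2 / l := by rw [eq_div_iff hl, hkl]
  obtain rfl : y = ![0, 0, 0, t₂ / l] := by
    rw [hy, hx]
    ext i
    fin_cases i <;> simp [shearJ, Matrix.mulVec, dotProduct, Fin.sum_univ_four]
  subst hx
  obtain ⟨C, hC⟩ : ∃ C, C = jetCurvatureCoeff (shearInv ρ (ρ₁ ^ 2 / f) f (t₂ ^ 2 / l) l)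
      (shearD ρ ρ₁ E₁ f f₁ (t₂ ^ 2 / l) k₂ k₃ l l₂ l₃ 0 t₂ t₃)
      (shearT ρ ρ₁ ρ₂ E₂ f f₁ f₂ (t₂ ^ 2 / l) k₂ k₃ k₂₂ k₂₃ k₃₃ l l₂ l₃ l₂₂ l₂₃ l₃₃ t₂ t₃ t₂₂ t₂₃
        t₃₃) := ⟨_, rfl⟩
  have h : C 2 3 2 3
      = -(ρ * diagGaussCurvature (t₂ ^ 2 / l) k₂ k₃ k₃₃ l l₂ l₃ l₂₂ + f) * t₂ ^ 2 := by
    subst hC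
    simp only [jetCurvatureCoeff, Fin.sum_univ_four, shearInv, shearD, shearT, shearMatrix_apply,
      shearFirstJet_apply, shearSecondJet_apply, mul_zero, zero_mul, add_zero, zero_add, sub_zero,
      zero_sub, sub_self, diagGaussCurvature]
    field_simp
    ring
  refine (jetCurvature_four (shearMatrix_isSymm ..) shearD_symm shearT_symm
    shearSecondJet_symm_left _ _ (p₀ := 0) (p₁ := 0) (p₂ := 0) (p₃ := 0) (p₄ := 0) (p₅ := t₂ / l)
    (by simp) (by simp) (by simp) (by simp) (by simp) (by simp) hC).trans ?_
  rw [h]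
  field_simp
  ring

/-- For `f = a ρ² + b ρ` and a base of Gauss curvature `-b`, the curvature coefficients are those of
the model tensor of constant holomorphic sectional curvature `-a`. The base is specialised to `G
ds₀² + G⁻¹ ds₁²` with `τ = s₀ ds₁`. -/
theorem shear_curvature_constant {a b : ℂ} (hρ : ρ ≠ 0) (hρ₁ : ρ₁ ≠ 0) (hf : f ≠ 0) (hk : k ≠ 0)
    (hE : E * f = ρ₁ ^ 2) (hE₁ : E₁ * f + E * f₁ = 2 * ρ₁ * ρ₂) (hfρ : f = a * ρ ^ 2 + b * ρ)
    (hf₁ : f₁ = (2 * a * ρ + b) * ρ₁) (hf₂ : f₂ = 2 * a * ρ₁ ^ 2 + (2 * a * ρ + b) * ρ₂)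
    (hk₃₃ : k₃₃ = 2 * b) {x y : Fin 4 → ℂ} (hy : y = shearJ ρ₁ f (1 / k) 1 *ᵥ x) :
    jetCurvature (shearInv ρ E f k (1 / k))
      (shearD ρ ρ₁ E₁ f f₁ k 0 k₃ (1 / k) 0 (-k₃ / k ^ 2) 0 1 0)
      (shearT ρ ρ₁ ρ₂ E₂ f f₁ f₂ k 0 k₃ 0 0 k₃₃ (1 / k) 0 (-k₃ / k ^ 2) 0 0
        ((2 * k₃ ^ 2 - k * k₃₃) / k ^ 3) 1 0 0 0 0) x y x y
      = -a * (x ⬝ᵥ shearMetric ρ E f k (1 / k) 0 *ᵥ x) ^ 2 := by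
  obtain rfl : E = ρ₁ ^ 2 / f := by rw [eq_div_iff hf, hE]
  obtain rfl : E₁ = 2 * ρ₁ * ρ₂ / f - ρ₁ ^ 2 * f₁ / f ^ 2 := by
    field_simp
    field_simp at hE₁
    linear_combination hE₁
  obtain ⟨C, hC⟩ : ∃ C, C = jetCurvatureCoeff (shearInv ρ (ρ₁ ^ 2 / f) f k (1 / k))
      (shearD ρ ρ₁ (2 * ρ₁ * ρ₂ / f - ρ₁ ^ 2 * f₁ / f ^ 2) f f₁ k 0 k₃ (1 / k) 0 (-k₃ / k ^ 2) 0 1 0)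
      (shearT ρ ρ₁ ρ₂ E₂ f f₁ f₂ k 0 k₃ 0 0 k₃₃ (1 / k) 0 (-k₃ / k ^ 2) 0 0
        ((2 * k₃ ^ 2 - k * k₃₃) / k ^ 3) 1 0 0 0 0) := ⟨_, rfl⟩
  -- The `J`-invariant frame planes 01 and 23 have `-a` times the squared length, the other
  -- coordinate planes a quarter of `-a` times the product of the diagonal entries, and the three
  -- mixed coefficients involve only `ω`.
  have h : C 0 1 0 1 = -a * ρ₁ ^ 2 ∧ C 0 2 0 2 = a / 4 * (ρ₁ ^ 2 / f * ρ * k) ∧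
      C 0 3 0 3 = a / 4 * (ρ₁ ^ 2 / f * ρ / k) ∧ C 1 2 1 2 = a / 4 * (f * ρ * k) ∧
      C 1 3 1 3 = a / 4 * (f * ρ / k) ∧ C 2 3 2 3 = -a * ρ ^ 2 ∧ C 0 1 2 3 = a / 2 * (ρ₁ * ρ) ∧
      C 0 2 1 3 = a / 4 * (ρ₁ * ρ) ∧ C 0 3 1 2 = -(a / 4 * (ρ₁ * ρ)) ∧ C 0 1 0 2 = 0 ∧
      C 0 1 0 3 = 0 ∧ C 0 1 1 2 = 0 ∧ C 0 1 1 3 = 0 ∧ C 0 2 0 3 = 0 ∧ C 0 2 1 2 = 0 ∧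
      C 0 2 2 3 = 0 ∧ C 0 3 1 3 = 0 ∧ C 0 3 2 3 = 0 ∧ C 1 2 1 3 = 0 ∧ C 1 2 2 3 = 0 ∧
      C 1 3 2 3 = 0 := by
    subst hC
    refine ⟨?_, ?_, ?_, ?_, ?_, ?_, ?_, ?_, ?_, ?_, ?_, ?_, ?_, ?_, ?_, ?_, ?_, ?_, ?_, ?_, ?_⟩ <;>
    · simp only [jetCurvatureCoeff, Fin.sum_univ_four, shearInv, shearD, shearT, shearMatrix_apply,
        shearFirstJet_apply, shearSecondJet_apply, mul_zero, zero_mul, add_zero, zero_add, sub_zero,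
        zero_sub, sub_self, neg_zero, mul_one, one_pow, ne_eq, OfNat.ofNat_ne_zero,
        not_false_eq_true, zero_pow]
      try field_simp
      try rw [hf₁]
      try rw [hf₂]
      try rw [hk₃₃]
      try rw [hfρ]
      try ring
  obtain ⟨c1, c2, c3, c4, c5, c6, c7, c8, c9, z1, z2, z3, z4, z5, z6, z7, z8, z9, z10, z11,
    z12⟩ := h
  refine (jetCurvature_four (shearMatrix_isSymm ..) shearD_symm shearT_symm
    shearSecondJet_symm_left _ _ rfl rfl rfl rfl rfl rfl hC).trans ?_
  rw [c1, c2, c3, c4, c5, c6, c7, c8, c9, z1, z2, z3, z4, z5, z6, z7, z8, z9, z10, z11, z12, hy]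
  clear * - hρ hρ₁ hf hk
  simp [shearJ, shearMetric, shearMatrix, Matrix.mulVec, dotProduct, Fin.sum_univ_four]
  field_simp
  ring

end

/-! ### Calculus of functions independent of `x₁` -/

/-- `f` does not depend on the second coordinate and has the partial derivatives `x`, `y` and `z` in
the other coordinates. -/
abbrev HasTripleGrad (f : (Fin 4 → ℝ) → ℂ) (x y z : ℂ) (p : Fin 4 → ℝ) : Prop :=
  HasFrameGrad 1 f ![x, 0, y, z] p

namespace HasTripleGrad
variable {f g : (Fin 4 → ℝ) → ℂ} {x y z x' y' z' : ℂ} {p : Fin 4 → ℝ}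

theorem congr (hf : HasTripleGrad f x y z p) (hx : x' = x) (hy : y' = y) (hz : z' = z) :
    HasTripleGrad f x' y' z' p := by
  rwa [hx, hy, hz]

theorem const (c : ℂ) : HasTripleGrad (fun _ => c) 0 0 0 p :=
  (HasFrameGrad.const c).congr_grad (forall_fin_four rfl rfl rfl rfl)

theorem add (hf : HasTripleGrad f x y z p) (hg : HasTripleGrad g x' y' z' p) :
    HasTripleGrad (fun q => f q + g q) (x + x') (y + y') (z + z') p :=
  (HasFrameGrad.add hf hg).congr_grad (forall_fin_four rfl (by simp) rfl rfl)

theorem sub (hf : HasTripleGrad f x y z p) (hg : HasTripleGrad g x' y' z' p) :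
    HasTripleGrad (fun q => f q - g q) (x - x') (y - y') (z - z') p :=
  (HasFrameGrad.sub hf hg).congr_grad (forall_fin_four rfl (by simp) rfl rfl)

theorem neg (hf : HasTripleGrad f x y z p) :
    HasTripleGrad (fun q => -f q) (-x) (-y) (-z) p :=
  (HasFrameGrad.neg hf).congr_grad (forall_fin_four rfl (by simp) rfl rfl)

theorem mul (hf : HasTripleGrad f x y z p) (hg : HasTripleGrad g x' y' z' p) :
    HasTripleGrad (fun q => f q * g q) (x * g p + f p * x') (y * g p + f p * y')
      (z * g p + f p * z') p :=
  (HasFrameGrad.mul hf hg).congr_grad (forall_fin_four rfl (by simp) rfl rfl)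

theorem pow (hf : HasTripleGrad f x y z p) (n : ℕ) :
    HasTripleGrad (fun q => f q ^ n) (n * f p ^ (n - 1) * x) (n * f p ^ (n - 1) * y)
      (n * f p ^ (n - 1) * z) p :=
  (HasFrameGrad.comp hf (hasDerivAt_pow n (f p))).congr_grad
    (forall_fin_four rfl (by simp) rfl rfl)

theorem of_zero {φ : ℝ → ℝ} {φ' : ℝ} (h : HasDerivAt φ φ' (p 0)) :
    HasTripleGrad (fun q => (φ (q 0) : ℂ)) φ' 0 0 p := by
  refine forall_fin_four ?_ ?_ ?_ ?_ <;>
    simpa [Fin.sum_univ_four, Matrix.one_apply] using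
      by first | exact h.ofReal_comp | exact hasDerivAt_const _ _

theorem of_two {φ : ℝ → ℝ} {φ' : ℝ} (h : HasDerivAt φ φ' (p 2)) :
    HasTripleGrad (fun q => (φ (q 2) : ℂ)) 0 φ' 0 p := by
  refine forall_fin_four ?_ ?_ ?_ ?_ <;>
    simpa [Fin.sum_univ_four, Matrix.one_apply] using
      by first | exact h.ofReal_comp | exact hasDerivAt_const _ _

theorem of_three {φ : ℝ → ℝ} {φ' : ℝ} (h : HasDerivAt φ φ' (p 3)) :
    HasTripleGrad (fun q => (φ (q 3) : ℂ)) 0 0 φ' p := by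
  refine forall_fin_four ?_ ?_ ?_ ?_ <;>
    simpa [Fin.sum_univ_four, Matrix.one_apply] using
      by first | exact h.ofReal_comp | exact hasDerivAt_const _ _

end HasTripleGrad

/-- The coframe `dx₀, dx₁ - t ds₁, ds₀, ds₁` for a constant `t`. -/
def shearCoframe (t : ℂ) : Matrix (Fin 4) (Fin 4) ℂ :=
  !![1, 0, 0, 0; 0, 1, 0, -t; 0, 0, 1, 0; 0, 0, 0, 1]

theorem shearCoframe_mul_neg (t : ℂ) : shearCoframe t * shearCoframe (-t) = 1 := by
  ext i j
  fin_cases i <;> fin_cases j <;>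
    simp [shearCoframe, Matrix.mul_apply, Fin.sum_univ_four]

theorem HasTripleGrad.hasFrameGrad {f : (Fin 4 → ℝ) → ℂ} {x y z : ℂ} {p : Fin 4 → ℝ}
    (h : HasTripleGrad f x y z p) (t : ℂ) : HasFrameGrad (shearCoframe t) f ![x, 0, y, z] p := by
  refine fun i => (h i).congr_deriv ?_
  revert i
  refine forall_fin_four ?_ ?_ ?_ ?_ <;>
    simp [Fin.sum_univ_four, shearCoframe, Matrix.one_apply]

theorem hasFrameGrad_shearMatrix {x y m s r : (Fin 4 → ℝ) → ℂ}
    {x₀ y₀ m₀ s₀ r₀ x₂ y₂ m₂ s₂ r₂ x₃ y₃ m₃ s₃ r₃ : ℂ} {p : Fin 4 → ℝ} (t : ℂ)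
    (hx : HasTripleGrad x x₀ x₂ x₃ p) (hy : HasTripleGrad y y₀ y₂ y₃ p)
    (hm : HasTripleGrad m m₀ m₂ m₃ p) (hs : HasTripleGrad s s₀ s₂ s₃ p)
    (hr : HasTripleGrad r r₀ r₂ r₃ p) (i j : Fin 4) :
    HasFrameGrad (shearCoframe t) (fun q => shearMatrix (x q) (y q) (m q) (s q) (r q) i j)
      (fun c => shearFirstJet (shearMatrix x₀ y₀ m₀ s₀ r₀) (shearMatrix x₂ y₂ m₂ s₂ r₂)
        (shearMatrix x₃ y₃ m₃ s₃ r₃) c i j) p := by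
  have h0 : HasTripleGrad (fun _ => 0) 0 0 0 p := HasTripleGrad.const 0
  have key : ∀ {f : (Fin 4 → ℝ) → ℂ} {a b c : ℂ}, HasTripleGrad f a b c p →
      ∀ {d : Fin 4 → ℂ}, d 0 = a → d 1 = 0 → d 2 = b → d 3 = c →
        HasFrameGrad (shearCoframe t) f d p := fun h _ h0 h1 h2 h3 =>
    (h.hasFrameGrad t).congr_grad (forall_fin_four h0 h1 h2 h3)
  revert i j
  refine forall_fin_four ?_ ?_ ?_ ?_ <;> refine forall_fin_four ?_ ?_ ?_ ?_
  exacts [key hx rfl rfl rfl rfl, key h0 rfl rfl rfl rfl, key h0 rfl rfl rfl rfl,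
    key h0 rfl rfl rfl rfl, key h0 rfl rfl rfl rfl, key hy rfl rfl rfl rfl, key h0 rfl rfl rfl rfl,
    key hm rfl rfl rfl rfl, key h0 rfl rfl rfl rfl, key h0 rfl rfl rfl rfl, key hs rfl rfl rfl rfl,
    key h0 rfl rfl rfl rfl, key h0 rfl rfl rfl rfl, key hm rfl rfl rfl rfl, key h0 rfl rfl rfl rfl,
    key hr rfl rfl rfl rfl]

theorem hasFrameGrad_shearFirstJet {Q : Matrix (Fin 4) (Fin 4) ℂ}
    {M₀ M₂ M₃ : (Fin 4 → ℝ) → Matrix (Fin 4) (Fin 4) ℂ}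
    {M₀₀ M₀₂ M₀₃ M₂₂ M₂₃ M₃₃ : Matrix (Fin 4) (Fin 4) ℂ} {p : Fin 4 → ℝ}
    (h₀ : ∀ j k, HasFrameGrad Q (fun q => M₀ q j k) (fun c => shearFirstJet M₀₀ M₀₂ M₀₃ c j k) p)
    (h₂ : ∀ j k, HasFrameGrad Q (fun q => M₂ q j k) (fun c => shearFirstJet M₀₂ M₂₂ M₂₃ c j k) p)
    (h₃ : ∀ j k, HasFrameGrad Q (fun q => M₃ q j k) (fun c => shearFirstJet M₀₃ M₂₃ M₃₃ c j k) p)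
    (i j k : Fin 4) :
    HasFrameGrad Q (fun q => shearFirstJet (M₀ q) (M₂ q) (M₃ q) i j k)
      (fun c => shearSecondJet M₀₀ M₀₂ M₀₃ M₂₂ M₂₃ M₃₃ c i j k) p := by
  revert i
  refine forall_fin_four ?_ ?_ ?_ ?_
  · exact (h₀ j k).congr_grad (forall_fin_four rfl rfl rfl rfl)
  · exact (HasFrameGrad.const 0).congr_grad (forall_fin_four rfl rfl rfl rfl)
  · exact (h₂ j k).congr_grad (forall_fin_four rfl rfl rfl rfl)
  · exact (h₃ j k).congr_grad (forall_fin_four rfl rfl rfl rfl)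

/-! ### Degenerate presentations and the condition on the base -/

/-- Functions `ρ`, `E` and `f = ρ'² / E` of one real variable; subscripts denote derivatives. -/
structure DegenerateProfile (S : Set ℝ) where
  ρ : ℝ → ℝ
  ρ₁ : ℝ → ℝ
  ρ₂ : ℝ → ℝ
  E : ℝ → ℝ
  E₁ : ℝ → ℝ
  E₂ : ℝ → ℝ
  f : ℝ → ℝ
  f₁ : ℝ → ℝ
  f₂ : ℝ → ℝ
  deriv_ρ : ∀ x ∈ S, HasDerivAt ρ (ρ₁ x) x
  deriv_ρ₁ : ∀ x ∈ S, HasDerivAt ρ₁ (ρ₂ x) x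
  deriv_E : ∀ x ∈ S, HasDerivAt E (E₁ x) x
  deriv_E₁ : ∀ x ∈ S, HasDerivAt E₁ (E₂ x) x
  deriv_f : ∀ x ∈ S, HasDerivAt f (f₁ x) x
  deriv_f₁ : ∀ x ∈ S, HasDerivAt f₁ (f₂ x) x
  ρ_ne : ∀ x ∈ S, ρ x ≠ 0
  ρ₁_ne : ∀ x ∈ S, ρ₁ x ≠ 0
  E_mul_f : ∀ x ∈ S, E x * f x = ρ₁ x ^ 2
  E₁_mul_f : ∀ x ∈ S, E₁ x * f x + E x * f₁ x = 2 * ρ₁ x * ρ₂ x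

/-- Functions `k`, `l` and `t` of `s₀` and `s₁` such that `dt ∧ ds₁` is an area form of
`k ds₀² + l ds₁²`; the subscripts denote derivatives. -/
structure DegenerateBase (U : Set (Fin 4 → ℝ)) where
  k : (Fin 4 → ℝ) → ℂ
  k₂ : (Fin 4 → ℝ) → ℂ
  k₃ : (Fin 4 → ℝ) → ℂ
  k₂₂ : (Fin 4 → ℝ) → ℂ
  k₂₃ : (Fin 4 → ℝ) → ℂ
  k₃₃ : (Fin 4 → ℝ) → ℂ
  l : (Fin 4 → ℝ) → ℂ
  l₂ : (Fin 4 → ℝ) → ℂ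
  l₃ : (Fin 4 → ℝ) → ℂ
  l₂₂ : (Fin 4 → ℝ) → ℂ
  l₂₃ : (Fin 4 → ℝ) → ℂ
  l₃₃ : (Fin 4 → ℝ) → ℂ
  t : (Fin 4 → ℝ) → ℂ
  t₂ : (Fin 4 → ℝ) → ℂ
  t₃ : (Fin 4 → ℝ) → ℂ
  t₂₂ : (Fin 4 → ℝ) → ℂ
  t₂₃ : (Fin 4 → ℝ) → ℂ
  t₃₃ : (Fin 4 → ℝ) → ℂ
  grad_k : ∀ p ∈ U, HasTripleGrad k 0 (k₂ p) (k₃ p) p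
  grad_k₂ : ∀ p ∈ U, HasTripleGrad k₂ 0 (k₂₂ p) (k₂₃ p) p
  grad_k₃ : ∀ p ∈ U, HasTripleGrad k₃ 0 (k₂₃ p) (k₃₃ p) p
  grad_l : ∀ p ∈ U, HasTripleGrad l 0 (l₂ p) (l₃ p) p
  grad_l₂ : ∀ p ∈ U, HasTripleGrad l₂ 0 (l₂₂ p) (l₂₃ p) p
  grad_l₃ : ∀ p ∈ U, HasTripleGrad l₃ 0 (l₂₃ p) (l₃₃ p) p
  grad_t : ∀ p ∈ U, HasTripleGrad t 0 (t₂ p) (t₃ p) p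
  grad_t₂ : ∀ p ∈ U, HasTripleGrad t₂ 0 (t₂₂ p) (t₂₃ p) p
  grad_t₃ : ∀ p ∈ U, HasTripleGrad t₃ 0 (t₂₃ p) (t₃₃ p) p
  t₂_ne : ∀ p ∈ U, t₂ p ≠ 0
  k_mul_l : ∀ p ∈ U, k p * l p = t₂ p ^ 2

/-- The Gauss curvature of the base. -/
noncomputable def DegenerateBase.curvature {U : Set (Fin 4 → ℝ)} (B : DegenerateBase U)
    (p : Fin 4 → ℝ) : ℂ :=
  diagGaussCurvature (B.k p) (B.k₂ p) (B.k₃ p) (B.k₃₃ p) (B.l p) (B.l₂ p) (B.l₃ p) (B.l₂₂ p)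

/-- A presentation of `g` and `ω` on `U` as a metric of degenerate type. -/
structure DegeneratePresentation {S : Set ℝ} {U : Set (Fin 4 → ℝ)} (P : DegenerateProfile S)
    (B : DegenerateBase U) (g ω : FormField 4) : Prop where
  mem : ∀ p ∈ U, p 0 ∈ S
  metric_eq : ∀ p ∈ U, (g p).map Complex.ofReal
    = !![(P.E (p 0) : ℂ), 0, 0, 0; 0, P.f (p 0), 0, -(P.f (p 0) * B.t p);
        0, 0, -(P.ρ (p 0) * B.k p), 0;
        0, -(P.f (p 0) * B.t p), 0, -(P.ρ (p 0) * B.l p) + P.f (p 0) * B.t p ^ 2]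
  form_eq : ∀ p ∈ U, (ω p).map Complex.ofReal
    = !![0, (P.ρ₁ (p 0) : ℂ), 0, -(P.ρ₁ (p 0) * B.t p); -P.ρ₁ (p 0), 0, 0, 0;
        0, 0, 0, -(P.ρ (p 0) * B.t₂ p); P.ρ₁ (p 0) * B.t p, 0, P.ρ (p 0) * B.t₂ p, 0]

namespace DegeneratePresentation
variable {S : Set ℝ} {U : Set (Fin 4 → ℝ)} {P : DegenerateProfile S} {B : DegenerateBase U}
  {g ω : FormField 4} {p q : Fin 4 → ℝ}

theorem grad_metric (F : DegeneratePresentation P B g ω) (hq : q ∈ U) (t₀ : ℂ) (i j : Fin 4) :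
    HasFrameGrad (shearCoframe t₀)
      (fun q => shearMetric (P.ρ (q 0)) (P.E (q 0)) (P.f (q 0)) (B.k q) (B.l q) (B.t q - t₀) i j)
      (fun c => shearD (P.ρ (q 0)) (P.ρ₁ (q 0)) (P.E₁ (q 0)) (P.f (q 0)) (P.f₁ (q 0)) (B.k q)
        (B.k₂ q) (B.k₃ q) (B.l q) (B.l₂ q) (B.l₃ q) (B.t q - t₀) (B.t₂ q) (B.t₃ q) c i j) q := by
  have hρ := HasTripleGrad.of_zero (P.deriv_ρ _ (F.mem q hq))
  have hE := HasTripleGrad.of_zero (P.deriv_E _ (F.mem q hq))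
  have hf := HasTripleGrad.of_zero (P.deriv_f _ (F.mem q hq))
  have hτ := (B.grad_t q hq).sub (HasTripleGrad.const t₀)
  refine hasFrameGrad_shearMatrix t₀ hE hf ((hf.mul hτ).neg.congr ?_ ?_ ?_)
    ((hρ.mul (B.grad_k q hq)).neg.congr ?_ ?_ ?_)
    (((hρ.mul (B.grad_l q hq)).neg.add (hf.mul (hτ.pow 2))).congr ?_ ?_ ?_) i j <;>
  · push_cast
    ring

theorem grad_D (F : DegeneratePresentation P B g ω) (hp : p ∈ U) (i j k : Fin 4) :
    HasFrameGrad (shearCoframe (B.t p))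
      (fun q => shearD (P.ρ (q 0)) (P.ρ₁ (q 0)) (P.E₁ (q 0)) (P.f (q 0)) (P.f₁ (q 0)) (B.k q)
        (B.k₂ q) (B.k₃ q) (B.l q) (B.l₂ q) (B.l₃ q) (B.t q - B.t p) (B.t₂ q) (B.t₃ q) i j k)
      (fun c => shearT (P.ρ (p 0)) (P.ρ₁ (p 0)) (P.ρ₂ (p 0)) (P.E₂ (p 0)) (P.f (p 0)) (P.f₁ (p 0))
        (P.f₂ (p 0)) (B.k p) (B.k₂ p) (B.k₃ p) (B.k₂₂ p) (B.k₂₃ p) (B.k₃₃ p) (B.l p) (B.l₂ p)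
        (B.l₃ p) (B.l₂₂ p) (B.l₂₃ p) (B.l₃₃ p) (B.t₂ p) (B.t₃ p) (B.t₂₂ p) (B.t₂₃ p) (B.t₃₃ p)
        c i j k) p := by
  have hρ := HasTripleGrad.of_zero (P.deriv_ρ _ (F.mem p hp))
  have hρ₁ := HasTripleGrad.of_zero (P.deriv_ρ₁ _ (F.mem p hp))
  have hE₁ := HasTripleGrad.of_zero (P.deriv_E₁ _ (F.mem p hp))
  have hf := HasTripleGrad.of_zero (P.deriv_f _ (F.mem p hp))
  have hf₁ := HasTripleGrad.of_zero (P.deriv_f₁ _ (F.mem p hp))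
  have hτ := (B.grad_t p hp).sub (HasTripleGrad.const (B.t p))
  have h0 : HasTripleGrad (fun _ => 0) 0 0 0 p := HasTripleGrad.const 0
  have h2 : HasTripleGrad (fun _ => 2) 0 0 0 p := HasTripleGrad.const 2
  refine hasFrameGrad_shearFirstJet
    (fun j k => hasFrameGrad_shearMatrix _ hE₁ hf₁ ((hf₁.mul hτ).neg.congr ?_ ?_ ?_)
      ((hρ₁.mul (B.grad_k p hp)).neg.congr ?_ ?_ ?_)
      (((hρ₁.mul (B.grad_l p hp)).neg.add (hf₁.mul (hτ.pow 2))).congr ?_ ?_ ?_) j k)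
    (fun j k => hasFrameGrad_shearMatrix _ h0 h0 ((hf.mul (B.grad_t₂ p hp)).neg.congr ?_ ?_ ?_)
      ((hρ.mul (B.grad_k₂ p hp)).neg.congr ?_ ?_ ?_)
      (((hρ.mul (B.grad_l₂ p hp)).neg.add
        (((h2.mul hf).mul hτ).mul (B.grad_t₂ p hp))).congr ?_ ?_ ?_) j k)
    (fun j k => hasFrameGrad_shearMatrix _ h0 h0 ((hf.mul (B.grad_t₃ p hp)).neg.congr ?_ ?_ ?_)
      ((hρ.mul (B.grad_k₃ p hp)).neg.congr ?_ ?_ ?_)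
      (((hρ.mul (B.grad_l₃ p hp)).neg.add
        (((h2.mul hf).mul hτ).mul (B.grad_t₃ p hp))).congr ?_ ?_ ?_) j k) i j k <;>
  · push_cast
    ring

theorem f_ne (F : DegeneratePresentation P B g ω) (hp : p ∈ U) : (P.f (p 0) : ℂ) ≠ 0 :=
  Complex.ofReal_ne_zero.2 (right_ne_zero_of_mul
    (P.E_mul_f _ (F.mem p hp) ▸ pow_ne_zero 2 (P.ρ₁_ne _ (F.mem p hp))))

theorem k_ne (hp : p ∈ U) : B.k p ≠ 0 :=
  left_ne_zero_of_mul (B.k_mul_l p hp ▸ pow_ne_zero 2 (B.t₂_ne p hp))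

theorem l_ne (hp : p ∈ U) : B.l p ≠ 0 :=
  right_ne_zero_of_mul (B.k_mul_l p hp ▸ pow_ne_zero 2 (B.t₂_ne p hp))

/-- The jet of the metric at a point. -/
noncomputable def frameJet (F : DegeneratePresentation P B g ω) (hp : p ∈ U) :
    FrameJet g ω U p where
  P := shearCoframe (-B.t p)
  -- The coframe uses the frozen value `t(p)`. Thus `τ = t - t(p)` vanishes at `p`, the metric is
  -- diagonal there, and the frame remains constant.
  Q := shearCoframe (B.t p)
  G q := shearMetric (P.ρ (q 0)) (P.E (q 0)) (P.f (q 0)) (B.k q) (B.l q) (B.t q - B.t p)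
  N := shearInv (P.ρ (p 0)) (P.E (p 0)) (P.f (p 0)) (B.k p) (B.l p)
  J := shearJ (P.ρ₁ (p 0)) (P.f (p 0)) (B.l p) (B.t₂ p)
  D q := shearD (P.ρ (q 0)) (P.ρ₁ (q 0)) (P.E₁ (q 0)) (P.f (q 0)) (P.f₁ (q 0)) (B.k q)
    (B.k₂ q) (B.k₃ q) (B.l q) (B.l₂ q) (B.l₃ q) (B.t q - B.t p) (B.t₂ q) (B.t₃ q)
  T := shearT (P.ρ (p 0)) (P.ρ₁ (p 0)) (P.ρ₂ (p 0)) (P.E₂ (p 0)) (P.f (p 0)) (P.f₁ (p 0))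
    (P.f₂ (p 0)) (B.k p) (B.k₂ p) (B.k₃ p) (B.k₂₂ p) (B.k₂₃ p) (B.k₃₃ p) (B.l p) (B.l₂ p)
    (B.l₃ p) (B.l₂₂ p) (B.l₂₃ p) (B.l₃₃ p) (B.t₂ p) (B.t₃ p) (B.t₂₂ p) (B.t₂₃ p) (B.t₃₃ p)
  Q_mul_P := shearCoframe_mul_neg _
  metric_eq q hq := by
    rw [F.metric_eq q hq]
    ext i j
    fin_cases i <;> fin_cases j <;>
      simp [shearMetric, shearMatrix, shearCoframe, Matrix.mul_apply, Fin.sum_univ_four] <;> ring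
  form_eq := by
    have hE : (P.E (p 0) : ℂ) * P.f (p 0) = P.ρ₁ (p 0) ^ 2 := by
      exact_mod_cast P.E_mul_f _ (F.mem p hp)
    rw [F.form_eq p hp, sub_self, shearJ_transpose_mul
      (Complex.ofReal_ne_zero.2 (P.ρ₁_ne _ (F.mem p hp))) (F.f_ne hp) (l_ne hp) (B.t₂_ne p hp) hE
      (B.k_mul_l p hp)]
    ext i j
    fin_cases i <;> fin_cases j <;>
      simp [shearCoframe, Matrix.mul_apply, Fin.sum_univ_four, mul_comm]
  G_mul_N := by
    rw [sub_self]
    exact shearMetric_mul_shearInv (Complex.ofReal_ne_zero.2 (P.ρ_ne _ (F.mem p hp)))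
      (Complex.ofReal_ne_zero.2 (left_ne_zero_of_mul
        (P.E_mul_f _ (F.mem p hp) ▸ pow_ne_zero 2 (P.ρ₁_ne _ (F.mem p hp)))))
      (F.f_ne hp) (k_ne hp) (l_ne hp)
  G_symm _ := shearMatrix_isSymm ..
  D_symm _ := shearD_symm
  T_symm := shearSecondJet_symm_left
  hasFrameGrad_G _ hq := F.grad_metric hq _
  hasFrameGrad_D := F.grad_D hp

/-- The horizontal lift of `∂_{s₀}` has squared length `-ρ k` and curvature `-(ρ K + f) k²`;
equating the quotient with `κ` and solving for `K` gives the formula. -/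
theorem curvature_eq_of_hasConstantHSC (F : DegeneratePresentation P B g ω) (hU : IsOpen U)
    (h : HasConstantHSC g ω U) : ∃ κ : ℝ, ∀ p ∈ U,
      B.curvature p = -((P.f (p 0) / P.ρ (p 0) + κ * P.ρ (p 0) : ℝ) : ℂ) := by
  obtain ⟨κ, hκ⟩ := (hasConstantHSC_iff_defect (fun _ => hU) (fun _ hp => hp)
    (fun p hp => F.frameJet hp)).1 h
  refine ⟨κ, fun p hp => ?_⟩
  have hρ := Complex.ofReal_ne_zero.2 (P.ρ_ne _ (F.mem p hp))
  have hx : (![0, 0, 1, 0] : Fin 4 → ℂ) ⬝ᵥ (F.frameJet hp).G p *ᵥ ![0, 0, 1, 0]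
      = -(P.ρ (p 0) * B.k p) := by
    simp [frameJet, shearMetric, shearMatrix, Matrix.mulVec, dotProduct, Fin.sum_univ_four]
  have h0 : -((P.ρ (p 0) : ℂ) * B.k p) ≠ 0 := neg_ne_zero.2 (mul_ne_zero hρ (k_ne hp))
  have := hκ p hp ![0, 0, 1, 0] (hx ▸ h0)
  rw [FrameJet.defect, hx, FrameJet.curv] at this
  have hE : (P.E (p 0) : ℂ) * P.f (p 0) = P.ρ₁ (p 0) ^ 2 := by
    exact_mod_cast P.E_mul_f _ (F.mem p hp)
  have hc := shear_curvature_base (ρ := P.ρ (p 0)) (ρ₂ := P.ρ₂ (p 0)) (E₁ := P.E₁ (p 0)) (E₂ := P.E₂ (p 0))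
    (f₁ := P.f₁ (p 0)) (f₂ := P.f₂ (p 0)) (k₂ := B.k₂ p) (k₃ := B.k₃ p) (k₂₂ := B.k₂₂ p)
    (k₂₃ := B.k₂₃ p) (k₃₃ := B.k₃₃ p) (l₂ := B.l₂ p) (l₃ := B.l₃ p) (l₂₂ := B.l₂₂ p)
    (l₂₃ := B.l₂₃ p) (l₃₃ := B.l₃₃ p) (t₃ := B.t₃ p) (t₂₂ := B.t₂₂ p) (t₂₃ := B.t₂₃ p)
    (t₃₃ := B.t₃₃ p) (Complex.ofReal_ne_zero.2 (P.ρ₁_ne _ (F.mem p hp))) (F.f_ne hp) (l_ne hp)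
    (B.t₂_ne p hp) hE (B.k_mul_l p hp) rfl rfl
  simp only [frameJet, sub_self] at this
  rw [hc] at this
  have h2 : (B.k p) ^ 2 ≠ 0 := pow_ne_zero 2 (k_ne hp)
  rw [DegenerateBase.curvature]
  push_cast
  field_simp
  refine mul_right_cancel₀ h2 ?_
  linear_combination -this

end DegeneratePresentation

namespace DegeneratePresentation
variable {S : Set ℝ} {U : Set (Fin 4 → ℝ)} {P : DegenerateProfile S} {B : DegenerateBase U}
  {g ω : FormField 4} {p : Fin 4 → ℝ}

/-- The derivative along `x₀` of the formula for the curvature of the base. -/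
theorem deriv_eq_of_hasConstantHSC (F : DegeneratePresentation P B g ω) (hU : IsOpen U)
    (hB : ∀ p x, B.curvature (Function.update p 0 x) = B.curvature p)
    (h : HasConstantHSC g ω U) : ∃ κ : ℝ,
      (∀ p ∈ U, B.curvature p = -((P.f (p 0) / P.ρ (p 0) + κ * P.ρ (p 0) : ℝ) : ℂ)) ∧
      ∀ p ∈ U, (P.f₁ (p 0) * P.ρ (p 0) - P.f (p 0) * P.ρ₁ (p 0)) / P.ρ (p 0) ^ 2
        + κ * P.ρ₁ (p 0) = 0 := by
  obtain ⟨κ, hκ⟩ := F.curvature_eq_of_hasConstantHSC hU h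
  refine ⟨κ, hκ, fun p hp => ?_⟩
  have hS := F.mem p hp
  have hd := ((P.deriv_f _ hS).fun_div (P.deriv_ρ _ hS) (P.ρ_ne _ hS)).fun_add
    ((P.deriv_ρ _ hS).const_mul κ)
  -- Along `x₀` the curvature of the base does not change, so `f/ρ + κ ρ` is locally constant in
  -- this direction.
  refine hd.unique ((hasDerivAt_const (p 0) (P.f (p 0) / P.ρ (p 0) + κ * P.ρ (p 0))
    ).congr_of_eventuallyEq ?_)
  filter_upwards [eventually_update_mem hU hp 0] with x hx
  have h1 := hκ _ hx
  rw [hB, hκ p hp, neg_inj, Complex.ofReal_inj] at h1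
  simpa using h1.symm

end DegeneratePresentation

theorem eq_zero_of_coord_const {U : Set (Fin 4 → ℝ)} {p : Fin 4 → ℝ} (hU : IsOpen U) (hp : p ∈ U)
    {ψ : ℝ → ℝ} {ψ' c : ℝ} (h : ∀ q ∈ U, ψ (q 0) = c) (hψ : HasDerivAt ψ ψ' (p 0)) : ψ' = 0 := by
  refine hψ.unique ((hasDerivAt_const (p 0) c).congr_of_eventuallyEq ?_)
  filter_upwards [eventually_update_mem hU hp 0] with x hx
  simpa using h _ hx

theorem ContDiffOn.hasDerivAt_deriv {G : ℝ → ℝ} {I : Set ℝ} (hG : ContDiffOn ℝ (⊤ : ℕ∞) G I)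
    (hI : IsOpen I) {x : ℝ} (hx : x ∈ I) :
    HasDerivAt G (deriv G x) x ∧ HasDerivAt (deriv G) (deriv (deriv G) x) x := by
  obtain ⟨h1, h2⟩ := (contDiffOn_infty_iff_deriv_of_isOpen hI).1 hG
  obtain ⟨h3, -⟩ := (contDiffOn_infty_iff_deriv_of_isOpen hI).1 h2
  exact ⟨((h1 x hx).differentiableAt (hI.mem_nhds hx)).hasDerivAt,
    ((h3 x hx).differentiableAt (hI.mem_nhds hx)).hasDerivAt⟩

theorem hasDerivAt_exp_mul (c x : ℝ) :
    HasDerivAt (fun x => Real.exp (c * x)) (c * Real.exp (c * x)) x := by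
  simpa using HasDerivAt.exp_mul 1 c x

/-! ### The two kinds of base surfaces -/

section
variable {G : ℝ → ℝ} {U : Set (Fin 4 → ℝ)} {p : Fin 4 → ℝ}

theorem isOpen_image_coord (hU : IsOpen U) : IsOpen ((fun p : Fin 4 → ℝ => p 3) '' U) :=
  isOpenMap_eval 3 U hU

theorem IsSmoothNonvanishing.hasDerivAt (hG : IsSmoothNonvanishing G U) (hU : IsOpen U)
    (hp : p ∈ U) : HasDerivAt G (deriv G (p 3)) (p 3) ∧
      HasDerivAt (deriv G) (deriv (deriv G) (p 3)) (p 3) :=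
  hG.1.hasDerivAt_deriv (isOpen_image_coord hU) ⟨p, hp, rfl⟩

theorem hasDerivAt_one_div {x : ℝ} {G₁ : ℝ} (hx : G x ≠ 0) (h : HasDerivAt G G₁ x) :
    HasDerivAt (fun y => 1 / G y) (-G₁ / G x ^ 2) x := by
  simpa using (hasDerivAt_const x (1 : ℝ)).fun_div h hx

theorem hasDerivAt_neg_div_sq {x : ℝ} {G₂ : ℝ} (hx : G x ≠ 0) (h : HasDerivAt G (deriv G x) x)
    (h2 : HasDerivAt (deriv G) G₂ x) :
    HasDerivAt (fun y => -deriv G y / G y ^ 2)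
      ((2 * deriv G x ^ 2 - G x * G₂) / G x ^ 3) x := by
  refine (h2.fun_neg.fun_div (h.fun_pow 2) (pow_ne_zero 2 hx)).congr_deriv ?_
  push_cast
  field_simp
  ring

/-- The base `G(s₁) ds₀² + G(s₁)⁻¹ ds₁²`. -/
noncomputable def degenerateBaseA (hU : IsOpen U) (hG : IsSmoothNonvanishing G U) :
    DegenerateBase U where
  k p := (G (p 3) : ℝ)
  k₂ _ := 0
  k₃ p := (deriv G (p 3) : ℝ)
  k₂₂ _ := 0
  k₂₃ _ := 0
  k₃₃ p := (deriv (deriv G) (p 3) : ℝ)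
  l p := ((1 / G (p 3) : ℝ) : ℂ)
  l₂ _ := 0
  l₃ p := ((-deriv G (p 3) / G (p 3) ^ 2 : ℝ) : ℂ)
  l₂₂ _ := 0
  l₂₃ _ := 0
  l₃₃ p := (((2 * deriv G (p 3) ^ 2 - G (p 3) * deriv (deriv G) (p 3)) / G (p 3) ^ 3 : ℝ) : ℂ)
  t p := (p 2 : ℝ)
  t₂ _ := 1
  t₃ _ := 0
  t₂₂ _ := 0
  t₂₃ _ := 0
  t₃₃ _ := 0
  grad_k p hp := .of_three (hG.hasDerivAt hU hp).1
  grad_k₂ _ _ := .const 0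
  grad_k₃ p hp := .of_three (hG.hasDerivAt hU hp).2
  grad_l p hp := .of_three (hasDerivAt_one_div (hG.2 p hp) (hG.hasDerivAt hU hp).1)
  grad_l₂ _ _ := .const 0
  grad_l₃ p hp := .of_three
    (hasDerivAt_neg_div_sq (hG.2 p hp) (hG.hasDerivAt hU hp).1 (hG.hasDerivAt hU hp).2)
  grad_t p _ := by simpa using HasTripleGrad.of_two (hasDerivAt_id' (p 2))
  grad_t₂ _ _ := .const 1
  grad_t₃ _ _ := .const 0
  t₂_ne _ _ := one_ne_zero
  k_mul_l p hp := by
    have : (G (p 3) : ℂ) ≠ 0 := Complex.ofReal_ne_zero.2 (hG.2 p hp)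
    push_cast
    field_simp

theorem degenerateBaseA_curvature (hU : IsOpen U) (hG : IsSmoothNonvanishing G U) (hp : p ∈ U) :
    (degenerateBaseA hU hG).curvature p = ((-(1 / 2) * deriv (deriv G) (p 3) : ℝ) : ℂ) := by
  have : (G (p 3) : ℂ) ≠ 0 := Complex.ofReal_ne_zero.2 (hG.2 p hp)
  simp only [DegenerateBase.curvature, degenerateBaseA, diagGaussCurvature]
  push_cast
  field_simp
  ring

/-- The metric has determinant 1 and depends on `s₁` only. The two-jet formula applies directly in
dimension two and gives `-G''/2`, the same value as for the base of the presentation. -/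
theorem gaussCurvature_baseMetricA (hU : IsOpen U) (hG : IsSmoothNonvanishing G U) (hp : p ∈ U) :
    gaussCurvature (baseMetricA G) (baseCoord p) = -(1 / 2) * deriv (deriv G) (p 3) := by
  set I := (fun p : Fin 4 → ℝ => p 3) '' U with hIdef
  have hI : IsOpen I := isOpen_image_coord hU
  have hIG : ∀ x ∈ I, G x ≠ 0 := by
    rintro _ ⟨q, hq, rfl⟩
    exact hG.2 q hq
  have hV : IsOpen {q : Fin 2 → ℝ | q 1 ∈ I} := hI.preimage (continuous_apply 1)
  have hb : baseCoord p 1 = p 3 := rfl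
  have hpI : p 3 ∈ I := ⟨p, hp, rfl⟩
  have h0 := hIG _ hpI
  have hdet : (baseMetricA G (baseCoord p)).det = 1 := by
    simp [baseMetricA, hb, Matrix.det_fin_two, h0]
  let D : Fin 2 → Fin 2 → Fin 2 → (Fin 2 → ℝ) → ℝ := fun i j k q =>
    (![0, !![deriv G (q 1), 0; 0, -deriv G (q 1) / G (q 1) ^ 2]] :
      Fin 2 → Matrix (Fin 2) (Fin 2) ℝ) i j k
  let T : Fin 2 → Fin 2 → Fin 2 → Fin 2 → ℝ := fun i j k l =>
    (![0, ![0, !![deriv (deriv G) (p 3), 0;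
      0, (2 * deriv G (p 3) ^ 2 - G (p 3) * deriv (deriv G) (p 3)) / G (p 3) ^ 3]]] :
      Fin 2 → Fin 2 → Matrix (Fin 2) (Fin 2) ℝ) i j k l
  have hg : ∀ q ∈ {q : Fin 2 → ℝ | q 1 ∈ I}, ∀ i j k,
      HasDerivAt (fun t => baseMetricA G (Function.update q i t) j k) (D i j k q) (q i) := by
    intro q hq i j k
    have h1 := (hG.1.hasDerivAt_deriv hI hq).1
    have h2 := hasDerivAt_one_div (hIG _ hq) h1
    fin_cases i <;> fin_cases j <;> fin_cases k <;>
      first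
        | simpa [baseMetricA, D] using hasDerivAt_const _ _
        | simpa [baseMetricA, D] using h1
        | simpa [baseMetricA, D] using h2
  have hdg : ∀ l i j k, HasDerivAt (fun t => D i j k (Function.update (baseCoord p) l t))
      (T l i j k) (baseCoord p l) := by
    intro l i j k
    have h1 := (hG.1.hasDerivAt_deriv hI hpI).2
    have h2 := hasDerivAt_neg_div_sq h0 (hG.1.hasDerivAt_deriv hI hpI).1 h1
    fin_cases l <;> fin_cases i <;> fin_cases j <;> fin_cases k <;>
      first
        | simpa [T, D] using hasDerivAt_const _ _
        | simpa [T, D, hb] using h1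
        | simpa [T, D, hb] using h2
  have hinv : (baseMetricA G (baseCoord p))⁻¹ = !![1 / G (p 3), 0; 0, G (p 3)] := by
    refine Matrix.inv_eq_right_inv ?_
    ext i j
    fin_cases i <;> fin_cases j <;> simp [baseMetricA, hb, h0]
  rw [gaussCurvature, hdet, div_one, riemannForm_eq_jetCurvature hV (p := baseCoord p) hpI
    (by rw [hdet]; exact one_ne_zero) hg hdg, hinv, jetCurvature_eq_sum]
  · simp [Fin.sum_univ_two, jetCurvatureCoeff, D, T, hb]
    field_simp
    ring
  · exact Matrix.IsSymm.ext fun i j => by fin_cases i <;> fin_cases j <;> rfl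
  · intro i j k
    fin_cases i <;> fin_cases j <;> fin_cases k <;> rfl
  · intro i j k l
    fin_cases i <;> fin_cases j <;> rfl

/-- The base `exp (-c s₀) G(s₁) (ds₀² + ds₁²)`. -/
noncomputable def degenerateBaseB {c : ℝ} (hc : c ≠ 0) (hU : IsOpen U)
    (hG : IsSmoothNonvanishing G U) : DegenerateBase U where
  k p := (Real.exp (-c * p 2) : ℝ) * (G (p 3) : ℝ)
  k₂ p := (-c * Real.exp (-c * p 2) : ℝ) * (G (p 3) : ℝ)
  k₃ p := (Real.exp (-c * p 2) : ℝ) * (deriv G (p 3) : ℝ)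
  k₂₂ p := (-c * (-c * Real.exp (-c * p 2)) : ℝ) * (G (p 3) : ℝ)
  k₂₃ p := (-c * Real.exp (-c * p 2) : ℝ) * (deriv G (p 3) : ℝ)
  k₃₃ p := (Real.exp (-c * p 2) : ℝ) * (deriv (deriv G) (p 3) : ℝ)
  l p := (Real.exp (-c * p 2) : ℝ) * (G (p 3) : ℝ)
  l₂ p := (-c * Real.exp (-c * p 2) : ℝ) * (G (p 3) : ℝ)
  l₃ p := (Real.exp (-c * p 2) : ℝ) * (deriv G (p 3) : ℝ)
  l₂₂ p := (-c * (-c * Real.exp (-c * p 2)) : ℝ) * (G (p 3) : ℝ)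
  l₂₃ p := (-c * Real.exp (-c * p 2) : ℝ) * (deriv G (p 3) : ℝ)
  l₃₃ p := (Real.exp (-c * p 2) : ℝ) * (deriv (deriv G) (p 3) : ℝ)
  t p := (-(1 / c) * Real.exp (-c * p 2) : ℝ) * (G (p 3) : ℝ)
  t₂ p := (Real.exp (-c * p 2) : ℝ) * (G (p 3) : ℝ)
  t₃ p := (-(1 / c) * Real.exp (-c * p 2) : ℝ) * (deriv G (p 3) : ℝ)
  t₂₂ p := (-c * Real.exp (-c * p 2) : ℝ) * (G (p 3) : ℝ)
  t₂₃ p := (Real.exp (-c * p 2) : ℝ) * (deriv G (p 3) : ℝ)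
  t₃₃ p := (-(1 / c) * Real.exp (-c * p 2) : ℝ) * (deriv (deriv G) (p 3) : ℝ)
  grad_k p hp := ((HasTripleGrad.of_two (hasDerivAt_exp_mul (-c) (p 2))).mul
    (.of_three (hG.hasDerivAt hU hp).1)).congr (by simp) (by simp) (by simp)
  grad_k₂ p hp := ((HasTripleGrad.of_two (HasDerivAt.exp_mul (-c) (-c) (p 2))).mul
    (.of_three (hG.hasDerivAt hU hp).1)).congr (by simp) (by simp) (by simp)
  grad_k₃ p hp := ((HasTripleGrad.of_two (hasDerivAt_exp_mul (-c) (p 2))).mul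
    (.of_three (hG.hasDerivAt hU hp).2)).congr (by simp) (by simp) (by simp)
  grad_l p hp := ((HasTripleGrad.of_two (hasDerivAt_exp_mul (-c) (p 2))).mul
    (.of_three (hG.hasDerivAt hU hp).1)).congr (by simp) (by simp) (by simp)
  grad_l₂ p hp := ((HasTripleGrad.of_two (HasDerivAt.exp_mul (-c) (-c) (p 2))).mul
    (.of_three (hG.hasDerivAt hU hp).1)).congr (by simp) (by simp) (by simp)
  grad_l₃ p hp := ((HasTripleGrad.of_two (hasDerivAt_exp_mul (-c) (p 2))).mul
    (.of_three (hG.hasDerivAt hU hp).2)).congr (by simp) (by simp) (by simp)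
  grad_t p hp := ((HasTripleGrad.of_two (HasDerivAt.exp_mul (-(1 / c)) (-c) (p 2))).mul
    (.of_three (hG.hasDerivAt hU hp).1)).congr (by simp) (by simp [hc]) (by simp)
  grad_t₂ p hp := ((HasTripleGrad.of_two (hasDerivAt_exp_mul (-c) (p 2))).mul
    (.of_three (hG.hasDerivAt hU hp).1)).congr (by simp) (by simp) (by simp)
  grad_t₃ p hp := ((HasTripleGrad.of_two (HasDerivAt.exp_mul (-(1 / c)) (-c) (p 2))).mul
    (.of_three (hG.hasDerivAt hU hp).2)).congr (by simp) (by simp [hc]) (by simp)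
  t₂_ne p hp := mul_ne_zero (Complex.ofReal_ne_zero.2 (Real.exp_ne_zero _))
    (Complex.ofReal_ne_zero.2 (hG.2 p hp))
  k_mul_l _ _ := (sq _).symm

end

/-! ### The metrics of degenerate type in normal form -/

theorem degeneratePresentation {S : Set ℝ} {U : Set (Fin 4 → ℝ)} {P : DegenerateProfile S}
    {B : DegenerateBase U} {ρ F : ℝ → ℝ} {t : (Fin 2 → ℝ) → ℝ} {h : FormField 2}
    (hmem : ∀ p ∈ U, p 0 ∈ S) (hρ : ∀ p ∈ U, P.ρ (p 0) = ρ (p 0))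
    (hρ₁ : ∀ p ∈ U, P.ρ₁ (p 0) = deriv ρ (p 0)) (hE : ∀ p ∈ U, P.E (p 0) = ρ (p 0) * F (p 0) ^ 2)
    (hh : ∀ p ∈ U, (h (baseCoord p)).map Complex.ofReal = !![B.k p, 0; 0, B.l p])
    (ht : ∀ p ∈ U, (t (baseCoord p) : ℂ) = B.t p)
    (ht₂ : ∀ p ∈ U, (coordDeriv 0 t (baseCoord p) : ℂ) = B.t₂ p) :
    DegeneratePresentation P B (degenerateMetric ρ F t h) (degenerateForm ρ t) where
  mem := hmem
  metric_eq p hp := by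
    have hρ0 := P.ρ_ne _ (hmem p hp)
    have hρ₁0 := P.ρ₁_ne _ (hmem p hp)
    -- Both sides are determined by `E f = ρ'²` with `E = ρ F²`.
    have hf : 1 / ρ (p 0) * (deriv ρ (p 0) / F (p 0)) ^ 2 = P.f (p 0) := by
      have h1 := P.E_mul_f _ (hmem p hp)
      have hE0 : P.E (p 0) ≠ 0 := left_ne_zero_of_mul (h1 ▸ pow_ne_zero 2 hρ₁0)
      rw [← hρ₁ p hp, ← hρ p hp]
      rw [hE p hp, ← hρ p hp] at h1 hE0
      have hF : F (p 0) ≠ 0 := fun h0 => hE0 (by rw [h0]; ring)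
      field_simp
      linear_combination -h1
    have h' := fun i j => congrFun (congrFun (hh p hp) i) j
    have h00 := h' 0 0
    have h01 := h' 0 1
    have h10 := h' 1 0
    have h11 := h' 1 1
    simp at h00 h01 h10 h11
    rw [degenerateMetric, hf, ← hE p hp, ← hρ p hp]
    ext i j
    fin_cases i <;> fin_cases j <;>
      simp [formSq, thetaForm, baseCoframe, h00, h01, h10, h11, ht p hp] <;>
      (first | done | ring1 | (ring_nf; simp))
  form_eq p hp := by
    simp only [degenerateForm, ← hρ₁ p hp, ← hρ p hp]
    ext i j
    fin_cases i <;> fin_cases j <;>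
      simp [formWedge, thetaForm, ht p hp, ht₂ p hp]

theorem degeneratePresentationA {S : Set ℝ} {U : Set (Fin 4 → ℝ)} {P : DegenerateProfile S}
    {ρ F G : ℝ → ℝ} (hU : IsOpen U) (hG : IsSmoothNonvanishing G U)
    (hmem : ∀ p ∈ U, p 0 ∈ S) (hρ : ∀ p ∈ U, P.ρ (p 0) = ρ (p 0))
    (hρ₁ : ∀ p ∈ U, P.ρ₁ (p 0) = deriv ρ (p 0))
    (hE : ∀ p ∈ U, P.E (p 0) = ρ (p 0) * F (p 0) ^ 2) :
    DegeneratePresentation P (degenerateBaseA hU hG)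
      (degenerateMetric ρ F (fun s => s 0) (baseMetricA G)) (degenerateForm ρ (fun s => s 0)) := by
  refine degeneratePresentation hmem hρ hρ₁ hE (fun p _ => ?_) (fun _ _ => rfl) fun p _ => ?_
  · ext i j
    fin_cases i <;> fin_cases j <;> simp [baseMetricA, degenerateBaseA, baseCoord]
  · simp [coordDeriv, degenerateBaseA]

theorem degeneratePresentationB {S : Set ℝ} {U : Set (Fin 4 → ℝ)} {P : DegenerateProfile S}
    {ρ F G : ℝ → ℝ} {c : ℝ} (hc : c ≠ 0) (hU : IsOpen U) (hG : IsSmoothNonvanishing G U)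
    (hmem : ∀ p ∈ U, p 0 ∈ S) (hρ : ∀ p ∈ U, P.ρ (p 0) = ρ (p 0))
    (hρ₁ : ∀ p ∈ U, P.ρ₁ (p 0) = deriv ρ (p 0))
    (hE : ∀ p ∈ U, P.E (p 0) = ρ (p 0) * F (p 0) ^ 2) :
    DegeneratePresentation P (degenerateBaseB hc hU hG)
      (degenerateMetric ρ F (fun s => -(1 / c) * Real.exp (-c * s 0) * G (s 1)) (baseMetricB c G))
      (degenerateForm ρ (fun s => -(1 / c) * Real.exp (-c * s 0) * G (s 1))) := by
  refine degeneratePresentation hmem hρ hρ₁ hE (fun p _ => ?_) (fun p _ => ?_) fun p _ => ?_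
  · ext i j
    fin_cases i <;> fin_cases j <;> simp [baseMetricB, degenerateBaseB, baseCoord]
  · simp [degenerateBaseB, baseCoord]
  · have h1 : coordDeriv 0 (fun s : Fin 2 → ℝ => -(1 / c) * Real.exp (-c * s 0) * G (s 1))
        (baseCoord p) = Real.exp (-c * p 2) * G (p 3) := by
      have := ((HasDerivAt.exp_mul (-(1 / c)) (-c) (p 2)).mul_const (G (p 3))).deriv
      simp only [coordDeriv, Function.update_self, Function.update_of_ne (one_ne_zero (α := Fin 2)),
        baseCoord, Matrix.cons_val_zero, Matrix.cons_val_one]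
      rw [this]
      field_simp
    rw [h1]
    exact Complex.ofReal_mul ..

/-- If `f` is a polynomial in `ρ` without constant term of degree two, then the holomorphic
sectional curvature is constant precisely for a certain constant curvature of the base. -/
theorem DegeneratePresentation.hasConstantHSC_iff_baseA {S : Set ℝ} {U : Set (Fin 4 → ℝ)}
    {P : DegenerateProfile S} {G : ℝ → ℝ} {g ω : FormField 4} {hU : IsOpen U}
    {hG : IsSmoothNonvanishing G U} (F : DegeneratePresentation P (degenerateBaseA hU hG) g ω)
    {a b : ℝ} (hf : ∀ x ∈ S, P.f x = a * P.ρ x ^ 2 + b * P.ρ x)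
    (hf₁ : ∀ x ∈ S, P.f₁ x = (2 * a * P.ρ x + b) * P.ρ₁ x)
    (hf₂ : ∀ x ∈ S, P.f₂ x = 2 * a * P.ρ₁ x ^ 2 + (2 * a * P.ρ x + b) * P.ρ₂ x) :
    HasConstantHSC g ω U ↔ ∀ p ∈ U, gaussCurvature (baseMetricA G) (baseCoord p) = -b := by
  constructor
  · intro h p hp
    obtain ⟨κ, h1, h2⟩ := F.deriv_eq_of_hasConstantHSC hU
      (fun p x => by simp [DegenerateBase.curvature, degenerateBaseA]) h
    have hρ := P.ρ_ne _ (F.mem p hp)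
    have hρ₁ := P.ρ₁_ne _ (F.mem p hp)
    have e2 := h2 p hp
    rw [hf _ (F.mem p hp), hf₁ _ (F.mem p hp)] at e2
    -- With `f/ρ = a ρ + b` the derivative along `x₀` reads `(a + κ) ρ' = 0`.
    have hκ : κ = -a := by
      have e : ((2 * a * P.ρ (p 0) + b) * P.ρ₁ (p 0) * P.ρ (p 0)
          - (a * P.ρ (p 0) ^ 2 + b * P.ρ (p 0)) * P.ρ₁ (p 0)) / P.ρ (p 0) ^ 2
          = a * P.ρ₁ (p 0) := by
        field_simp
        ring
      exact mul_right_cancel₀ hρ₁ (by linear_combination e2 - e)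
    have e1 := h1 p hp
    rw [degenerateBaseA_curvature hU hG hp, hf _ (F.mem p hp), hκ] at e1
    rw [gaussCurvature_baseMetricA hU hG hp]
    have e3 : -(1 / 2) * deriv (deriv G) (p 3)
        = -((a * P.ρ (p 0) ^ 2 + b * P.ρ (p 0)) / P.ρ (p 0) + -a * P.ρ (p 0)) := by
      exact_mod_cast e1
    rw [e3]
    field_simp
    ring
  · intro h
    refine (hasConstantHSC_iff_defect (fun _ => hU) (fun _ hp => hp)
      (fun p hp => F.frameJet hp)).2 ⟨-a, fun p hp x _ => ?_⟩
    have hS := F.mem p hp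
    have hG2 := h p hp
    rw [gaussCurvature_baseMetricA hU hG hp] at hG2
    have hc := shear_curvature_constant (ρ := P.ρ (p 0)) (ρ₁ := P.ρ₁ (p 0)) (ρ₂ := P.ρ₂ (p 0))
      (E := P.E (p 0)) (E₁ := P.E₁ (p 0)) (E₂ := P.E₂ (p 0)) (f := P.f (p 0)) (f₁ := P.f₁ (p 0))
      (f₂ := P.f₂ (p 0)) (k := (G (p 3) : ℝ)) (k₃ := (deriv G (p 3) : ℝ))
      (k₃₃ := (deriv (deriv G) (p 3) : ℝ))
      (a := a) (b := b) (x := x) (Complex.ofReal_ne_zero.2 (P.ρ_ne _ hS))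
      (Complex.ofReal_ne_zero.2 (P.ρ₁_ne _ hS)) (F.f_ne hp)
      (Complex.ofReal_ne_zero.2 (hG.2 p hp)) (by exact_mod_cast P.E_mul_f _ hS)
      (by exact_mod_cast P.E₁_mul_f _ hS) (by exact_mod_cast hf _ hS) (by exact_mod_cast hf₁ _ hS)
      (by exact_mod_cast hf₂ _ hS)
      -- The Gauss curvature is `-G''/2`, so the value `-b` means `G'' = 2b`.
      (by exact_mod_cast (by linarith : deriv (deriv G) (p 3) = 2 * b)) rfl
    refine sub_eq_zero.2 ?_
    simp only [FrameJet.curv, frameJet, degenerateBaseA, sub_self]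
    push_cast
    exact hc

/-! ### Profiles of the degenerate families -/

/-- The profile `ρ = 1 / x`, `E = e exp (-k x) / x²`. -/
noncomputable def invProfile (k e : ℝ) (he : e ≠ 0) : DegenerateProfile {x | x ≠ 0} where
  ρ x := 1 / x
  ρ₁ x := -(1 / x ^ 2)
  ρ₂ x := 2 / x ^ 3
  E x := e * Real.exp (-k * x) / x ^ 2
  E₁ x := e * Real.exp (-k * x) * (-k / x ^ 2 - 2 / x ^ 3)
  E₂ x := e * Real.exp (-k * x) * (k ^ 2 / x ^ 2 + 4 * k / x ^ 3 + 6 / x ^ 4)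
  f x := 1 / e * Real.exp (k * x) / x ^ 2
  f₁ x := 1 / e * Real.exp (k * x) * (k / x ^ 2 - 2 / x ^ 3)
  f₂ x := 1 / e * Real.exp (k * x) * (k ^ 2 / x ^ 2 - 4 * k / x ^ 3 + 6 / x ^ 4)
  deriv_ρ x hx := by simpa using hasDerivAt_inv hx
  deriv_ρ₁ x hx := by
    refine ((hasDerivAt_const x (1 : ℝ)).fun_div (hasDerivAt_pow 2 x)
      (pow_ne_zero 2 hx)).fun_neg.congr_deriv ?_
    have hx : x ≠ 0 := hx
    push_cast
    field_simp
    ring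
  deriv_E x hx := by
    refine ((HasDerivAt.exp_mul e (-k) x).fun_div (hasDerivAt_pow 2 x)
      (pow_ne_zero 2 hx)).congr_deriv ?_
    have hx : x ≠ 0 := hx
    push_cast
    field_simp
  deriv_E₁ x hx := by
    refine ((HasDerivAt.exp_mul e (-k) x).fun_mul (((hasDerivAt_const x (-k)).fun_div
      (hasDerivAt_pow 2 x) (pow_ne_zero 2 hx)).fun_sub ((hasDerivAt_const x (2 : ℝ)).fun_div
      (hasDerivAt_pow 3 x) (pow_ne_zero 3 hx)))).congr_deriv ?_
    have hx : x ≠ 0 := hx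
    push_cast
    field_simp
    ring
  deriv_f x hx := by
    refine ((HasDerivAt.exp_mul (1 / e) k x).fun_div (hasDerivAt_pow 2 x)
      (pow_ne_zero 2 hx)).congr_deriv ?_
    have hx : x ≠ 0 := hx
    push_cast
    field_simp
  deriv_f₁ x hx := by
    refine ((HasDerivAt.exp_mul (1 / e) k x).fun_mul (((hasDerivAt_const x k).fun_div
      (hasDerivAt_pow 2 x) (pow_ne_zero 2 hx)).fun_sub ((hasDerivAt_const x (2 : ℝ)).fun_div
      (hasDerivAt_pow 3 x) (pow_ne_zero 3 hx)))).congr_deriv ?_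
    have hx : x ≠ 0 := hx
    push_cast
    field_simp
    ring
  ρ_ne x hx := one_div_ne_zero hx
  ρ₁_ne x hx := neg_ne_zero.2 (one_div_ne_zero (pow_ne_zero 2 hx))
  E_mul_f x hx := by
    have hx : x ≠ 0 := hx
    have := Real.exp_ne_zero (k * x)
    rw [neg_mul, Real.exp_neg]
    field_simp
  E₁_mul_f x hx := by
    have hx : x ≠ 0 := hx
    have := Real.exp_ne_zero (k * x)
    rw [neg_mul, Real.exp_neg]
    field_simp
    ring

/-- The profile `ρ = c exp ((β - 1) x)`, `E = c d² exp (-3 x)`. -/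
noncomputable def expDegenerateProfile (β c d : ℝ) (hβ : β ≠ 1) (hc : c ≠ 0) (hd : d ≠ 0) :
    DegenerateProfile Set.univ where
  ρ x := c * Real.exp ((β - 1) * x)
  ρ₁ x := (β - 1) * (c * Real.exp ((β - 1) * x))
  ρ₂ x := (β - 1) * ((β - 1) * (c * Real.exp ((β - 1) * x)))
  -- The exponent of `ρ F²` is `(β - 1) - (β + 2) = -3` for every `β`.
  E x := c * d ^ 2 * Real.exp (-3 * x)
  E₁ x := -3 * (c * d ^ 2 * Real.exp (-3 * x))
  E₂ x := -3 * (-3 * (c * d ^ 2 * Real.exp (-3 * x)))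
  f x := (β - 1) ^ 2 * (c / d ^ 2) * Real.exp ((2 * β + 1) * x)
  f₁ x := (2 * β + 1) * ((β - 1) ^ 2 * (c / d ^ 2) * Real.exp ((2 * β + 1) * x))
  f₂ x := (2 * β + 1) * ((2 * β + 1) * ((β - 1) ^ 2 * (c / d ^ 2) * Real.exp ((2 * β + 1) * x)))
  deriv_ρ x _ := .exp_mul ..
  deriv_ρ₁ x _ := (HasDerivAt.exp_mul ..).const_mul _
  deriv_E x _ := .exp_mul ..
  deriv_E₁ x _ := (HasDerivAt.exp_mul ..).const_mul _
  deriv_f x _ := .exp_mul ..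
  deriv_f₁ x _ := (HasDerivAt.exp_mul ..).const_mul _
  ρ_ne x _ := mul_ne_zero hc (Real.exp_ne_zero _)
  ρ₁_ne x _ := mul_ne_zero (sub_ne_zero.2 hβ) (mul_ne_zero hc (Real.exp_ne_zero _))
  E_mul_f x _ := by
    have := Real.exp_ne_zero (3 * x)
    rw [show (2 * β + 1) * x = 3 * x + ((β - 1) * x + (β - 1) * x) by ring, Real.exp_add,
      Real.exp_add, show -3 * x = -(3 * x) by ring, Real.exp_neg]
    field_simp
  E₁_mul_f x _ := by
    have := Real.exp_ne_zero (3 * x)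
    rw [show (2 * β + 1) * x = 3 * x + ((β - 1) * x + (β - 1) * x) by ring, Real.exp_add,
      Real.exp_add, show -3 * x = -(3 * x) by ring, Real.exp_neg]
    field_simp
    ring

/-! ### The families D1, D2a, D2b and D3 -/

section
variable {U : Set (Fin 4 → ℝ)} {c₁ d₁ β : ℝ} {G : ℝ → ℝ}

/-- By the intermediate value theorem a function without zeros keeps its sign on a preconnected set.
This turns `|x₀|` into `σ x₀` in D1 and D3. -/
theorem IsPreconnected.exists_sign {p : (Fin 4 → ℝ) → ℝ} (hU : IsPreconnected U)
    (hp : Continuous p) (h : ∀ q ∈ U, p q ≠ 0) : ∃ σ : ℝ, σ ≠ 0 ∧ ∀ q ∈ U, |p q| = σ * p q := by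
  by_cases h1 : ∀ q ∈ U, 0 < p q
  · exact ⟨1, one_ne_zero, fun q hq => by rw [one_mul, abs_of_pos (h1 q hq)]⟩
  · push Not at h1
    obtain ⟨q, hq, hq0⟩ := h1
    refine ⟨-1, by norm_num, fun r hr => ?_⟩
    rcases (h r hr).lt_or_gt with h2 | h2
    · rw [abs_of_neg h2, neg_one_mul]
    · obtain ⟨s, hs, hs0⟩ := hU.intermediate_value hq hr hp.continuousOn ⟨hq0, h2.le⟩
      exact absurd hs0 (h s hs)

theorem deriv_one_div {x : ℝ} : deriv (fun x : ℝ => 1 / x) x = -(1 / x ^ 2) := by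
  simp

theorem degenerate_inv_hasConstantHSC_iff (hc : c₁ ≠ 0) (hU : IsOpen U) (hc' : IsConnected U)
    (h0 : ∀ p ∈ U, p 0 ≠ 0) (hG : IsSmoothNonvanishing G U) :
    HasConstantHSC
        (degenerateMetric (fun x => 1 / x) (fun x => c₁ / Real.sqrt |x|)
          (fun s => s 0) (baseMetricA G))
        (degenerateForm (fun x => 1 / x) (fun s => s 0)) U ↔
      ∀ p ∈ U, gaussCurvature (baseMetricA G) (baseCoord p) = 0 := by
  obtain ⟨σ, hσ, hs⟩ := hc'.isPreconnected.exists_sign (continuous_apply 0) h0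
  -- Since `|x₀| = σ x₀`, the product `ρ F²` equals `(c₁²/σ)/x₀²`.
  have he : c₁ ^ 2 / σ ≠ 0 := div_ne_zero (pow_ne_zero 2 hc) hσ
  have F : DegeneratePresentation (invProfile 0 _ he) (degenerateBaseA hU hG)
      (degenerateMetric (fun x => 1 / x) (fun x => c₁ / Real.sqrt |x|)
        (fun s => s 0) (baseMetricA G)) (degenerateForm (fun x => 1 / x) (fun s => s 0)) := by
    refine degeneratePresentationA hU hG h0 (fun _ _ => rfl) (fun _ _ => deriv_one_div.symm)
      fun p hp => ?_
    have := h0 p hp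
    have hsq : Real.sqrt |p 0| ^ 2 = σ * p 0 := by rw [Real.sq_sqrt (abs_nonneg _), hs p hp]
    simp only [invProfile, div_pow, hsq, neg_zero, zero_mul, Real.exp_zero]
    field_simp
  -- Here `f = (σ/c₁²) ρ²`, so `b = 0` and the base must be flat, while the holomorphic sectional
  -- curvature `-σ/c₁²` is not zero.
  refine (F.hasConstantHSC_iff_baseA (a := σ / c₁ ^ 2) (b := 0) ?_ ?_ ?_).trans (by simp) <;>
  · intro x hx
    have hx : x ≠ 0 := hx
    simp only [invProfile, zero_mul, Real.exp_zero]
    field_simp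
    try ring

/-- Up to a factor `f/ρ` is `exp (3x)/x`, which is not an affine function of `ρ = 1/x`. The shape of
the base plays no role beyond its independence of `x₀`. -/
theorem degenerate_inv_exp_not_hasConstantHSC (hc : c₁ ≠ 0) (hU : IsOpen U) (hc' : IsConnected U)
    (h0 : ∀ p ∈ U, p 0 ≠ 0) (hG : IsSmoothNonvanishing G U) :
    ¬ HasConstantHSC
      (degenerateMetric (fun x => 1 / x) (fun x => c₁ * Real.exp (-(3 / 2) * x) / Real.sqrt |x|)
        (fun s => -(1 / 3) * Real.exp (-3 * s 0) * G (s 1)) (baseMetricB 3 G))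
      (degenerateForm (fun x => 1 / x)
        (fun s => -(1 / 3) * Real.exp (-3 * s 0) * G (s 1))) U := by
  obtain ⟨σ, hσ, hs⟩ := hc'.isPreconnected.exists_sign (continuous_apply 0) h0
  have he : c₁ ^ 2 / σ ≠ 0 := div_ne_zero (pow_ne_zero 2 hc) hσ
  have F : DegeneratePresentation (invProfile 3 _ he)
      (degenerateBaseB (three_ne_zero (α := ℝ)) hU hG)
      (degenerateMetric (fun x => 1 / x) (fun x => c₁ * Real.exp (-(3 / 2) * x) / Real.sqrt |x|)
        (fun s => -(1 / 3) * Real.exp (-3 * s 0) * G (s 1)) (baseMetricB 3 G))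
      (degenerateForm (fun x => 1 / x) (fun s => -(1 / 3) * Real.exp (-3 * s 0) * G (s 1))) := by
    refine degeneratePresentationB three_ne_zero hU hG h0 (fun _ _ => rfl)
      (fun _ _ => deriv_one_div.symm) fun p hp => ?_
    have := h0 p hp
    have h1 : Real.exp (-3 * p 0) = Real.exp (-(3 / 2) * p 0) ^ 2 := by
      rw [← Real.exp_nat_mul]; congr 1; push_cast; ring
    have hsq : Real.sqrt |p 0| ^ 2 = σ * p 0 := by rw [Real.sq_sqrt (abs_nonneg _), hs p hp]
    simp only [invProfile, div_pow, mul_pow, hsq, h1]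
    field_simp
  intro h
  obtain ⟨κ, -, h2⟩ := F.deriv_eq_of_hasConstantHSC hU
    (fun p x => by simp [DegenerateBase.curvature, degenerateBaseB]) h
  obtain ⟨p, hp⟩ := hc'.nonempty
  have h3 : ∀ q ∈ U, (3 * q 0 - 1) * Real.exp (3 * q 0) = κ * (c₁ ^ 2 / σ) := fun q hq => by
    have hq0 := h0 q hq
    have := h2 q hq
    simp only [invProfile] at this
    field_simp at this
    field_simp
    linear_combination this
  -- The function `(3x - 1) exp (3x)` would be constant along `x₀`, but its derivative `9x exp (3x)`
  -- has no zero except 0.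
  have h4 := eq_zero_of_coord_const (ψ := fun x => (3 * x - 1) * Real.exp (3 * x)) hU hp h3
    ((((hasDerivAt_id' (p 0)).const_mul 3).sub_const 1).fun_mul (hasDerivAt_exp_mul 3 (p 0)))
  have h5 : 9 * p 0 * Real.exp (3 * p 0) = 0 := by linear_combination h4
  simp [h0 p hp] at h5

/-- This is the exponential profile with `β = -2`, for which `f = (9/d₁²) ρ`; hence `a = 0` and `b =
9/d₁²`. -/
theorem degenerate_exp_hasConstantHSC_iff (hc : c₁ ≠ 0) (hd : d₁ ≠ 0) (hU : IsOpen U)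
    (hG : IsSmoothNonvanishing G U) :
    HasConstantHSC
        (degenerateMetric (fun x => c₁ * Real.exp (-3 * x)) (fun _ => d₁)
          (fun s => s 0) (baseMetricA G))
        (degenerateForm (fun x => c₁ * Real.exp (-3 * x)) (fun s => s 0)) U ↔
      ∀ p ∈ U, gaussCurvature (baseMetricA G) (baseCoord p) = -(9 / d₁ ^ 2) := by
  have F : DegeneratePresentation (expDegenerateProfile (-2) c₁ d₁ (by norm_num) hc hd)
      (degenerateBaseA hU hG)
      (degenerateMetric (fun x => c₁ * Real.exp (-3 * x)) (fun _ => d₁) (fun s => s 0)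
        (baseMetricA G)) (degenerateForm (fun x => c₁ * Real.exp (-3 * x)) (fun s => s 0)) := by
    refine degeneratePresentationA hU hG (fun _ _ => trivial) (fun p _ => ?_) (fun p _ => ?_)
      fun p _ => ?_
    · norm_num [expDegenerateProfile]
    · rw [(HasDerivAt.exp_mul c₁ (-3) (p 0)).deriv]
      norm_num [expDegenerateProfile]
    · simp only [expDegenerateProfile]
      ring
  refine F.hasConstantHSC_iff_baseA (a := 0) ?_ ?_ ?_ <;>
  · intro x _
    simp only [expDegenerateProfile]
    norm_num
    try ring

/-- Up to a factor `f/ρ` is `exp ((β+2)x)`. It is not constant as `β ≠ -2`, and not affine in `exp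
((β-1)x)` because the exponents differ by 3. -/
theorem degenerate_exp_not_hasConstantHSC (hβ : β ≠ 1) (hβ' : β ≠ -2) (hc : c₁ ≠ 0) (hd : d₁ ≠ 0)
    (hU : IsOpen U) (hne : U.Nonempty) (hG : IsSmoothNonvanishing G U) :
    ¬ HasConstantHSC
      (degenerateMetric (fun x => c₁ * Real.exp ((β - 1) * x))
        (fun x => d₁ * Real.exp (-(1 / 2) * (β + 2) * x))
        (fun s => -(1 / (β + 2)) * Real.exp (-(β + 2) * s 0) * G (s 1)) (baseMetricB (β + 2) G))
      (degenerateForm (fun x => c₁ * Real.exp ((β - 1) * x))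
        (fun s => -(1 / (β + 2)) * Real.exp (-(β + 2) * s 0) * G (s 1))) U := by
  have hk : β + 2 ≠ 0 := fun h => hβ' (by linear_combination h)
  have hb : β - 1 ≠ 0 := sub_ne_zero.2 hβ
  have F : DegeneratePresentation (expDegenerateProfile β c₁ d₁ hβ hc hd)
      (degenerateBaseB hk hU hG)
      (degenerateMetric (fun x => c₁ * Real.exp ((β - 1) * x))
        (fun x => d₁ * Real.exp (-(1 / 2) * (β + 2) * x))
        (fun s => -(1 / (β + 2)) * Real.exp (-(β + 2) * s 0) * G (s 1)) (baseMetricB (β + 2) G))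
      (degenerateForm (fun x => c₁ * Real.exp ((β - 1) * x))
        (fun s => -(1 / (β + 2)) * Real.exp (-(β + 2) * s 0) * G (s 1))) := by
    refine degeneratePresentationB hk hU hG (fun _ _ => trivial) (fun p _ => rfl)
      (fun p _ => (HasDerivAt.exp_mul c₁ (β - 1) (p 0)).deriv.symm) fun p _ => ?_
    have h1 : Real.exp (-3 * p 0)
        = Real.exp ((β - 1) * p 0) * Real.exp (-(1 / 2) * (β + 2) * p 0) ^ 2 := by
      rw [← Real.exp_nat_mul, ← Real.exp_add]; congr 1; push_cast; ring
    simp only [expDegenerateProfile, h1]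
    ring
  intro h
  obtain ⟨κ, -, h2⟩ := F.deriv_eq_of_hasConstantHSC hU
    (fun p x => by simp [DegenerateBase.curvature, degenerateBaseB]) h
  obtain ⟨p, hp⟩ := hne
  -- Division of the `x₀`-derivative by `ρ'` leaves the quotient of the two exponentials, `exp
  -- (3x)`, which would have to be constant.
  have h3 : ∀ q ∈ U, (β + 2) * (β - 1) * Real.exp (3 * q 0) = -(κ * c₁ * d₁ ^ 2) := fun q hq => by
    have := h2 q hq
    have hx := Real.exp_ne_zero ((β - 1) * q 0)
    have h1 : Real.exp ((2 * β + 1) * q 0)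
        = Real.exp ((β - 1) * q 0) ^ 2 * Real.exp (3 * q 0) := by
      rw [← Real.exp_nat_mul, ← Real.exp_add]; congr 1; push_cast; ring
    simp only [expDegenerateProfile, h1] at this
    field_simp at this
    rw [mul_comm (q 0) 3] at this
    exact mul_left_cancel₀ (mul_ne_zero hb hx) (by linear_combination this)
  have h4 := eq_zero_of_coord_const (ψ := fun x => (β + 2) * (β - 1) * Real.exp (3 * x)) hU hp h3
    (.exp_mul ..)
  simp [hk, hb] at h4

end

/-! ### The classification -/

theorem mainTheorem1 :
    -- L1
    (∀ (ε c₀ c₁ : ℝ) (U : Set (Fin 4 → ℝ)), (ε = 1 ∨ ε = -1) → c₀ ≠ 0 → c₁ ≠ 0 →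
      IsOpen U → IsConnected U → (∀ p ∈ U, p 0 ≠ p 1) →
      (HasConstantHSC
          (liouvilleMetric ε (fun x => x) (fun x => x) (fun _ => c₀) (fun _ => c₁))
          (liouvilleForm (fun x => x) (fun x => x)) U ↔
        ε = -1 ∧ (c₁ = c₀ ∨ c₁ = -c₀))) ∧
    -- L2
    (∀ (ε β c₀ c₁ d₀ d₁ : ℝ) (U : Set (Fin 4 → ℝ)), (ε = 1 ∨ ε = -1) → β ≠ 1 →
      c₀ ≠ 0 → c₁ ≠ 0 → d₀ ≠ 0 → d₁ ≠ 0 → IsOpen U → IsConnected U →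
      (∀ p ∈ U, c₀ * Real.exp ((β - 1) * p 0) ≠ c₁ * Real.exp ((β - 1) * p 1)) →
      (HasConstantHSC
          (liouvilleMetric ε
            (fun x => c₀ * Real.exp ((β - 1) * x)) (fun x => c₁ * Real.exp ((β - 1) * x))
            (fun x => d₀ * Real.exp (-(1 / 2) * (β + 2) * x))
            (fun x => d₁ * Real.exp (-(1 / 2) * (β + 2) * x)))
          (liouvilleForm
            (fun x => c₀ * Real.exp ((β - 1) * x)) (fun x => c₁ * Real.exp ((β - 1) * x))) U ↔
        (β = -1 / 2 ∧ c₁ = -ε * c₀ * (d₁ ^ 2 / d₀ ^ 2)) ∨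
        (β = -2 ∧ ε = -1 ∧ (d₁ = d₀ ∨ d₁ = -d₀)) ∨
        (β = 0 ∧ ε = -1 ∧ (d₁ / c₁ = d₀ / c₀ ∨ d₁ / c₁ = -(d₀ / c₀))))) ∧
    -- L3
    (∀ (ε c₀ c₁ : ℝ) (U : Set (Fin 4 → ℝ)), (ε = 1 ∨ ε = -1) → c₀ ≠ 0 → c₁ ≠ 0 →
      IsOpen U → IsConnected U → (∀ p ∈ U, p 0 ≠ p 1) →
      ¬ HasConstantHSC
          (liouvilleMetric ε (fun x => x) (fun x => x)
            (fun x => c₀ * Real.exp (-(3 / 2) * x)) (fun x => c₁ * Real.exp (-(3 / 2) * x)))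
          (liouvilleForm (fun x => x) (fun x => x)) U) ∧
    -- L4
    (∀ (ε β c₀ c₁ : ℝ) (U : Set (Fin 4 → ℝ)), (ε = 1 ∨ ε = -1) → c₀ ≠ 0 → c₁ ≠ 0 →
      IsOpen U → IsConnected U →
      (∀ p ∈ U, Real.cos (p 0) ≠ 0 ∧ Real.cos (p 1) ≠ 0 ∧ Real.tan (p 0) ≠ Real.tan (p 1)) →
      ¬ HasConstantHSC
          (liouvilleMetric ε (fun x => -Real.tan x) (fun x => -Real.tan x)
            (fun x => c₀ * Real.exp (-(3 / 2) * β * x) / Real.sqrt |Real.cos x|)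
            (fun x => c₁ * Real.exp (-(3 / 2) * β * x) / Real.sqrt |Real.cos x|))
          (liouvilleForm (fun x => -Real.tan x) (fun x => -Real.tan x)) U) ∧
    -- C1
    (∀ (ς : ℂ) (U : Set (Fin 4 → ℝ)), ς ≠ 0 → IsOpen U → IsConnected U →
      (∀ p ∈ U, (zCoord p).im ≠ 0) →
      (HasConstantHSC (complexTypeMetric (fun z => z) (fun _ => ς))
          (complexTypeForm (fun z => z)) U ↔
        ς.re = 0 ∨ ς.im = 0)) ∧
    -- C2
    (∀ (β : ℝ) (ς : ℂ) (U : Set (Fin 4 → ℝ)), β ≠ 1 → ς ≠ 0 → IsOpen U → IsConnected U →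
      (∀ p ∈ U, (Complex.exp ((β - 1) * zCoord p)).im ≠ 0) →
      (HasConstantHSC
          (complexTypeMetric (fun z => Complex.exp ((β - 1) * z))
            (fun z => ς * Complex.exp (-(1 / 2) * (β + 2) * z)))
          (complexTypeForm (fun z => Complex.exp ((β - 1) * z))) U ↔
        (β = -1 / 2 ∨ β = -2 ∨ β = 0) ∧ (ς.re = 0 ∨ ς.im = 0))) ∧
    -- C3
    (∀ (ς : ℂ) (U : Set (Fin 4 → ℝ)), ς ≠ 0 → IsOpen U → IsConnected U →
      (∀ p ∈ U, (zCoord p).im ≠ 0) →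
      ¬ HasConstantHSC
          (complexTypeMetric (fun z => z) (fun z => ς * Complex.exp (-(3 / 2) * z)))
          (complexTypeForm (fun z => z)) U) ∧
    -- C4; the metric involves only `F²`, so the choice of the square root plays no role
    (∀ (β : ℝ) (ς : ℂ) (U : Set (Fin 4 → ℝ)), ς ≠ 0 → IsOpen U → IsConnected U →
      (∀ p ∈ U, Complex.cos (zCoord p) ≠ 0 ∧ (Complex.tan (zCoord p)).im ≠ 0) →
      ¬ HasConstantHSC
          (complexTypeMetric (fun z => -Complex.tan z)
            (fun z => ς * Complex.exp (-(3 / 2) * β * z) / Complex.cos z ^ (1 / 2 : ℂ)))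
          (complexTypeForm (fun z => -Complex.tan z)) U) ∧
    -- D1
    (∀ (c₁ : ℝ) (G : ℝ → ℝ) (U : Set (Fin 4 → ℝ)), c₁ ≠ 0 → IsOpen U → IsConnected U →
      (∀ p ∈ U, p 0 ≠ 0) → IsSmoothNonvanishing G U →
      (HasConstantHSC
          (degenerateMetric (fun x => 1 / x) (fun x => c₁ / Real.sqrt |x|)
            (fun s => s 0) (baseMetricA G))
          (degenerateForm (fun x => 1 / x) (fun s => s 0)) U ↔
        ∀ p ∈ U, gaussCurvature (baseMetricA G) (baseCoord p) = 0)) ∧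
    -- D2a
    (∀ (c₁ d₁ : ℝ) (G : ℝ → ℝ) (U : Set (Fin 4 → ℝ)), c₁ ≠ 0 → d₁ ≠ 0 →
      IsOpen U → IsConnected U → IsSmoothNonvanishing G U →
      (HasConstantHSC
          (degenerateMetric (fun x => c₁ * Real.exp (-3 * x)) (fun _ => d₁)
            (fun s => s 0) (baseMetricA G))
          (degenerateForm (fun x => c₁ * Real.exp (-3 * x)) (fun s => s 0)) U ↔
        ∀ p ∈ U, gaussCurvature (baseMetricA G) (baseCoord p) = -(9 / d₁ ^ 2))) ∧
    -- D2b
    (∀ (β c₁ d₁ : ℝ) (G : ℝ → ℝ) (U : Set (Fin 4 → ℝ)), β ≠ 1 → β ≠ -2 → c₁ ≠ 0 → d₁ ≠ 0 →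
      IsOpen U → IsConnected U → IsSmoothNonvanishing G U →
      ¬ HasConstantHSC
          (degenerateMetric (fun x => c₁ * Real.exp ((β - 1) * x))
            (fun x => d₁ * Real.exp (-(1 / 2) * (β + 2) * x))
            (fun s => -(1 / (β + 2)) * Real.exp (-(β + 2) * s 0) * G (s 1))
            (baseMetricB (β + 2) G))
          (degenerateForm (fun x => c₁ * Real.exp ((β - 1) * x))
            (fun s => -(1 / (β + 2)) * Real.exp (-(β + 2) * s 0) * G (s 1))) U) ∧
    -- D3
    (∀ (c₁ : ℝ) (G : ℝ → ℝ) (U : Set (Fin 4 → ℝ)), c₁ ≠ 0 → IsOpen U → IsConnected U →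
      (∀ p ∈ U, p 0 ≠ 0) → IsSmoothNonvanishing G U →
      ¬ HasConstantHSC
          (degenerateMetric (fun x => 1 / x)
            (fun x => c₁ * Real.exp (-(3 / 2) * x) / Real.sqrt |x|)
            (fun s => -(1 / 3) * Real.exp (-3 * s 0) * G (s 1)) (baseMetricB 3 G))
          (degenerateForm (fun x => 1 / x)
            (fun s => -(1 / 3) * Real.exp (-3 * s 0) * G (s 1))) U) := by
  refine ⟨?_, ?_, ?_, ?_, ?_, ?_, ?_, ?_, ?_, ?_, ?_, ?_⟩
  · intro _ _ _ _ hε h₀ h₁ hU hc hp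
    exact liouville_linear_hasConstantHSC_iff hε h₀ h₁ hU hc.nonempty hp
  · intro _ _ _ _ _ _ _ hε hβ hc₀ hc₁ hd₀ hd₁ hU hc hp
    exact liouville_exp_hasConstantHSC_iff hε hβ hc₀ hc₁ hd₀ hd₁ hU hc.nonempty hp
  · intro _ _ _ _ hε h₀ h₁ hU hc hp
    exact liouville_linear_exp_not_hasConstantHSC hε h₀ h₁ hU hc.nonempty hp
  · intro _ _ _ _ _ hε h₀ h₁ hU hc hp
    exact liouville_tan_not_hasConstantHSC hε h₀ h₁ hU hc.nonempty hp
  · intro _ _ hς hU hc hp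
    exact complex_linear_hasConstantHSC_iff hς hU hc.nonempty hp
  · intro _ _ _ hβ hς hU hc hp
    exact complex_exp_hasConstantHSC_iff hβ hς hU hc.nonempty hp
  · intro _ _ hς hU hc hp
    exact complex_linear_exp_not_hasConstantHSC hς hU hc.nonempty hp
  · intro _ _ _ hς hU hc hp
    exact complex_tan_not_hasConstantHSC hς hU hc.nonempty hp
  · intro _ _ _ h₁ hU hc hp hG
    exact degenerate_inv_hasConstantHSC_iff h₁ hU hc hp hG
  · intro _ _ _ _ h₁ hd hU _ hG
    exact degenerate_exp_hasConstantHSC_iff h₁ hd hU hG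
  · intro _ _ _ _ _ hβ hβ' h₁ hd hU hc hG
    exact degenerate_exp_not_hasConstantHSC hβ hβ' h₁ hd hU hc.nonempty hG
  · intro _ _ _ h₁ hU hc hp hG
    exact degenerate_inv_exp_not_hasConstantHSC h₁ hU hc hp hG
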